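/- **Setting.** Let $\mathbb K$ be an at most countable index set, let $\mathcal X$ be a set, let $\kappa>0$, and let $(\phi_k)_{k\in\mathbb K}$ be functions $\mathcal X\to\mathbb R$ with $\sum_{k}|\phi_k(x)|^2\le\kappa^2$ for every $x\in\mathcal X$. For $u=(\mu_k)_k\in\ell^2(\mathbb K)$ put $f_u=\sum_k\mu_k\phi_k$ (pointwise). Let $1<r\le 2$, $r^*=r/(r-1)$, $\eta>0$, $\lambda>0$, $n\ge 1$, and let $(x_i,y_i)_{1\le i\le n}\in(\mathcal X\times\mathbb R)^n$. For every $k$ let $C_k\subset\mathbb R$ be a closed interval containing $0$; let $D_k\subset\mathbb R$ be a nonempty closed bounded interval, with $\sum_k \big((\inf D_k)_+\big)^{r^*}<\infty$ and $\sum_k\big((\sup D_k)_-\big)^{r^*}<\infty$; and let $h_k:\mathbb R\to[0,+\infty]$ be proper, lower semicontinuous and convex, with $h_k(0)=0$ and $h_k-\eta|\cdot|^r$ again proper, lower semicontinuous, convex and nonnegative. Let $g_k=\iota_{C_k}+\sigma_{D_k}+h_k$ (indicator function of $C_k$, support function of $D_k$) and, for $u=(\mu_k)_k\in\ell^2(\mathbb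 K)$, $$J(u)=\frac1n\sum_{i=1}^n|f_u(x_i)-y_i|^2+\lambda\sum_{k\in\mathbb K}g_k(\mu_k)\in\,]-\infty,+\infty].$$ Write $\operatorname{prox}_f w$ for the minimizer of $f+\frac12|\cdot-w|^2$ and $\operatorname{soft}_D=\mathrm{Id}-\operatorname{proj}_D$. Set $\|x\|_r=(\sum_k|x_k|^r)^{1/r}\in[0,+\infty]$. **Algorithm.** Let $0<\inf_m\gamma_m\le\sup_m\gamma_m<\lambda/\kappa^2$, $\tau_m\in\,]0,1]$ with $\inf_m\tau_m>0$, $b_m=(\beta_{m,k})_k\in\ell^2(\mathbb K)$ with $\sum_m\|b_m\|<\infty$, $\zeta>0$, $p>1$, $(\xi_k)_k\in\ell^1(\mathbb K)$, and $(\mu_{0,k})_k\in\ell^2(\mathbb K)$. For $m=0,1,\dots$ and every $k\in\mathbb K$ let $$\chi_{m,k}=\mu_{m,k}-\frac{\gamma_m}{\lambda}\Big(\frac2n\sum_{i=1}^n\Big(\sum_{j}\mu_{m,j}\phi_j(x_i)-y_i\Big)\phi_k(x_i)+\beta_{m,k}\Big),\qquad t_{m,k}=\operatorname{soft}_{\gamma_mD_k}\chi_{m,k},$$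 $$\pi_{m,k}=\operatorname{prox}_{\gamma_mh_k}t_{m,k}+\alpha_{m,k},\qquad \nu_{m,k}=\operatorname{proj}_{C_k}\big(\operatorname{sign}(t_{m,k})\max\{0,\operatorname{sign}(t_{m,k})\pi_{m,k}\}\big),$$ $$\mu_{m+1,k}=\mu_{m,k}+\tau_m(\nu_{m,k}-\mu_{m,k}),$$ where the errors $\alpha_{m,k}\in\mathbb R$ satisfy $$|\alpha_{m,k}|\le\frac{\zeta\,\max\{m,1\}^{-2p}\,\xi_k}{4\gamma_m\max\{h_k(|\chi_{m,k}|+2),h_k(-|\chi_{m,k}|-2)\}+2|\chi_{m,k}|+1}$$ (the right side being $0$ if the denominator is $+\infty$) and, for those $k$ for which $h_k$ takes the value $+\infty$, in addition $\alpha_{m,k}=0$ or both $0\in D_k$ and $|\alpha_{m,k}|\le1$. Put $u_m=(\mu_{m,k})_k$ and $v_m=(\nu_{m,k})_k$. **Theorem.** 1. $J$ never takes the value $-\infty$ and has a unique minimizer $\widehat u$ over $\ell^2(\mathbb K)$; $J(\widehat u)<+\infty$ and $\widehat u\in\ell^r(\mathbb K)$. 2. For every sequence generated by the algorithm, $u_m,v_m\in\ell^2(\mathbb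 K)$ for all $m$, $\sum_m|J(v_m)-\inf J|^2<\infty$, $\|v_m-\widehat u\|_r\to0$, $\|v_m-\widehat u\|_r=O\big(\sqrt{J(v_m)-\inf J}\big)$ and $\|u_m-\widehat u\|_r=O\big(\sqrt{J(u_m)-\inf J}\big)$ (an inequality in $[0,+\infty]$). If $J(u_M)<+\infty$ for some $M$ (for instance $M=0$), then $J(u_m)\to\inf J$. If $J(u_M)<+\infty$ or $u_M\in\ell^r(\mathbb K)$ for some $M$, then $\|u_m-\widehat u\|_r\to0$. 3. If $\sum_m(1-\tau_m)<\infty$, then $\sum_m(J(v_m)-\inf J)<\infty$, and $\sum_{m\ge M}(J(u_m)-\inf J)<\infty$ for every $M$ with $J(u_M)<+\infty$. 4. If $p>2$, $\sum_m(1-\tau_m)<\infty$, $\sum_m m\|b_m\|<\infty$, and $J(u_M)<+\infty$ for some $M$, then $J(u_m)-\inf J=o(1/m)$ and $\|u_m-\widehat u\|_r=o(1/\sqrt m)$. -/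

import Mathlib

open Filter Topology
open scoped ENNReal NNReal

noncomputable section

/-- The class of proper lower semicontinuous convex functions on `ℝ` with values
in `[0, +∞]`. -/
structure IsGammaZeroPlus (f : ℝ → ℝ≥0∞) : Prop where
  proper : ∃ t, f t ≠ ⊤
  lsc : LowerSemicontinuous f
  convex : ∀ s t a b : ℝ, 0 ≤ a → 0 ≤ b → a + b = 1 →
    f (a * s + b * t) ≤ ENNReal.ofReal a * f s + ENNReal.ofReal b * f t

/-- `q = prox_f w`: the point `q` minimizes `s ↦ f s + |w - s|² / 2`. -/
def IsProx (f : ℝ → ℝ≥0∞) (w q : ℝ) : Prop :=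
  ∀ s : ℝ, f q + ENNReal.ofReal ((w - q) ^ 2 / 2) ≤ f s + ENNReal.ofReal ((w - s) ^ 2 / 2)

/-- `q = proj_C w`: the point `q` is a nearest point to `w` in `C`. -/
def IsProj (C : Set ℝ) (w q : ℝ) : Prop :=
  q ∈ C ∧ ∀ c ∈ C, |w - q| ≤ |w - c|

/-- The soft thresholder `Id - proj_{[a, b]}` with respect to `[a, b]`, for `a ≤ b`. -/
def softThreshold (a b t : ℝ) : ℝ := t - max a (min b t)

/-- The support function `t ↦ sup_{v ∈ [a, b]} v t` of `[a, b]`, for `a ≤ b`. -/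
def supportFun (a b t : ℝ) : ℝ := sSup ((fun v => v * t) '' Set.Icc a b)

/-- The sum of a family in `[-∞, +∞]`: the sum of the positive parts minus the sum of the
negative parts. It is only used where the negative parts have a finite sum. -/
def extSum {K : Type*} (f : K → EReal) : EReal :=
  ((∑' k, (f k).toENNReal : ℝ≥0∞) : EReal) - ((∑' k, (-(f k)).toENNReal : ℝ≥0∞) : EReal)

/-- The `ℓ^r` norm as an extended number: it is `+∞` off `ℓ^r`. -/
def lrENorm {K : Type*} (r : ℝ) (x : K → ℝ) : ℝ≥0∞ := (∑' k, ‖x k‖ₑ ^ r) ^ (1 / r)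

/-- The real Hilbert space `ℓ²(K)`. -/
abbrev EllTwo (K : Type*) := lp (fun _ : K => ℝ) 2

/-- The data of the regularized empirical problem: dictionary `phi`, its bound `kappa`,
the exponent `r` and the modulus `eta`, the intervals `C k` and `D k = [dlo k, dhi k]`, the
functions `h k`, the regularization parameter `lam`, and the training set `(x i, y i)`. -/
structure Setting (K X : Type*) where
  phi : K → X → ℝ
  kappa : ℝ
  r : ℝ
  eta : ℝ
  C : K → Set ℝ
  dlo : K → ℝ
  dhi : K → ℝ
  h : K → ℝ → ℝ≥0∞
  lam : ℝ
  n : ℕ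
  x : Fin n → X
  y : Fin n → ℝ

namespace Setting

variable {K X : Type*} (S : Setting K X)

/-- The standing assumptions on the data. The exponent `r / (r - 1)` is the conjugate of `r`,
and the last clause says that `h k - eta |·|^r` is proper, lsc, convex and nonnegative. -/
structure Standing : Prop where
  kappa_pos : 0 < S.kappa
  phi_bound : ∀ x, Summable (fun k => S.phi k x ^ 2) ∧ ∑' k, S.phi k x ^ 2 ≤ S.kappa ^ 2
  one_lt_r : 1 < S.r
  r_le_two : S.r ≤ 2
  eta_pos : 0 < S.eta
  lam_pos : 0 < S.lam
  n_pos : 0 < S.n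
  C_closed : ∀ k, IsClosed (S.C k)
  C_interval : ∀ k, (S.C k).OrdConnected
  zero_mem_C : ∀ k, (0 : ℝ) ∈ S.C k
  dlo_le_dhi : ∀ k, S.dlo k ≤ S.dhi k
  dlo_summable : Summable fun k => (max (S.dlo k) 0) ^ (S.r / (S.r - 1))
  dhi_summable : Summable fun k => (max (-(S.dhi k)) 0) ^ (S.r / (S.r - 1))
  h_gamma : ∀ k, IsGammaZeroPlus (S.h k)
  h_zero : ∀ k, S.h k 0 = 0
  h_sub_power : ∀ k, ∃ f : ℝ → ℝ≥0∞, IsGammaZeroPlus f ∧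
    ∀ t, S.h k t = f t + ENNReal.ofReal (S.eta * |t| ^ S.r)

open Classical in
/-- `g_k = ι_{C_k} + σ_{D_k} + h_k`. -/
def g (k : K) (t : ℝ) : EReal :=
  (if t ∈ S.C k then 0 else ⊤) + (supportFun (S.dlo k) (S.dhi k) t : EReal)
    + (S.h k t : EReal)

/-- `G(u) = ∑ₖ g_k(u_k)`. -/
def G (u : EllTwo K) : EReal := extSum fun k => S.g k (u k)

/-- The value at a point of `f_u = ∑ₖ u_k φ_k`. -/
def predict (u : K → ℝ) (x : X) : ℝ := ∑' k, u k * S.phi k x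

/-- The objective `J(u) = (1/n) ∑ᵢ |f_u(x_i) - y_i|² + λ G(u)`. -/
def J (u : EllTwo K) : EReal :=
  ((1 / (S.n : ℝ) * ∑ i, |S.predict u (S.x i) - S.y i| ^ 2 : ℝ) : EReal)
    + (S.lam : EReal) * S.G u

/-- The objective gap `J(u) - inf J`, in `[0, +∞]`. -/
def gap (u : EllTwo K) : ℝ≥0∞ := (S.J u - ⨅ w, S.J w).toENNReal

end Setting

/-- Parameters of the algorithm: step sizes, relaxations, gradient errors, and the
constants of the error tolerance. -/
structure AlgParams (K : Type*) where
  gam : ℕ → ℝ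
  tau : ℕ → ℝ
  b : ℕ → EllTwo K
  zeta : ℝ
  p : ℝ
  xi : K → ℝ

/-- The standing assumptions on the parameters of the algorithm. -/
structure AlgParams.Admissible {K X : Type*} (P : AlgParams K) (S : Setting K X) : Prop where
  gam_bounds : ∃ lo hi : ℝ, 0 < lo ∧ hi < S.lam / S.kappa ^ 2 ∧
    ∀ m, lo ≤ P.gam m ∧ P.gam m ≤ hi
  tau_bounds : ∃ lo : ℝ, 0 < lo ∧ ∀ m, lo ≤ P.tau m ∧ P.tau m ≤ 1
  b_summable : Summable fun m => ‖P.b m‖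
  zeta_pos : 0 < P.zeta
  one_lt_p : 1 < P.p
  xi_summable : Summable P.xi

/-- The real families computed by the algorithm (iteration `m`, component `k`): iterates
`mu` and `nu`, forward points `chi`, soft-thresholded points `thr`, exact proximal points
`prx`, errors `alpha`, and inexact proximal points `pii`. -/
structure AlgFamilies (K : Type*) where
  mu : ℕ → K → ℝ
  nu : ℕ → K → ℝ
  chi : ℕ → K → ℝ
  thr : ℕ → K → ℝ
  prx : ℕ → K → ℝ
  alpha : ℕ → K → ℝ
  pii : ℕ → K → ℝ

/-- The families are generated by the inexact componentwise proximal thresholding algorithm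
started at a point of `ℓ²(K)`. -/
structure AlgFamilies.IsRun {K X : Type*} (R : AlgFamilies K) (S : Setting K X)
    (P : AlgParams K) : Prop where
  start : Memℓp (R.mu 0) 2
  chi_eq : ∀ m k, R.chi m k = R.mu m k - P.gam m / S.lam *
    (2 / (S.n : ℝ) * ∑ i, (S.predict (R.mu m) (S.x i) - S.y i) * S.phi k (S.x i) + P.b m k)
  /-- With the convention `c / ∞ = 0`; at `m = 0` the factor `m ^ (-2p)` is read as `1`. -/
  alpha_le : ∀ m k, ENNReal.ofReal |R.alpha m k| ≤
    ENNReal.ofReal (P.zeta * ((max m 1 : ℕ) : ℝ) ^ (-2 * P.p) * P.xi k) /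
      (4 * ENNReal.ofReal (P.gam m) *
          max (S.h k (|R.chi m k| + 2)) (S.h k (-|R.chi m k| - 2))
        + ENNReal.ofReal (2 * |R.chi m k| + 1))
  /-- Void if `h k` is finite; otherwise a nonzero error must be at most `1` in absolute
  value and requires `0 ∈ D k`. -/
  alpha_dom : ∀ m k, (∀ t, S.h k t ≠ ⊤) ∨ R.alpha m k = 0 ∨
    ((0 : ℝ) ∈ Set.Icc (S.dlo k) (S.dhi k) ∧ |R.alpha m k| ≤ 1)
  thr_eq : ∀ m k, R.thr m k =
    softThreshold (P.gam m * S.dlo k) (P.gam m * S.dhi k) (R.chi m k)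
  prx_spec : ∀ m k,
    IsProx (fun t => ENNReal.ofReal (P.gam m) * S.h k t) (R.thr m k) (R.prx m k)
  pii_eq : ∀ m k, R.pii m k = R.prx m k + R.alpha m k
  nu_spec : ∀ m k, IsProj (S.C k)
    (Real.sign (R.thr m k) * max 0 (Real.sign (R.thr m k) * R.pii m k)) (R.nu m k)
  mu_succ : ∀ m k, R.mu (m + 1) k = R.mu m k + P.tau m * (R.nu m k - R.mu m k)

end

noncomputable section

open RealInnerProductSpace Setting

theorem rpow_sub_one_sub_le {r M x y : ℝ} (hr : 1 < r) (hr2 : r ≤ 2) (hx : 0 ≤ x) (hxy : x ≤ y)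
    (hy : y ≤ M) :
    (r - 1) * M ^ (r - 2) * (y - x) ≤ |y| ^ (r - 2) * y - |x| ^ (r - 2) * x := by
  rcases hxy.eq_or_lt with rfl | hlt
  · simp
  have hy0 : 0 < y := hx.trans_lt hlt
  rw [abs_of_pos hy0, abs_of_nonneg hx]
  have e1 : ∀ z : ℝ, 0 ≤ z → z ^ (r - 2) * z = z ^ (r - 1) := by
    intro z hz
    rcases hz.eq_or_lt with rfl | hz
    · rw [mul_zero, Real.zero_rpow (by linarith)]
    · rw [← Real.rpow_add_one hz.ne']; congr 1; ring
  rw [e1 x hx]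
  have hb : x ^ (r - 1) ≤ y ^ (r - 1) * (1 + (r - 1) * (x / y - 1)) := by
    have := rpow_one_add_le_one_add_mul_self (s := x / y - 1) (p := r - 1)
      (by have : 0 ≤ x / y := by positivity
          linarith) (by linarith) (by linarith)
    rw [add_sub_cancel, Real.div_rpow hx hy0.le, div_le_iff₀ (by positivity)] at this
    linarith
  have hm : M ^ (r - 2) ≤ y ^ (r - 2) := Real.rpow_le_rpow_of_nonpos hy0 hy (by linarith)
  have h2 : y ^ (r - 1) * (1 + (r - 1) * (x / y - 1))
      = y ^ (r - 2) * y - (r - 1) * y ^ (r - 2) * (y - x) := by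
    rw [← e1 y hy0.le]; field_simp; ring
  have : (r - 1) * M ^ (r - 2) * (y - x) ≤ (r - 1) * y ^ (r - 2) * (y - x) := by
    gcongr
  linarith

theorem monotone_slope_rpow {r M x y : ℝ} (hr : 1 < r) (hr2 : r ≤ 2) (hx : -M ≤ x) (hxy : x ≤ y)
    (hy : y ≤ M) :
    (r - 1) * M ^ (r - 2) * (y - x) ≤ |y| ^ (r - 2) * y - |x| ^ (r - 2) * x := by
  rcases le_total 0 x with h | h
  · exact rpow_sub_one_sub_le hr hr2 h hxy hy
  rcases le_total y 0 with h' | h'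
  · have := rpow_sub_one_sub_le (x := -y) (y := -x) (M := M) hr hr2 (by linarith) (by linarith)
      (by linarith)
    simp only [abs_neg] at this
    linarith
  · have h1 := rpow_sub_one_sub_le (x := 0) (y := -x) (M := M) hr hr2 le_rfl (by linarith)
      (by linarith)
    have h2 := rpow_sub_one_sub_le (x := 0) (y := y) (M := M) hr hr2 le_rfl h' hy
    simp only [abs_neg, mul_zero, sub_zero] at h1 h2
    linarith

/-- The function `|·|^r` is strongly convex on `[-M, M]`. -/
theorem convexOn_abs_rpow_sub_sq {r M : ℝ} (hr : 1 < r) (hr2 : r ≤ 2) :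
    ConvexOn ℝ (Set.Icc (-M) M)
      fun x : ℝ => |x| ^ r - r * (r - 1) * M ^ (r - 2) / 2 * x ^ 2 := by
  have hd : ∀ x : ℝ, HasDerivAt (fun x : ℝ => |x| ^ r - r * (r - 1) * M ^ (r - 2) / 2 * x ^ 2)
      (r * |x| ^ (r - 2) * x - r * (r - 1) * M ^ (r - 2) / 2 * (2 * x)) x := by
    intro x
    have h2 := ((hasDerivAt_id x).pow 2).const_mul (r * (r - 1) * M ^ (r - 2) / 2)
    simp only [id, Nat.cast_ofNat, Nat.add_one_sub_one, pow_one, mul_one] at h2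
    exact (hasDerivAt_abs_rpow x hr).sub h2
  refine MonotoneOn.convexOn_of_deriv (convex_Icc _ _)
    (fun x _ => (hd x).continuousAt.continuousWithinAt)
    (fun x _ => (hd x).differentiableAt.differentiableWithinAt) ?_
  intro x hx y hy hxy
  have hx := interior_subset hx
  have hy := interior_subset hy
  rw [(hd x).deriv, (hd y).deriv]
  have := mul_le_mul_of_nonneg_left (monotone_slope_rpow hr hr2 hx.1 hxy hy.2)
    (by linarith : 0 ≤ r)
  linarith

/-- The modulus of convexity of `|·|^r` at the pair `s, t`, up to a constant. -/
def powModulus (r s t : ℝ) : ℝ := (s - t) ^ 2 * (|s| + |t|) ^ (r - 2)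

theorem powModulus_nonneg (r s t : ℝ) : 0 ≤ powModulus r s t := by
  unfold powModulus; positivity

theorem abs_rpow_midpoint {r : ℝ} (hr : 1 < r) (hr2 : r ≤ 2) (s t : ℝ) :
    |(s + t) / 2| ^ r + r * (r - 1) / 8 * powModulus r s t ≤ (|s| ^ r + |t| ^ r) / 2 := by
  have hc := (convexOn_abs_rpow_sub_sq (M := |s| + |t|) hr hr2).2
    (show s ∈ Set.Icc _ _ from
      ⟨by linarith [neg_abs_le s, abs_nonneg t], by linarith [le_abs_self s, abs_nonneg t]⟩)
    (show t ∈ Set.Icc _ _ from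
      ⟨by linarith [neg_abs_le t, abs_nonneg s], by linarith [le_abs_self t, abs_nonneg s]⟩)
    (show (0 : ℝ) ≤ 1 / 2 by norm_num) (show (0 : ℝ) ≤ 1 / 2 by norm_num) (by norm_num)
  simp only [smul_eq_mul] at hc
  rw [show 1 / 2 * s + 1 / 2 * t = (s + t) / 2 by ring] at hc
  unfold powModulus
  linarith

theorem sq_sub_le_powModulus {r M s t : ℝ} (hr2 : r ≤ 2) (hM : |s| + |t| ≤ M) :
    (s - t) ^ 2 ≤ M ^ (2 - r) * powModulus r s t := by
  rcases (show 0 ≤ |s| + |t| by positivity).eq_or_lt with h | h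
  · have hs : s = 0 := abs_eq_zero.mp (by linarith [abs_nonneg s, abs_nonneg t])
    have ht : t = 0 := abs_eq_zero.mp (by linarith [abs_nonneg s, abs_nonneg t])
    simp [powModulus, hs, ht]
  · have h1 : (s - t) ^ 2 = (|s| + |t|) ^ (2 - r) * powModulus r s t := by
      unfold powModulus
      rw [mul_left_comm, ← Real.rpow_add h]; simp
    rw [h1]
    gcongr
    exact powModulus_nonneg r s t

theorem abs_sub_rpow_eq {r : ℝ} (hr : 1 < r) (s t : ℝ) :
    |s - t| ^ r = powModulus r s t ^ (r / 2) * ((|s| + |t|) ^ r) ^ (1 - r / 2) := by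
  rcases (show 0 ≤ |s| + |t| by positivity).eq_or_lt with h | h
  · have hs : s = 0 := abs_eq_zero.mp (by linarith [abs_nonneg s, abs_nonneg t])
    have ht : t = 0 := abs_eq_zero.mp (by linarith [abs_nonneg s, abs_nonneg t])
    simp [powModulus, hs, ht, Real.zero_rpow (by linarith : r ≠ 0),
      Real.zero_rpow (by linarith : r / 2 ≠ 0)]
  · unfold powModulus
    rw [Real.mul_rpow (by positivity) (by positivity), ← Real.rpow_mul h.le, ← Real.rpow_mul h.le,
      mul_assoc, ← Real.rpow_add h, ← sq_abs, ← Real.rpow_natCast, ← Real.rpow_mul (abs_nonneg _)]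
    rw [show (r - 2) * (r / 2) + r * (1 - r / 2) = 0 by ring]
    rw [Real.rpow_zero, mul_one]; congr 1; push_cast; ring

/-- Hölder's inequality for the difference of two families, in terms of the modulus. -/
theorem abs_sub_rpow_le {r X Y : ℝ} (hr : 1 < r) (hr2 : r ≤ 2) (hX : 0 < X) (hY : 0 < Y)
    (s t : ℝ) :
    |s - t| ^ r ≤ X ^ (r / 2) * Y ^ (1 - r / 2) *
      (r / 2 * (powModulus r s t / X) + (1 - r / 2) * ((|s| + |t|) ^ r / Y)) := by
  have hm := powModulus_nonneg r s t
  have h := Real.geom_mean_le_arith_mean2_weighted (w₁ := r / 2) (w₂ := 1 - r / 2)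
    (p₁ := powModulus r s t / X) (p₂ := (|s| + |t|) ^ r / Y) (by linarith) (by linarith)
    (by positivity) (by positivity) (by ring)
  refine le_trans (le_of_eq ?_) (mul_le_mul_of_nonneg_left h (by positivity))
  rw [abs_sub_rpow_eq hr, Real.div_rpow hm hX.le, Real.div_rpow (by positivity) hY.le]
  field_simp

theorem convex_abs_rpow {r : ℝ} (hr : 1 < r) {a b : ℝ} (ha : 0 ≤ a) (hb : 0 ≤ b)
    (hab : a + b = 1) (s t : ℝ) : |a * s + b * t| ^ r ≤ a * |s| ^ r + b * |t| ^ r := by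
  have h1 : |a * s + b * t| ≤ a * |s| + b * |t| := by
    refine (abs_add_le _ _).trans ?_
    rw [abs_mul, abs_mul, abs_of_nonneg ha, abs_of_nonneg hb]
  refine (Real.rpow_le_rpow (abs_nonneg _) h1 (by linarith)).trans ?_
  have := (convexOn_rpow hr.le).2 (Set.mem_Ici.mpr (abs_nonneg s))
    (Set.mem_Ici.mpr (abs_nonneg t)) ha hb hab
  simpa using this

/-- Young's inequality with a prescribed coefficient. -/
theorem exists_young_const {r eta : ℝ} (hr : 1 < r) (heta : 0 < eta) :
    ∃ A : ℝ, 0 ≤ A ∧ ∀ c t : ℝ, 0 ≤ c →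
      c * |t| ≤ eta * |t| ^ r + A * c ^ (r / (r - 1)) := by
  have hr0 : 0 < r := by linarith
  set l : ℝ := (eta * r) ^ (1 / r) with hl
  have hl0 : 0 < l := by positivity
  have hlr : l ^ r = eta * r := by
    rw [hl, ← Real.rpow_mul (by positivity)]; field_simp; simp
  refine ⟨(1 / l) ^ (r / (r - 1)) / (r / (r - 1)), by
    have : 0 < r - 1 := by linarith
    positivity, fun c t hc => ?_⟩
  have hpq : r.HolderConjugate (r / (r - 1)) := Real.HolderConjugate.conjExponent hr
  have h := Real.young_inequality_of_nonneg (a := l * |t|) (b := (1 / l) * c)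
    (by positivity) (by positivity) hpq
  rw [Real.mul_rpow hl0.le (abs_nonneg t), Real.mul_rpow (by positivity) hc, hlr] at h
  have e1 : l * |t| * (1 / l * c) = c * |t| := by field_simp
  have e2 : eta * r * |t| ^ r / r = eta * |t| ^ r := by field_simp
  rw [e1, e2] at h
  linarith [h, show (1 / l) ^ (r / (r - 1)) * c ^ (r / (r - 1)) / (r / (r - 1)) =
    (1 / l) ^ (r / (r - 1)) / (r / (r - 1)) * c ^ (r / (r - 1)) by ring]

theorem supportFun_eq {a b : ℝ} (hab : a ≤ b) (t : ℝ) : supportFun a b t = max (a * t) (b * t) := by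
  unfold supportFun
  apply IsLUB.csSup_eq _ ((Set.nonempty_Icc.mpr hab).image _)
  constructor
  · rintro _ ⟨v, hv, rfl⟩
    rcases le_total 0 t with h | h
    · exact le_max_of_le_right (mul_le_mul_of_nonneg_right hv.2 h)
    · exact le_max_of_le_left (mul_le_mul_of_nonpos_right hv.1 h)
  · intro w hw
    exact max_le (hw ⟨a, ⟨le_rfl, hab⟩, rfl⟩) (hw ⟨b, ⟨hab, le_rfl⟩, rfl⟩)

theorem continuous_supportFun {a b : ℝ} (hab : a ≤ b) : Continuous (supportFun a b) := by
  rw [show supportFun a b = fun t => max (a * t) (b * t) from funext (supportFun_eq hab)]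
  fun_prop

theorem supportFun_convex {a b : ℝ} (hab : a ≤ b) {p q : ℝ} (hp : 0 ≤ p) (hq : 0 ≤ q) (s t : ℝ) :
    supportFun a b (p * s + q * t) ≤ p * supportFun a b s + q * supportFun a b t := by
  simp only [supportFun_eq hab]
  apply max_le
  · nlinarith [mul_le_mul_of_nonneg_left (le_max_left (a * s) (b * s)) hp,
      mul_le_mul_of_nonneg_left (le_max_left (a * t) (b * t)) hq]
  · nlinarith [mul_le_mul_of_nonneg_left (le_max_right (a * s) (b * s)) hp,
      mul_le_mul_of_nonneg_left (le_max_right (a * t) (b * t)) hq]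

theorem supportFun_lower {a b : ℝ} (hab : a ≤ b) (t : ℝ) :
    -((max a 0 + max (-b) 0) * |t|) ≤ supportFun a b t := by
  rw [supportFun_eq hab]
  have h1 := le_max_left a 0
  have h2 := le_max_right a 0
  have h3 := le_max_left (-b) 0
  have h4 := le_max_right (-b) 0
  rcases le_total 0 t with h | h
  · apply le_max_of_le_right
    rw [abs_of_nonneg h]
    nlinarith
  · apply le_max_of_le_left
    rw [abs_of_nonpos h]
    nlinarith

/-- Convexity, with a gain, of a sum of an indicator, a convex function and a real function. -/
theorem indicator_add_convex {C : Set ℝ} [DecidablePred (· ∈ C)] (hC : C.OrdConnected)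
    {f : ℝ → ℝ≥0∞} (hf : IsGammaZeroPlus f) {rho : ℝ → ℝ} (hrho : ∀ t, 0 ≤ rho t)
    {a b s t e : ℝ} (ha : 0 < a) (hb : 0 < b) (hab : a + b = 1) (he : 0 ≤ e)
    (hr : rho (a * s + b * t) + e ≤ a * rho s + b * rho t) :
    (if a * s + b * t ∈ C then 0 else ⊤) + f (a * s + b * t) + ENNReal.ofReal (rho (a * s + b * t))
        + ENNReal.ofReal e
      ≤ ENNReal.ofReal a * ((if s ∈ C then 0 else ⊤) + f s + ENNReal.ofReal (rho s))
        + ENNReal.ofReal b * ((if t ∈ C then 0 else ⊤) + f t + ENNReal.ofReal (rho t)) := by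
  by_cases hs : s ∈ C
  swap
  · simp [hs, ENNReal.mul_top, ha]
  by_cases ht : t ∈ C
  swap
  · simp [ht, ENNReal.mul_top, hb]
  have hm : a * s + b * t ∈ C := by
    have := hC.convex hs ht ha.le hb.le hab
    simpa using this
  simp only [hs, ht, hm, if_true, zero_add, mul_add]
  have h1 := hf.convex s t a b ha.le hb.le hab
  have h2 : ENNReal.ofReal (rho (a * s + b * t)) + ENNReal.ofReal e
      ≤ ENNReal.ofReal a * ENNReal.ofReal (rho s) + ENNReal.ofReal b * ENNReal.ofReal (rho t) := by
    rw [← ENNReal.ofReal_mul ha.le, ← ENNReal.ofReal_mul hb.le,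
      ← ENNReal.ofReal_add (hrho _) he, ← ENNReal.ofReal_add]
    · exact ENNReal.ofReal_le_ofReal hr
    · exact mul_nonneg ha.le (hrho s)
    · exact mul_nonneg hb.le (hrho t)
  calc _ = f (a * s + b * t) + (ENNReal.ofReal (rho (a * s + b * t)) + ENNReal.ofReal e) := by
        ring
    _ ≤ _ := add_le_add h1 h2
    _ = _ := by ring

theorem EReal.coe_add_toENNReal_neg {x : EReal} {g : ℝ≥0∞} {A : ℝ} (hA : 0 ≤ A)
    (hx : x = (g : EReal) - (A : EReal)) :
    g + (-x).toENNReal = x.toENNReal + ENNReal.ofReal A := by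
  subst hx
  induction g using ENNReal.recTopCoe with
  | top => simp
  | coe g =>
    have e : (((g : ℝ≥0) : ℝ≥0∞) : EReal) - (A : EReal) = ((g - A : ℝ) : EReal) := by
      rw [EReal.coe_sub]; rfl
    rw [e, ← EReal.coe_neg, EReal.toENNReal_of_ne_top (EReal.coe_ne_top _),
      EReal.toENNReal_of_ne_top (EReal.coe_ne_top _), EReal.toReal_coe, EReal.toReal_coe,
      ← ENNReal.ofReal_coe_nnreal]
    rcases le_total (g : ℝ) A with h | h
    · rw [ENNReal.ofReal_of_nonpos (by linarith : (g : ℝ) - A ≤ 0), zero_add,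
        ← ENNReal.ofReal_add g.coe_nonneg (by linarith)]
      congr 1; ring
    · rw [ENNReal.ofReal_of_nonpos (by linarith : -((g : ℝ) - A) ≤ 0), add_zero,
        ← ENNReal.ofReal_add (by linarith) hA]
      congr 1; ring

theorem EReal.toENNReal_neg_le {x : EReal} {g : ℝ≥0∞} {A : ℝ}
    (hx : x = (g : EReal) - (A : EReal)) : (-x).toENNReal ≤ ENNReal.ofReal A := by
  subst hx
  induction g using ENNReal.recTopCoe with
  | top => simp
  | coe g =>
    have e : (((g : ℝ≥0) : ℝ≥0∞) : EReal) - (A : EReal) = ((g - A : ℝ) : EReal) := by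
      rw [EReal.coe_sub]; rfl
    rw [e, ← EReal.coe_neg, EReal.toENNReal_of_ne_top (EReal.coe_ne_top _), EReal.toReal_coe]
    exact ENNReal.ofReal_le_ofReal (by linarith [g.coe_nonneg])

theorem extSum_eq_sub {K : Type*} {f : K → EReal} {gp : K → ℝ≥0∞} {A : K → ℝ} (hA : ∀ k, 0 ≤ A k)
    (hAs : Summable A) (hf : ∀ k, f k = (gp k : EReal) - (A k : EReal)) :
    extSum f = ((∑' k, gp k : ℝ≥0∞) : EReal) - ((∑' k, A k : ℝ) : EReal) := by
  have hsum : ∑' k, gp k + ∑' k, (-(f k)).toENNReal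
      = ∑' k, (f k).toENNReal + ENNReal.ofReal (∑' k, A k) := by
    rw [ENNReal.ofReal_tsum_of_nonneg hA hAs, ← ENNReal.tsum_add, ← ENNReal.tsum_add]
    exact tsum_congr fun k => EReal.coe_add_toENNReal_neg (hA k) (hf k)
  have hneg : ∑' k, (-(f k)).toENNReal ≤ ENNReal.ofReal (∑' k, A k) := by
    rw [ENNReal.ofReal_tsum_of_nonneg hA hAs]
    refine ENNReal.tsum_le_tsum fun k => ?_
    exact EReal.toENNReal_neg_le (hf k)
  have hneg' : ∑' k, (-(f k)).toENNReal ≠ ⊤ := ne_top_of_le_ne_top ENNReal.ofReal_ne_top hneg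
  have h0 : 0 ≤ ∑' k, A k := tsum_nonneg hA
  unfold extSum
  lift ∑' k, (-(f k)).toENNReal to ℝ≥0 using hneg' with N
  generalize ∑' k, gp k = P at *
  generalize ∑' k, (f k).toENNReal = Q at *
  generalize ∑' k, A k = B at *
  induction P using ENNReal.recTopCoe with
  | top =>
    have : Q = ⊤ := by
      by_contra hQ
      rw [top_add] at hsum
      exact ENNReal.add_ne_top.mpr ⟨hQ, ENNReal.ofReal_ne_top⟩ hsum.symm
    subst this
    rfl
  | coe P =>
    induction Q using ENNReal.recTopCoe with
    | top =>
      rw [top_add] at hsum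
      exact absurd hsum (by simp)
    | coe Q =>
      have := congrArg ENNReal.toReal hsum
      rw [ENNReal.toReal_add (by simp) (by simp), ENNReal.toReal_add (by simp) (by simp),
        ENNReal.toReal_ofReal h0] at this
      simp only [ENNReal.coe_toReal] at this
      change ((Q : ℝ) : EReal) - ((N : ℝ) : EReal) = ((P : ℝ) : EReal) - (B : EReal)
      rw [← EReal.coe_sub, ← EReal.coe_sub]
      congr 1; linarith

namespace Setting

variable {K X : Type*} (S : Setting K X)

/-- A nonnegative, convex and coercive shift `gp k = g_k + A k` of the functions `g_k`, with
summable constants `A k`. -/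
structure IsNormalization (A : K → ℝ) (gp : K → ℝ → ℝ≥0∞) : Prop where
  nonneg : ∀ k, 0 ≤ A k
  summable : Summable A
  g_eq : ∀ k t, S.g k t = (gp k t : EReal) - (A k : EReal)
  lsc : ∀ k, LowerSemicontinuous (gp k)
  convex : ∀ k (s t a b : ℝ), 0 < a → 0 < b → a + b = 1 →
    gp k (a * s + b * t) ≤ ENNReal.ofReal a * gp k s + ENNReal.ofReal b * gp k t
  midpoint : ∀ k (s t : ℝ), gp k (1 / 2 * s + 1 / 2 * t) +
      ENNReal.ofReal (S.eta * (S.r * (S.r - 1) / 8) * powModulus S.r s t)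
    ≤ ENNReal.ofReal (1 / 2) * gp k s + ENNReal.ofReal (1 / 2) * gp k t
  lower : ∀ k t, ENNReal.ofReal (S.eta / 2 * |t| ^ S.r) ≤ gp k t
  zero : ∀ k, gp k 0 = ENNReal.ofReal (A k)
  ne_top_iff : ∀ k t, gp k t ≠ ⊤ ↔ t ∈ S.C k ∧ S.h k t ≠ ⊤
  toReal : ∀ k t, t ∈ S.C k → S.h k t ≠ ⊤ →
    (gp k t).toReal = (S.h k t).toReal + supportFun (S.dlo k) (S.dhi k) t + A k

variable {S}

theorem Standing.summable_dual (hS : S.Standing) :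
    Summable fun k => (max (S.dlo k) 0 + max (-(S.dhi k)) 0) ^ (S.r / (S.r - 1)) := by
  have h1 := hS.one_lt_r
  have hpos : 0 < S.r / (S.r - 1) := div_pos (by linarith) (by linarith)
  refine (hS.dlo_summable.add hS.dhi_summable).congr fun k => ?_
  have := hS.dlo_le_dhi k
  rcases le_total (S.dlo k) 0 with h | h
  · rw [max_eq_right h, Real.zero_rpow hpos.ne', zero_add, zero_add]
  · rw [max_eq_right (by linarith : -(S.dhi k) ≤ 0), Real.zero_rpow hpos.ne', add_zero, add_zero]

open Classical in
theorem Standing.exists_normalization (hS : S.Standing) :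
    ∃ (A : K → ℝ) (gp : K → ℝ → ℝ≥0∞), S.IsNormalization A gp := by
  have hr := hS.one_lt_r
  have hr2 := hS.r_le_two
  have heta := hS.eta_pos
  obtain ⟨A0, hA0, hY⟩ := exists_young_const (eta := S.eta / 2) hr (by linarith)
  choose f hf hfh using hS.h_sub_power
  set c : K → ℝ := fun k => max (S.dlo k) 0 + max (-(S.dhi k)) 0 with hc
  have hc0 : ∀ k, 0 ≤ c k := fun k => add_nonneg (le_max_right _ _) (le_max_right _ _)
  set A : K → ℝ := fun k => A0 * c k ^ (S.r / (S.r - 1)) with hA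
  have hAn : ∀ k, 0 ≤ A k := fun k => mul_nonneg hA0 (Real.rpow_nonneg (hc0 k) _)
  set rho : K → ℝ → ℝ := fun k t =>
    supportFun (S.dlo k) (S.dhi k) t + S.eta * |t| ^ S.r + A k with hrho
  have hlow : ∀ k t, S.eta / 2 * |t| ^ S.r ≤ rho k t := by
    intro k t
    have h1 := supportFun_lower (hS.dlo_le_dhi k) t
    have h2 := hY (c k) t (hc0 k)
    simp only [hrho, hA]
    simp only [hc] at h2 ⊢
    linarith
  have hrho0 : ∀ k t, 0 ≤ rho k t := fun k t => le_trans (by positivity) (hlow k t)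
  have hconv : ∀ k (s t a b : ℝ), 0 < a → 0 < b → a + b = 1 →
      rho k (a * s + b * t) + 0 ≤ a * rho k s + b * rho k t := by
    intro k s t a b ha hb hab
    have h1 := supportFun_convex (hS.dlo_le_dhi k) ha.le hb.le s t
    have h2 := mul_le_mul_of_nonneg_left (convex_abs_rpow hr ha.le hb.le hab s t) heta.le
    have h3 : A k = a * A k + b * A k := by rw [← add_mul, hab, one_mul]
    simp only [hrho]
    linarith
  have hmid : ∀ k (s t : ℝ), rho k (1 / 2 * s + 1 / 2 * t) +
      S.eta * (S.r * (S.r - 1) / 8) * powModulus S.r s t ≤ 1 / 2 * rho k s + 1 / 2 * rho k t := by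
    intro k s t
    have h1 := supportFun_convex (hS.dlo_le_dhi k) (by norm_num : (0 : ℝ) ≤ 1 / 2)
      (by norm_num : (0 : ℝ) ≤ 1 / 2) s t
    have h2 := mul_le_mul_of_nonneg_left (abs_rpow_midpoint hr hr2 s t) heta.le
    rw [show (s + t) / 2 = 1 / 2 * s + 1 / 2 * t by ring] at h2
    simp only [hrho]
    linarith
  set gp : K → ℝ → ℝ≥0∞ := fun k t =>
    (if t ∈ S.C k then 0 else ⊤) + f k t + ENNReal.ofReal (rho k t) with hgp
  have hlsc : ∀ k, LowerSemicontinuous (gp k) := by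
    intro k
    have h1 : LowerSemicontinuous fun t => (if t ∈ S.C k then (0 : ℝ≥0∞) else ⊤) := by
      have := (hS.C_closed k).isOpen_compl.lowerSemicontinuous_indicator (y := (⊤ : ℝ≥0∞)) bot_le
      convert this using 2 with t
      by_cases ht : t ∈ S.C k <;> simp [ht]
    refine (h1.add (hf k).lsc).add (Continuous.lowerSemicontinuous ?_)
    refine ENNReal.continuous_ofReal.comp ?_
    refine ((continuous_supportFun (hS.dlo_le_dhi k)).add ?_).add continuous_const
    exact continuous_const.mul ((continuous_abs).rpow_const fun _ => Or.inr (by linarith))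
  have hne : ∀ k t, gp k t ≠ ⊤ ↔ t ∈ S.C k ∧ S.h k t ≠ ⊤ := by
    intro k t
    by_cases ht : t ∈ S.C k <;> simp [hgp, ht, hfh k t]
  refine ⟨A, gp, hAn, hS.summable_dual.mul_left A0, ?_, hlsc, ?_, ?_, ?_, ?_, hne, ?_⟩
  · intro k t
    unfold Setting.g
    by_cases ht : t ∈ S.C k
    · simp only [hgp, ht, if_true, zero_add]
      rw [hfh k t]
      rcases eq_or_ne (f k t) ⊤ with hft | hft
      · simp [hft]
      · lift f k t to ℝ≥0 using hft with F
        rw [← ENNReal.ofReal_coe_nnreal, ← ENNReal.ofReal_add F.coe_nonneg (by positivity),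
          ← ENNReal.ofReal_add F.coe_nonneg (hrho0 k t), EReal.coe_ennreal_ofReal, EReal.coe_ennreal_ofReal,
          max_eq_left (add_nonneg F.coe_nonneg (by positivity)), max_eq_left (add_nonneg F.coe_nonneg (hrho0 k t)),
          ← EReal.coe_add, ← EReal.coe_sub]
        congr 1
        simp only [hrho]; ring
    · have htop : gp k t = ⊤ := by simp [hgp, ht]
      rw [htop, if_neg ht, EReal.top_add_coe,
        EReal.top_add_of_ne_bot (EReal.coe_ennreal_ne_bot _)]
      rfl
  · intro k s t a b ha hb hab
    have := indicator_add_convex (hS.C_interval k) (hf k) (hrho0 k) ha hb hab le_rfl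
      (hconv k s t a b ha hb hab)
    simpa using this
  · intro k s t
    exact indicator_add_convex (hS.C_interval k) (hf k) (hrho0 k) (by norm_num) (by norm_num)
      (by norm_num) (mul_nonneg (mul_nonneg heta.le (by nlinarith)) (powModulus_nonneg _ _ _))
      (hmid k s t)
  · intro k t
    exact (ENNReal.ofReal_le_ofReal (hlow k t)).trans le_add_self
  · intro k
    have h0 : f k 0 = 0 := by
      have := hfh k 0
      rw [hS.h_zero k] at this
      exact (add_eq_zero.mp this.symm).1
    simp [hgp, hS.zero_mem_C k, h0, hrho, supportFun_eq (hS.dlo_le_dhi k),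
      Real.zero_rpow (by linarith : S.r ≠ 0)]
  · intro k t ht hh
    have hft : f k t ≠ ⊤ := by
      intro h; rw [hfh k t, h, top_add] at hh; exact hh rfl
    simp only [hgp, ht, if_true, zero_add]
    rw [hfh k t, ENNReal.toReal_add hft ENNReal.ofReal_ne_top,
      ENNReal.toReal_add hft ENNReal.ofReal_ne_top, ENNReal.toReal_ofReal (hrho0 k t),
      ENNReal.toReal_ofReal (by positivity)]
    simp only [hrho]; ring

end Setting

section LeastSquares

variable {E : Type*} [NormedAddCommGroup E] [InnerProductSpace ℝ E] {n : ℕ}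

/-- The empirical quadratic risk with feature vectors `Φ i` and targets `y i`. -/
def sqLoss (Φ : Fin n → E) (y : Fin n → ℝ) (u : E) : ℝ :=
  1 / (n : ℝ) * ∑ i, (⟪Φ i, u⟫ - y i) ^ 2

/-- The gradient of the empirical quadratic risk. -/
def sqLossGrad (Φ : Fin n → E) (y : Fin n → ℝ) (u : E) : E :=
  (2 / (n : ℝ)) • ∑ i, (⟪Φ i, u⟫ - y i) • Φ i

variable (Φ : Fin n → E) (y : Fin n → ℝ)

theorem sqLoss_nonneg (u : E) : 0 ≤ sqLoss Φ y u := by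
  unfold sqLoss; positivity

theorem continuous_sqLoss : Continuous (sqLoss Φ y) := by
  unfold sqLoss; fun_prop

theorem inner_sqLossGrad (u d : E) :
    ⟪sqLossGrad Φ y u, d⟫ = 2 / (n : ℝ) * ∑ i, (⟪Φ i, u⟫ - y i) * ⟪Φ i, d⟫ := by
  simp only [sqLossGrad, inner_smul_left, sum_inner, conj_trivial]

theorem sqLoss_expand (u v : E) : sqLoss Φ y v =
    sqLoss Φ y u + ⟪sqLossGrad Φ y u, v - u⟫ + 1 / (n : ℝ) * ∑ i, ⟪Φ i, v - u⟫ ^ 2 := by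
  rw [inner_sqLossGrad, sqLoss, sqLoss, show (2 : ℝ) / n = 1 / n * 2 by ring, mul_assoc, ← mul_add,
    ← mul_add]
  congr 1
  rw [Finset.mul_sum, ← Finset.sum_add_distrib, ← Finset.sum_add_distrib]
  refine Finset.sum_congr rfl fun i _ => ?_
  rw [inner_sub_right]; ring

variable {Φ} {kappa : ℝ}

theorem sum_inner_sq_le (hn : 0 < n) (hΦ : ∀ i, ‖Φ i‖ ≤ kappa) (d : E) :
    1 / (n : ℝ) * ∑ i, ⟪Φ i, d⟫ ^ 2 ≤ kappa ^ 2 * ‖d‖ ^ 2 := by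
  have h : ∑ i, ⟪Φ i, d⟫ ^ 2 ≤ ∑ _i : Fin n, kappa ^ 2 * ‖d‖ ^ 2 := by
    refine Finset.sum_le_sum fun i _ => ?_
    rw [← mul_pow, ← sq_abs]
    exact pow_le_pow_left₀ (abs_nonneg _) ((abs_real_inner_le_norm _ _).trans
      (mul_le_mul_of_nonneg_right (hΦ i) (norm_nonneg _))) 2
  have hn' : (0 : ℝ) < n := by exact_mod_cast hn
  rw [Finset.sum_const, Finset.card_univ, Fintype.card_fin, nsmul_eq_mul] at h
  rw [one_div, inv_mul_le_iff₀ hn']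
  exact h

theorem sqLoss_le (hn : 0 < n) (hΦ : ∀ i, ‖Φ i‖ ≤ kappa) (u v : E) : sqLoss Φ y v ≤
    sqLoss Φ y u + ⟪sqLossGrad Φ y u, v - u⟫ + kappa ^ 2 * ‖v - u‖ ^ 2 := by
  rw [sqLoss_expand Φ y u v]
  linarith [sum_inner_sq_le hn hΦ (v - u)]

variable (Φ) in
theorem le_sqLoss (u v : E) :
    sqLoss Φ y u + ⟪sqLossGrad Φ y u, v - u⟫ ≤ sqLoss Φ y v := by
  rw [sqLoss_expand Φ y u v]
  have : 0 ≤ 1 / (n : ℝ) * ∑ i, ⟪Φ i, v - u⟫ ^ 2 := by positivity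
  linarith

variable (Φ) in
theorem sqLoss_convex {a b : ℝ} (ha : 0 ≤ a) (hb : 0 ≤ b) (hab : a + b = 1) (u v : E) :
    sqLoss Φ y (a • u + b • v) ≤ a * sqLoss Φ y u + b * sqLoss Φ y v := by
  set w := a • u + b • v with hw
  have h1 := le_sqLoss Φ y w u
  have h2 := le_sqLoss Φ y w v
  have h3 : a * ⟪sqLossGrad Φ y w, u - w⟫ + b * ⟪sqLossGrad Φ y w, v - w⟫ = 0 := by
    rw [← real_inner_smul_right, ← real_inner_smul_right, ← inner_add_right]
    have : a • (u - w) + b • (v - w) = 0 := by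
      rw [smul_sub, smul_sub, show a • u - a • w + (b • v - b • w) = w - (a + b) • w by
        rw [hw]; module, hab, one_smul, sub_self]
    rw [this, inner_zero_right]
  have : sqLoss Φ y w = a * sqLoss Φ y w + b * sqLoss Φ y w := by rw [← add_mul, hab, one_mul]
  nlinarith [mul_le_mul_of_nonneg_left h1 ha, mul_le_mul_of_nonneg_left h2 hb]

/-- A form of the cocoercivity of the gradient of the quadratic risk. -/
theorem inner_sqLossGrad_sub_le (hn : 0 < n) (hΦ : ∀ i, ‖Φ i‖ ≤ kappa) (u w p : E) :
    ⟪w - p, sqLossGrad Φ y u - sqLossGrad Φ y w⟫ ≤ kappa ^ 2 / 2 * ‖u - p‖ ^ 2 := by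
  have h := sum_inner_sq_le hn hΦ (u - p)
  have key : ⟪w - p, sqLossGrad Φ y u - sqLossGrad Φ y w⟫
      ≤ 1 / 2 * (1 / (n : ℝ) * ∑ i, ⟪Φ i, u - p⟫ ^ 2) := by
    rw [real_inner_comm, inner_sub_left, inner_sqLossGrad, inner_sqLossGrad, ← mul_sub,
      ← Finset.sum_sub_distrib]
    have e : 1 / 2 * (1 / (n : ℝ) * ∑ i, ⟪Φ i, u - p⟫ ^ 2)
        = 2 / n * ∑ i, 1 / 4 * ⟪Φ i, u - p⟫ ^ 2 := by
      rw [← Finset.mul_sum]; ring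
    rw [e]
    refine mul_le_mul_of_nonneg_left (Finset.sum_le_sum fun i _ => ?_)
      (div_nonneg zero_le_two (Nat.cast_nonneg n))
    simp only [inner_sub_right]
    nlinarith [sq_nonneg ((⟪Φ i, u⟫ - ⟪Φ i, w⟫) - (⟪Φ i, u⟫ - ⟪Φ i, p⟫) / 2)]
  linarith

theorem norm_sqLossGrad_le (hn : 0 < n) (hΦ : ∀ i, ‖Φ i‖ ≤ kappa) (B : ℝ) :
    ∃ M : ℝ, ∀ u : E, ‖u‖ ≤ B → ‖sqLossGrad Φ y u‖ ≤ M := by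
  refine ⟨2 / n * ∑ i, (kappa * B + |y i|) * kappa, fun u hu => ?_⟩
  unfold sqLossGrad
  rw [norm_smul, Real.norm_of_nonneg (by positivity)]
  refine mul_le_mul_of_nonneg_left ((norm_sum_le _ _).trans (Finset.sum_le_sum fun i _ => ?_))
    (by positivity)
  have hk : 0 ≤ kappa := (norm_nonneg _).trans (hΦ i)
  rw [norm_smul]
  have h1 : ‖⟪Φ i, u⟫ - y i‖ ≤ kappa * B + |y i| := by
    refine (norm_sub_le _ _).trans (add_le_add ?_ le_rfl)
    exact (norm_inner_le_norm _ _).trans (mul_le_mul (hΦ i) hu (norm_nonneg _) hk)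
  exact mul_le_mul h1 (hΦ i) (norm_nonneg _) ((norm_nonneg _).trans h1)

theorem sqLoss_lipschitz_on_bounded (hn : 0 < n) (hΦ : ∀ i, ‖Φ i‖ ≤ kappa) (B : ℝ) :
    ∃ M : ℝ, 0 ≤ M ∧ ∀ u v : E, ‖v‖ ≤ B → sqLoss Φ y v - sqLoss Φ y u ≤ M * ‖v - u‖ := by
  obtain ⟨M, hM⟩ := norm_sqLossGrad_le y hn hΦ B
  refine ⟨max M 0, le_max_right _ _, fun u v hv => ?_⟩
  have h1 := le_sqLoss Φ y v u
  have h2 : -⟪sqLossGrad Φ y v, u - v⟫ ≤ max M 0 * ‖v - u‖ := by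
    rw [← inner_neg_right, neg_sub]
    exact (real_inner_le_norm _ _).trans (mul_le_mul_of_nonneg_right
      ((hM v hv).trans (le_max_left _ _)) (norm_nonneg _))
  linarith

end LeastSquares

theorem nonneg_of_forall_add_mul {X Q : ℝ} (h : ∀ θ : ℝ, 0 < θ → θ < 1 → 0 ≤ X + θ * Q) :
    0 ≤ X := by
  by_contra hX
  push Not at hX
  have hQ : 0 < |Q| + -X + 1 := by linarith [abs_nonneg Q]
  have h1 := h (-X / (2 * (|Q| + -X + 1))) (by apply div_pos <;> linarith)
    (by rw [div_lt_one (by linarith)]; linarith [abs_nonneg Q])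
  have h2 : -X / (2 * (|Q| + -X + 1)) * Q ≤ -X / 2 := by
    rw [div_mul_eq_mul_div, div_le_div_iff₀ (by linarith) (by norm_num)]
    nlinarith [le_abs_self Q]
  linarith

theorem EllTwo.summable_sq {K : Type*} (u : EllTwo K) : Summable fun k => u k ^ 2 := by
  have := lp.summable_inner (𝕜 := ℝ) u u
  refine this.congr fun k => ?_
  simp [sq]

theorem EllTwo.norm_sq {K : Type*} (u : EllTwo K) : ‖u‖ ^ 2 = ∑' k, u k ^ 2 := by
  rw [← real_inner_self_eq_norm_sq, lp.inner_eq_tsum]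
  refine tsum_congr fun k => ?_
  simp [sq]

theorem memℓp_two_of_summable_sq {K : Type*} {x : K → ℝ} (hx : Summable fun k => x k ^ 2) :
    Memℓp x 2 := by
  rw [memℓp_gen_iff (by norm_num)]
  simpa using hx

theorem EllTwo.continuous_apply {K : Type*} (k : K) : Continuous fun u : EllTwo K => u k :=
  (lp.evalCLM ℝ (fun _ : K => ℝ) 2 k).continuous

namespace Setting

variable {K X : Type*} {S : Setting K X}

/-- The feature vectors `(φ_k(x_i))_k`. -/
def Standing.feat (hS : S.Standing) (i : Fin S.n) : EllTwo K :=
  ⟨fun k => S.phi k (S.x i), memℓp_two_of_summable_sq (hS.phi_bound (S.x i)).1⟩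

theorem Standing.norm_feat_le (hS : S.Standing) (i : Fin S.n) : ‖hS.feat i‖ ≤ S.kappa := by
  refine le_of_sq_le_sq ?_ hS.kappa_pos.le
  rw [EllTwo.norm_sq]
  exact (hS.phi_bound (S.x i)).2

theorem Standing.predict_eq (hS : S.Standing) (u : EllTwo K) (i : Fin S.n) :
    S.predict u (S.x i) = ⟪hS.feat i, u⟫ := by
  rw [lp.inner_eq_tsum]
  exact tsum_congr fun k => by simp [Standing.feat]

/-- The data-fit term as a function on `ℓ²`. -/
def Standing.loss (hS : S.Standing) : EllTwo K → ℝ := sqLoss hS.feat S.y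

/-- The gradient of the data-fit term. -/
def Standing.grad (hS : S.Standing) : EllTwo K → EllTwo K := sqLossGrad hS.feat S.y

/-- The normalized separable penalty. -/
def Gsum (gp : K → ℝ → ℝ≥0∞) (u : EllTwo K) : ℝ≥0∞ := ∑' k, gp k (u k)

/-- The real-valued objective on the set where the penalty is finite. -/
def Standing.obj (hS : S.Standing) (A : K → ℝ) (gp : K → ℝ → ℝ≥0∞) (u : EllTwo K) : ℝ :=
  hS.loss u + S.lam * ((Gsum gp u).toReal - ∑' k, A k)

variable {A : K → ℝ} {gp : K → ℝ → ℝ≥0∞} (hS : S.Standing) (hN : S.IsNormalization A gp)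
include hS hN

theorem Standing.J_eq (u : EllTwo K) : S.J u =
    (hS.loss u : EReal) + (S.lam : EReal) * ((Gsum gp u : EReal) - ((∑' k, A k : ℝ) : EReal)) := by
  unfold Setting.J Setting.G
  rw [extSum_eq_sub hN.nonneg hN.summable (fun k => hN.g_eq k (u k))]
  simp only [hS.predict_eq, sq_abs]
  rfl

theorem Standing.J_eq_obj {u : EllTwo K} (hu : Gsum gp u ≠ ⊤) :
    S.J u = (hS.obj A gp u : EReal) := by
  rw [hS.J_eq hN, Standing.obj]
  have : (Gsum gp u : EReal) = ((Gsum gp u).toReal : EReal) := by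
    rw [EReal.coe_ennreal_toReal hu]
  rw [this]
  norm_cast

theorem Standing.J_eq_top {u : EllTwo K} (hu : Gsum gp u = ⊤) : S.J u = ⊤ := by
  rw [hS.J_eq hN, hu]
  have : ((⊤ : ℝ≥0∞) : EReal) - ((∑' k, A k : ℝ) : EReal) = ⊤ := rfl
  rw [this, EReal.coe_mul_top_of_pos hS.lam_pos]
  rfl

theorem Standing.J_ne_top_iff {u : EllTwo K} : S.J u ≠ ⊤ ↔ Gsum gp u ≠ ⊤ := by
  constructor
  · exact fun h h' => h (hS.J_eq_top hN h')
  · intro h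
    rw [hS.J_eq_obj hN h]
    exact EReal.coe_ne_top _

theorem Standing.J_ne_bot (u : EllTwo K) : S.J u ≠ ⊥ := by
  by_cases h : Gsum gp u = ⊤
  · rw [hS.J_eq_top hN h]; exact top_ne_bot
  · rw [hS.J_eq_obj hN h]; exact EReal.coe_ne_bot _

omit hS in
theorem IsNormalization.Gsum_zero : Gsum gp (0 : EllTwo K) = ENNReal.ofReal (∑' k, A k) := by
  unfold Gsum
  rw [ENNReal.ofReal_tsum_of_nonneg hN.nonneg hN.summable]
  exact tsum_congr fun k => by simpa using hN.zero k

omit hS in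
theorem IsNormalization.Gsum_convex (u v : EllTwo K) {a b : ℝ} (ha : 0 < a) (hb : 0 < b)
    (hab : a + b = 1) : Gsum gp (a • u + b • v) ≤
      ENNReal.ofReal a * Gsum gp u + ENNReal.ofReal b * Gsum gp v := by
  unfold Gsum
  rw [← ENNReal.tsum_mul_left, ← ENNReal.tsum_mul_left, ← ENNReal.tsum_add]
  exact ENNReal.tsum_le_tsum fun k => hN.convex k (u k) (v k) a b ha hb hab

omit hS in
theorem IsNormalization.Gsum_convex_toReal {u v : EllTwo K} (hu : Gsum gp u ≠ ⊤)
    (hv : Gsum gp v ≠ ⊤) {a b : ℝ} (ha : 0 < a) (hb : 0 < b) (hab : a + b = 1) :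
    Gsum gp (a • u + b • v) ≠ ⊤ ∧ (Gsum gp (a • u + b • v)).toReal ≤
      a * (Gsum gp u).toReal + b * (Gsum gp v).toReal := by
  have h := hN.Gsum_convex u v ha hb hab
  have h1 := ENNReal.mul_ne_top (ENNReal.ofReal_ne_top (r := a)) hu
  have h2 := ENNReal.mul_ne_top (ENNReal.ofReal_ne_top (r := b)) hv
  refine ⟨ne_top_of_le_ne_top (ENNReal.add_ne_top.mpr ⟨h1, h2⟩) h, ?_⟩
  have := ENNReal.toReal_mono (ENNReal.add_ne_top.mpr ⟨h1, h2⟩) h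
  rwa [ENNReal.toReal_add h1 h2, ENNReal.toReal_mul, ENNReal.toReal_mul,
    ENNReal.toReal_ofReal ha.le, ENNReal.toReal_ofReal hb.le] at this

theorem Standing.obj_convex {u v : EllTwo K} (hu : Gsum gp u ≠ ⊤)
    (hv : Gsum gp v ≠ ⊤) {a b : ℝ} (ha : 0 < a) (hb : 0 < b) (hab : a + b = 1) :
    hS.obj A gp (a • u + b • v) ≤ a * hS.obj A gp u + b * hS.obj A gp v := by
  have h1 := (hN.Gsum_convex_toReal hu hv ha hb hab).2
  have h2 := sqLoss_convex hS.feat S.y ha.le hb.le hab u v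
  have h3 := mul_le_mul_of_nonneg_left h1 hS.lam_pos.le
  have h4 : S.lam * ∑' k, A k = a * (S.lam * ∑' k, A k) + b * (S.lam * ∑' k, A k) := by
    rw [← add_mul, hab, one_mul]
  unfold Standing.obj Standing.loss
  linarith

/-- The sum of the moduli of convexity over the components. -/
def modSum (r : ℝ) (u v : EllTwo K) : ℝ≥0∞ := ∑' k, ENNReal.ofReal (powModulus r (u k) (v k))

omit hS hN in
theorem Standing.modulus_pos (hS : S.Standing) : 0 < S.eta * (S.r * (S.r - 1) / 8) := by
  have := hS.one_lt_r
  have := hS.eta_pos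
  have : 0 < S.r - 1 := by linarith
  positivity

theorem Standing.obj_midpoint {u v : EllTwo K} (hu : Gsum gp u ≠ ⊤) (hv : Gsum gp v ≠ ⊤) :
    modSum S.r u v ≠ ⊤ ∧ hS.obj A gp ((1 / 2 : ℝ) • u + (1 / 2 : ℝ) • v) +
        S.lam * (S.eta * (S.r * (S.r - 1) / 8)) * (modSum S.r u v).toReal
      ≤ 1 / 2 * hS.obj A gp u + 1 / 2 * hS.obj A gp v := by
  set c := S.eta * (S.r * (S.r - 1) / 8) with hc
  have hc0 : 0 < c := hS.modulus_pos
  have h : Gsum gp ((1 / 2 : ℝ) • u + (1 / 2 : ℝ) • v) + ENNReal.ofReal c * modSum S.r u v ≤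
      ENNReal.ofReal (1 / 2) * Gsum gp u + ENNReal.ofReal (1 / 2) * Gsum gp v := by
    unfold Gsum modSum
    rw [← ENNReal.tsum_mul_left, ← ENNReal.tsum_mul_left, ← ENNReal.tsum_mul_left,
      ← ENNReal.tsum_add, ← ENNReal.tsum_add]
    refine ENNReal.tsum_le_tsum fun k => ?_
    rw [← ENNReal.ofReal_mul hc0.le]
    exact hN.midpoint k (u k) (v k)
  have h1 := ENNReal.mul_ne_top (ENNReal.ofReal_ne_top (r := 1 / 2)) hu
  have h2 := ENNReal.mul_ne_top (ENNReal.ofReal_ne_top (r := 1 / 2)) hv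
  have h12 := ENNReal.add_ne_top.mpr ⟨h1, h2⟩
  obtain ⟨h3, h4⟩ := ENNReal.add_ne_top.mp (ne_top_of_le_ne_top h12 h)
  have hm : modSum S.r u v ≠ ⊤ := by
    intro hm
    rw [hm, ENNReal.mul_top (by simpa using hc0)] at h4
    exact h4 rfl
  refine ⟨hm, ?_⟩
  have h5 := ENNReal.toReal_mono h12 h
  rw [ENNReal.toReal_add h1 h2, ENNReal.toReal_add h3 h4, ENNReal.toReal_mul, ENNReal.toReal_mul,
    ENNReal.toReal_mul, ENNReal.toReal_ofReal hc0.le,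
    ENNReal.toReal_ofReal (by norm_num : (0 : ℝ) ≤ 1 / 2)] at h5
  have h6 := sqLoss_convex hS.feat S.y (a := 1 / 2) (b := 1 / 2) (by norm_num) (by norm_num)
    (by norm_num) u v
  have h7 := mul_le_mul_of_nonneg_left h5 hS.lam_pos.le
  unfold Standing.obj Standing.loss
  linarith

omit hS in
theorem IsNormalization.lowerSemicontinuous_Gsum : LowerSemicontinuous (Gsum gp) := by
  unfold Gsum
  exact lowerSemicontinuous_tsum fun k => (hN.lsc k).comp (EllTwo.continuous_apply k)

theorem Standing.abs_rpow_le_Gsum (u : EllTwo K) (hu : Gsum gp u ≠ ⊤) (k : K) :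
    S.eta / 2 * |u k| ^ S.r ≤ (Gsum gp u).toReal := by
  have h := (hN.lower k (u k)).trans (ENNReal.le_tsum (f := fun k => gp k (u k)) k)
  have h2 := ENNReal.toReal_mono hu h
  rwa [ENNReal.toReal_ofReal] at h2
  have := hS.eta_pos
  positivity

omit hN in
theorem Standing.Gsum_toReal_le (u : EllTwo K) :
    (Gsum gp u).toReal ≤ hS.obj A gp u / S.lam + ∑' k, A k := by
  have hl := hS.lam_pos
  have h0 : 0 ≤ hS.loss u := sqLoss_nonneg _ _ u
  unfold Standing.obj
  rw [add_div, mul_div_cancel_left₀ _ hl.ne']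
  have := div_nonneg h0 hl.le
  linarith

omit hN in
theorem Standing.norm_sub_sq_le_modSum {u v : EllTwo K} {M : ℝ} (hm : modSum S.r u v ≠ ⊤)
    (hM : ∀ k, |u k| + |v k| ≤ M) : ‖u - v‖ ^ 2 ≤ M ^ (2 - S.r) * (modSum S.r u v).toReal := by
  have hs : Summable fun k => powModulus S.r (u k) (v k) := by
    have := ENNReal.summable_toReal hm
    refine this.congr fun k => ENNReal.toReal_ofReal (powModulus_nonneg _ _ _)
  have e : (modSum S.r u v).toReal = ∑' k, powModulus S.r (u k) (v k) := by
    unfold modSum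
    rw [← ENNReal.ofReal_tsum_of_nonneg (fun k => powModulus_nonneg _ _ _) hs,
      ENNReal.toReal_ofReal (tsum_nonneg fun k => powModulus_nonneg _ _ _)]
  rw [EllTwo.norm_sq, e, ← tsum_mul_left]
  exact (EllTwo.summable_sq (u - v)).tsum_le_tsum
    (fun k => sq_sub_le_powModulus hS.r_le_two (hM k)) (hs.mul_left _)

theorem Standing.exists_minimizer :
    ∃ w : EllTwo K, Gsum gp w ≠ ⊤ ∧ ∀ v, Gsum gp v ≠ ⊤ → hS.obj A gp w ≤ hS.obj A gp v := by
  have hl := hS.lam_pos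
  have hr := hS.one_lt_r
  set T : Set ℝ := hS.obj A gp '' {u | Gsum gp u ≠ ⊤} with hT
  have hTne : T.Nonempty := ⟨_, 0, by
    rw [Set.mem_ofPred_eq, hN.Gsum_zero]; exact ENNReal.ofReal_ne_top, rfl⟩
  have hTb : BddBelow T := by
    refine ⟨-(S.lam * ∑' k, A k), ?_⟩
    rintro _ ⟨u, -, rfl⟩
    have h0 : 0 ≤ hS.loss u := sqLoss_nonneg _ _ u
    have h1 : 0 ≤ S.lam * (Gsum gp u).toReal := mul_nonneg hl.le ENNReal.toReal_nonneg
    unfold Standing.obj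
    linarith
  set I := sInf T with hI
  have hle : ∀ v, Gsum gp v ≠ ⊤ → I ≤ hS.obj A gp v := fun v hv => csInf_le hTb ⟨v, hv, rfl⟩
  have hseq : ∀ j : ℕ, ∃ w : EllTwo K, Gsum gp w ≠ ⊤ ∧ hS.obj A gp w < I + 1 / ((j : ℝ) + 1) := by
    intro j
    obtain ⟨_, ⟨w, hw, rfl⟩, hlt⟩ := exists_lt_of_csInf_lt hTne
      (show sInf T < I + 1 / ((j : ℝ) + 1) by linarith [Nat.one_div_pos_of_nat (α := ℝ) (n := j)])
    exact ⟨w, hw, hlt⟩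
  choose w hw hwlt using hseq
  set c := S.eta * (S.r * (S.r - 1) / 8) with hc
  have hc0 : 0 < c := hS.modulus_pos
  set B := ((I + 1) / S.lam + ∑' k, A k) with hB
  have hGB : ∀ j, (Gsum gp (w j)).toReal ≤ B := by
    intro j
    refine (hS.Gsum_toReal_le (A := A) (w j)).trans ?_
    have : (1 : ℝ) / ((j : ℝ) + 1) ≤ 1 := by
      rw [div_le_one (by positivity)]; linarith [Nat.cast_nonneg (α := ℝ) j]
    rw [hB]
    gcongr
    linarith [hwlt j]
  have hB0 : 0 ≤ B := ENNReal.toReal_nonneg.trans (hGB 0)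
  set M := (B / (S.eta / 2)) ^ (1 / S.r) with hM
  have heta := hS.eta_pos
  have hcoord : ∀ j k, |w j k| ≤ M := by
    intro j k
    have h1 := (hS.abs_rpow_le_Gsum hN (w j) (hw j) k).trans (hGB j)
    have h2 : |w j k| ^ S.r ≤ B / (S.eta / 2) := by
      rw [le_div_iff₀ (by positivity)]; linarith
    have h3 := Real.rpow_le_rpow (by positivity) h2 (by positivity : 0 ≤ 1 / S.r)
    rwa [← Real.rpow_mul (abs_nonneg _), mul_one_div_cancel (by linarith), Real.rpow_one] at h3
  set Q := (M + M) ^ (2 - S.r) / (S.lam * c) with hQ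
  have hM0 : 0 ≤ M := by positivity
  have hdist : ∀ i j N : ℕ, N ≤ i → N ≤ j → dist (w i) (w j) ≤ √(Q * (1 / ((N : ℝ) + 1))) := by
    intro i j N hi hj
    apply Real.le_sqrt_of_sq_le
    rw [dist_eq_norm]
    obtain ⟨hm, hmid⟩ := hS.obj_midpoint hN (hw i) (hw j)
    rw [← hc] at hmid
    have h1 := hS.norm_sub_sq_le_modSum hm (M := M + M)
      (fun k => add_le_add (hcoord i k) (hcoord j k))
    refine h1.trans ?_
    rw [hQ, div_mul_eq_mul_div, le_div_iff₀ (by positivity), mul_assoc]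
    refine mul_le_mul_of_nonneg_left ?_ (by positivity)
    have h2 := hle _ (hN.Gsum_convex_toReal (hw i) (hw j) (a := 1 / 2) (b := 1 / 2) (by norm_num)
      (by norm_num) (by norm_num)).1
    have h3 : 1 / ((i : ℝ) + 1) ≤ 1 / ((N : ℝ) + 1) := by gcongr
    have h4 : 1 / ((j : ℝ) + 1) ≤ 1 / ((N : ℝ) + 1) := by gcongr
    linarith [hwlt i, hwlt j]
  have hcau : CauchySeq w := by
    refine cauchySeq_of_le_tendsto_0 (fun N : ℕ => √(Q * (1 / ((N : ℝ) + 1)))) hdist ?_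
    have := (tendsto_one_div_add_atTop_nhds_zero_nat (𝕜 := ℝ)).const_mul Q
    simpa using this.sqrt
  obtain ⟨wh, hwh⟩ := cauchySeq_tendsto_of_complete hcau
  have hobj : Tendsto (fun j => hS.obj A gp (w j)) atTop (𝓝 I) := by
    have := (tendsto_one_div_add_atTop_nhds_zero_nat (𝕜 := ℝ)).const_add I
    rw [add_zero] at this
    exact tendsto_of_tendsto_of_tendsto_of_le_of_le tendsto_const_nhds this
      (fun j => hle _ (hw j)) (fun j => (hwlt j).le)
  have hloss : Tendsto (fun j => hS.loss (w j)) atTop (𝓝 (hS.loss wh)) :=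
    ((continuous_sqLoss hS.feat S.y).tendsto wh).comp hwh
  set g := (I - hS.loss wh) / S.lam + ∑' k, A k with hg
  have hG : Tendsto (fun j => (Gsum gp (w j)).toReal) atTop (𝓝 g) := by
    have := ((hobj.sub hloss).div_const S.lam).add_const (∑' k, A k)
    refine this.congr fun j => ?_
    unfold Standing.obj
    field_simp; ring
  have hGle : Gsum gp wh ≤ ENNReal.ofReal g := by
    refine le_of_forall_lt fun z hz => ?_
    obtain ⟨z', hz1, hz2⟩ := exists_between hz
    refine hz1.trans_le ?_
    refine ge_of_tendsto ((ENNReal.continuous_ofReal.tendsto g).comp hG) ?_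
    filter_upwards [hwh.eventually (hN.lowerSemicontinuous_Gsum wh z' hz2)] with j hj
    rw [Function.comp_apply, ENNReal.ofReal_toReal (hw j)]
    exact hj.le
  have hfin : Gsum gp wh ≠ ⊤ := ne_top_of_le_ne_top ENNReal.ofReal_ne_top hGle
  have hg0 : 0 ≤ g := ge_of_tendsto hG (Eventually.of_forall fun j => ENNReal.toReal_nonneg)
  refine ⟨wh, hfin, fun v hv => le_trans ?_ (hle v hv)⟩
  have h1 := ENNReal.toReal_mono ENNReal.ofReal_ne_top hGle
  rw [ENNReal.toReal_ofReal hg0] at h1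
  have h2 := mul_le_mul_of_nonneg_left h1 hl.le
  have h3 : S.lam * g = I - hS.loss wh + S.lam * ∑' k, A k := by
    rw [hg]; field_simp
  unfold Standing.obj
  linarith

end Setting

namespace Setting

variable {K X : Type*} {S : Setting K X}

variable {A : K → ℝ} {gp : K → ℝ → ℝ≥0∞} (hS : S.Standing) (hN : S.IsNormalization A gp)
include hS hN

theorem Standing.first_order {uh : EllTwo K} (huh : Gsum gp uh ≠ ⊤)
    (hmin : ∀ v, Gsum gp v ≠ ⊤ → hS.obj A gp uh ≤ hS.obj A gp v) {s : EllTwo K}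
    (hs : Gsum gp s ≠ ⊤) :
    0 ≤ ⟪hS.grad uh, s - uh⟫ + S.lam * ((Gsum gp s).toReal - (Gsum gp uh).toReal) := by
  refine nonneg_of_forall_add_mul (Q := S.kappa ^ 2 * ‖s - uh‖ ^ 2) fun θ h0 h1 => ?_
  obtain ⟨hw, hG⟩ := hN.Gsum_convex_toReal huh hs (a := 1 - θ) (b := θ) (by linarith) h0 (by ring)
  have h2 := hmin _ hw
  set w := (1 - θ) • uh + θ • s with hwdef
  have h3 := sqLoss_le S.y hS.n_pos hS.norm_feat_le uh w
  have e : w - uh = θ • (s - uh) := by rw [hwdef]; module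
  rw [e, real_inner_smul_right, norm_smul, Real.norm_of_nonneg h0.le] at h3
  have h4 := mul_le_mul_of_nonneg_left hG hS.lam_pos.le
  unfold Standing.obj Standing.loss at h2
  have h5 : 0 ≤ θ * (⟪hS.grad uh, s - uh⟫ + S.lam * ((Gsum gp s).toReal - (Gsum gp uh).toReal)
      + θ * (S.kappa ^ 2 * ‖s - uh‖ ^ 2)) := by
    unfold Standing.grad
    nlinarith
  exact nonneg_of_mul_nonneg_right h5 h0

theorem Standing.growth {uh : EllTwo K} (huh : Gsum gp uh ≠ ⊤)
    (hmin : ∀ v, Gsum gp v ≠ ⊤ → hS.obj A gp uh ≤ hS.obj A gp v) {s : EllTwo K}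
    (hs : Gsum gp s ≠ ⊤) :
    modSum S.r s uh ≠ ⊤ ∧ 2 * (S.lam * (S.eta * (S.r * (S.r - 1) / 8))) * (modSum S.r s uh).toReal
      ≤ hS.obj A gp s - hS.obj A gp uh := by
  obtain ⟨h1, h2⟩ := hS.obj_midpoint hN hs huh
  have h3 := hmin _ (hN.Gsum_convex_toReal hs huh (a := 1 / 2) (b := 1 / 2) (by norm_num)
      (by norm_num) (by norm_num)).1
  exact ⟨h1, by linarith⟩

theorem Standing.eq_of_obj_le {uh : EllTwo K} (huh : Gsum gp uh ≠ ⊤)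
    (hmin : ∀ v, Gsum gp v ≠ ⊤ → hS.obj A gp uh ≤ hS.obj A gp v) {s : EllTwo K}
    (hs : Gsum gp s ≠ ⊤) (hle : hS.obj A gp s ≤ hS.obj A gp uh) : s = uh := by
  obtain ⟨h1, h2⟩ := hS.growth hN huh hmin hs
  have h3 : (modSum S.r s uh).toReal = 0 := by
    have hp : 0 < 2 * (S.lam * (S.eta * (S.r * (S.r - 1) / 8))) := by
      have := hS.modulus_pos
      have := hS.lam_pos
      positivity
    have h4 : (0 : ℝ) ≤ (modSum S.r s uh).toReal := ENNReal.toReal_nonneg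
    by_contra hne
    have := mul_pos hp (lt_of_le_of_ne h4 (Ne.symm hne))
    linarith
  have h4 : modSum S.r s uh = 0 := by
    rcases (ENNReal.toReal_eq_zero_iff _).mp h3 with h | h
    · exact h
    · exact absurd h h1
  ext k
  have h5 := ENNReal.tsum_eq_zero.mp h4 k
  have h6 : powModulus S.r (s k) (uh k) = 0 :=
    le_antisymm (ENNReal.ofReal_eq_zero.mp h5) (powModulus_nonneg _ _ _)
  have h7 := sq_sub_le_powModulus hS.r_le_two (le_refl (|s k| + |uh k|))
  rw [h6, mul_zero] at h7
  have h8 : s k - uh k = 0 := by nlinarith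
  linarith

omit hN in
theorem Standing.add_abs_rpow_le (a b : ℝ) :
    (|a| + |b|) ^ S.r ≤ 2 ^ S.r * |a| ^ S.r + 2 ^ S.r * |b| ^ S.r := by
  have hr := hS.one_lt_r
  have h := convex_abs_rpow hr (a := 1 / 2) (b := 1 / 2) (by norm_num) (by norm_num) (by norm_num)
    (2 * |a|) (2 * |b|)
  rw [show 1 / 2 * (2 * |a|) + 1 / 2 * (2 * |b|) = |a| + |b| by ring,
    abs_of_nonneg (by positivity : 0 ≤ |a| + |b|), abs_mul, abs_mul, abs_abs, abs_abs,
    Real.mul_rpow (by positivity) (by positivity), Real.mul_rpow (by positivity) (by positivity),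
    abs_two] at h
  have h1 : 0 ≤ (2 : ℝ) ^ S.r * |a| ^ S.r := by positivity
  have h2 : 0 ≤ (2 : ℝ) ^ S.r * |b| ^ S.r := by positivity
  linarith

theorem Standing.tsum_abs_rpow_le (u : EllTwo K) :
    ∑' k, ENNReal.ofReal (|u k| ^ S.r) ≤ ENNReal.ofReal (2 / S.eta) * Gsum gp u := by
  have heta := hS.eta_pos
  unfold Gsum
  rw [← ENNReal.tsum_mul_left]
  refine ENNReal.tsum_le_tsum fun k => ?_
  refine le_trans (le_of_eq ?_) (mul_le_mul_right (hN.lower k (u k)) _)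
  rw [← ENNReal.ofReal_mul (by positivity)]
  congr 1; field_simp

theorem Standing.tsum_add_abs_rpow_le (u v : EllTwo K) :
    ∑' k, ENNReal.ofReal ((|u k| + |v k|) ^ S.r) ≤
      ENNReal.ofReal (2 ^ S.r * (2 / S.eta)) * (Gsum gp u + Gsum gp v) := by
  have heta := hS.eta_pos
  calc ∑' k, ENNReal.ofReal ((|u k| + |v k|) ^ S.r)
      ≤ ∑' k, (ENNReal.ofReal (2 ^ S.r) * ENNReal.ofReal (|u k| ^ S.r)
        + ENNReal.ofReal (2 ^ S.r) * ENNReal.ofReal (|v k| ^ S.r)) := by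
        refine ENNReal.tsum_le_tsum fun k => ?_
        rw [← ENNReal.ofReal_mul (by positivity), ← ENNReal.ofReal_mul (by positivity),
          ← ENNReal.ofReal_add (by positivity) (by positivity)]
        exact ENNReal.ofReal_le_ofReal (hS.add_abs_rpow_le _ _)
    _ = ENNReal.ofReal (2 ^ S.r) * (∑' k, ENNReal.ofReal (|u k| ^ S.r)
        + ∑' k, ENNReal.ofReal (|v k| ^ S.r)) := by
        rw [ENNReal.tsum_add, ENNReal.tsum_mul_left, ENNReal.tsum_mul_left, mul_add]
    _ ≤ ENNReal.ofReal (2 ^ S.r) * (ENNReal.ofReal (2 / S.eta) * Gsum gp u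
        + ENNReal.ofReal (2 / S.eta) * Gsum gp v) := by
        gcongr
        · exact hS.tsum_abs_rpow_le hN u
        · exact hS.tsum_abs_rpow_le hN v
    _ = _ := by
        rw [← mul_add, ← mul_assoc, ENNReal.ofReal_mul (by positivity)]

omit hN in
/-- Hölder's inequality: a bound of the `ℓ^r` distance by the modulus of convexity. -/
theorem Standing.lrENorm_sub_le {u v : EllTwo K} {x y : ℝ} (hx : 0 < x) (hy : 0 < y)
    (hm : modSum S.r u v ≤ ENNReal.ofReal x)
    (hs : ∑' k, ENNReal.ofReal ((|u k| + |v k|) ^ S.r) ≤ ENNReal.ofReal y) :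
    lrENorm S.r (⇑u - ⇑v) ≤ ENNReal.ofReal (y ^ ((1 - S.r / 2) / S.r))
      * ENNReal.ofReal x ^ (1 / 2 : ℝ) := by
  have hr := hS.one_lt_r
  have hr2 := hS.r_le_two
  have hw : 0 ≤ 1 - S.r / 2 := by linarith
  set Z := x ^ (S.r / 2) * y ^ (1 - S.r / 2) with hZ
  have hsum : ∑' k, ‖(⇑u - ⇑v) k‖ₑ ^ S.r ≤ ENNReal.ofReal Z := by
    calc ∑' k, ‖(⇑u - ⇑v) k‖ₑ ^ S.r
        ≤ ∑' k, ENNReal.ofReal Z * (ENNReal.ofReal (S.r / 2 / x) *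
            ENNReal.ofReal (powModulus S.r (u k) (v k)) + ENNReal.ofReal ((1 - S.r / 2) / y) *
            ENNReal.ofReal ((|u k| + |v k|) ^ S.r)) := by
          refine ENNReal.tsum_le_tsum fun k => ?_
          have hpm := powModulus_nonneg S.r (u k) (v k)
          rw [← ENNReal.ofReal_mul (by positivity), ← ENNReal.ofReal_mul (by positivity),
            ← ENNReal.ofReal_add (by positivity) (by positivity),
            ← ENNReal.ofReal_mul (by positivity), ← ofReal_norm,
            ENNReal.ofReal_rpow_of_nonneg (norm_nonneg _) (by linarith)]
          refine ENNReal.ofReal_le_ofReal ?_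
          have := abs_sub_rpow_le hr hr2 hx hy (u k) (v k)
          simp only [Pi.sub_apply, Real.norm_eq_abs]
          refine this.trans (le_of_eq ?_)
          rw [hZ]; ring
      _ = ENNReal.ofReal Z * (ENNReal.ofReal (S.r / 2 / x) * modSum S.r u v +
            ENNReal.ofReal ((1 - S.r / 2) / y) *
              ∑' k, ENNReal.ofReal ((|u k| + |v k|) ^ S.r)) := by
          rw [ENNReal.tsum_mul_left, ENNReal.tsum_add, ENNReal.tsum_mul_left,
            ENNReal.tsum_mul_left]
          rfl
      _ ≤ ENNReal.ofReal Z * (ENNReal.ofReal (S.r / 2 / x) * ENNReal.ofReal x +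
            ENNReal.ofReal ((1 - S.r / 2) / y) * ENNReal.ofReal y) := by gcongr
      _ = ENNReal.ofReal Z := by
          rw [← ENNReal.ofReal_mul (by positivity), ← ENNReal.ofReal_mul (by positivity),
            ← ENNReal.ofReal_add (by positivity) (by positivity),
            ← ENNReal.ofReal_mul (by positivity)]
          congr 1
          field_simp; ring
  unfold lrENorm
  refine (ENNReal.rpow_le_rpow hsum (by positivity)).trans (le_of_eq ?_)
  rw [ENNReal.ofReal_rpow_of_nonneg (by positivity) (by positivity),
    ENNReal.ofReal_rpow_of_nonneg hx.le (by positivity), ← ENNReal.ofReal_mul (by positivity), hZ,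
    Real.mul_rpow (by positivity) (by positivity), ← Real.rpow_mul hx.le, ← Real.rpow_mul hy.le,
    mul_comm]
  congr 3
  · ring
  · field_simp

theorem Standing.lrENorm_growth {uh : EllTwo K} (huh : Gsum gp uh ≠ ⊤)
    (hmin : ∀ v, Gsum gp v ≠ ⊤ → hS.obj A gp uh ≤ hS.obj A gp v) (Γ : ℝ) :
    ∃ c : ℝ≥0, 0 < c ∧ ∀ s, Gsum gp s ≠ ⊤ → hS.obj A gp s - hS.obj A gp uh ≤ Γ →
      lrENorm S.r (⇑s - ⇑uh) ≤
        c * ENNReal.ofReal (hS.obj A gp s - hS.obj A gp uh) ^ (1 / 2 : ℝ) := by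
  have hl := hS.lam_pos
  have heta := hS.eta_pos
  have hr := hS.one_lt_r
  set m := 2 * (S.lam * (S.eta * (S.r * (S.r - 1) / 8))) with hm
  have hm0 : 0 < m := by have := hS.modulus_pos; positivity
  set B := (hS.obj A gp uh + |Γ|) / S.lam + ∑' k, A k with hB
  set y := 2 ^ S.r * (2 / S.eta) * (B + (Gsum gp uh).toReal) + 1 with hy
  have hB0 : 0 ≤ B := by
    refine (ENNReal.toReal_nonneg (a := Gsum gp uh)).trans
      ((hS.Gsum_toReal_le (A := A) uh).trans ?_)
    rw [hB]; gcongr; linarith [abs_nonneg Γ]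
  have hy0 : 0 < y := by
    have : 0 ≤ (Gsum gp uh).toReal := ENNReal.toReal_nonneg
    positivity
  refine ⟨Real.toNNReal (y ^ ((1 - S.r / 2) / S.r) * (1 / m) ^ (1 / 2 : ℝ)),
    Real.toNNReal_pos.mpr (by positivity), fun s hs hΓ => ?_⟩
  set δ := hS.obj A gp s - hS.obj A gp uh with hδ
  rcases (sub_nonneg.mpr (hmin s hs)).eq_or_lt with h0 | hpos
  · have : s = uh := hS.eq_of_obj_le hN huh hmin hs (by linarith)
    subst this
    simp [lrENorm, (by linarith : 0 < S.r)]
  have hGs : (Gsum gp s).toReal ≤ B := by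
    refine (hS.Gsum_toReal_le (A := A) s).trans ?_
    rw [hB]; gcongr; linarith [le_abs_self Γ]
  obtain ⟨hm1, hm2⟩ := hS.growth hN huh hmin hs
  have hmod : modSum S.r s uh ≤ ENNReal.ofReal (δ / m) := by
    rw [← ENNReal.ofReal_toReal hm1]
    refine ENNReal.ofReal_le_ofReal ?_
    rw [le_div_iff₀ hm0, mul_comm]
    exact hm2
  have hsum : ∑' k, ENNReal.ofReal ((|s k| + |uh k|) ^ S.r) ≤ ENNReal.ofReal y := by
    refine (hS.tsum_add_abs_rpow_le hN s uh).trans ?_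
    rw [← ENNReal.ofReal_toReal hs, ← ENNReal.ofReal_toReal huh,
      ← ENNReal.ofReal_add ENNReal.toReal_nonneg ENNReal.toReal_nonneg,
      ← ENNReal.ofReal_mul (by positivity)]
    refine ENNReal.ofReal_le_ofReal ?_
    rw [hy]
    have : 2 ^ S.r * (2 / S.eta) * ((Gsum gp s).toReal + (Gsum gp uh).toReal) ≤
      2 ^ S.r * (2 / S.eta) * (B + (Gsum gp uh).toReal) := by gcongr
    linarith
  refine (hS.lrENorm_sub_le (div_pos hpos hm0) hy0 hmod hsum).trans (le_of_eq ?_)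
  rw [ENNReal.ofReal_rpow_of_pos (div_pos hpos hm0), ENNReal.ofReal_rpow_of_pos hpos,
    ← ENNReal.ofReal_mul (by positivity)]
  change _ = ENNReal.ofReal _ * _
  rw [← ENNReal.ofReal_mul (by positivity)]
  congr 1
  rw [div_eq_mul_one_div (hS.obj A gp s - hS.obj A gp uh) m, Real.mul_rpow hpos.le (by positivity)]
  ring

theorem Standing.J_isMin {uh : EllTwo K} (huh : Gsum gp uh ≠ ⊤)
    (hmin : ∀ v, Gsum gp v ≠ ⊤ → hS.obj A gp uh ≤ hS.obj A gp v) (w : EllTwo K) :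
    S.J uh ≤ S.J w := by
  by_cases hw : Gsum gp w = ⊤
  · rw [hS.J_eq_top hN hw]; exact le_top
  · rw [hS.J_eq_obj hN huh, hS.J_eq_obj hN hw]
    exact EReal.coe_le_coe_iff.mpr (hmin w hw)

theorem Standing.iInf_J {uh : EllTwo K} (huh : Gsum gp uh ≠ ⊤)
    (hmin : ∀ v, Gsum gp v ≠ ⊤ → hS.obj A gp uh ≤ hS.obj A gp v) :
    ⨅ w, S.J w = (hS.obj A gp uh : EReal) := by
  rw [← hS.J_eq_obj hN huh]
  exact le_antisymm (iInf_le _ uh) (le_iInf (hS.J_isMin hN huh hmin))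

theorem Standing.gap_eq {uh : EllTwo K} (huh : Gsum gp uh ≠ ⊤)
    (hmin : ∀ v, Gsum gp v ≠ ⊤ → hS.obj A gp uh ≤ hS.obj A gp v) {w : EllTwo K}
    (hw : Gsum gp w ≠ ⊤) : S.gap w = ENNReal.ofReal (hS.obj A gp w - hS.obj A gp uh) := by
  unfold Setting.gap
  rw [hS.iInf_J hN huh hmin, hS.J_eq_obj hN hw, ← EReal.coe_sub,
    EReal.toENNReal_of_ne_top (EReal.coe_ne_top _), EReal.toReal_coe]

theorem Standing.gap_eq_top {uh : EllTwo K} (huh : Gsum gp uh ≠ ⊤)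
    (hmin : ∀ v, Gsum gp v ≠ ⊤ → hS.obj A gp uh ≤ hS.obj A gp v) {w : EllTwo K}
    (hw : Gsum gp w = ⊤) : S.gap w = ⊤ := by
  unfold Setting.gap
  rw [hS.iInf_J hN huh hmin, hS.J_eq_top hN hw]
  rfl

theorem Standing.memℓp_of_Gsum_ne_top {u : EllTwo K} (hu : Gsum gp u ≠ ⊤) :
    Memℓp (u : K → ℝ) (ENNReal.ofReal S.r) := by
  have hr := hS.one_lt_r
  have h1 : ∑' k, ENNReal.ofReal (|u k| ^ S.r) ≠ ⊤ :=
    ne_top_of_le_ne_top (ENNReal.mul_ne_top ENNReal.ofReal_ne_top hu) (hS.tsum_abs_rpow_le hN u)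
  rw [memℓp_gen_iff (by rw [ENNReal.toReal_ofReal (by linarith)]; linarith),
    ENNReal.toReal_ofReal (by linarith)]
  refine (ENNReal.summable_toReal h1).congr fun k => ?_
  rw [ENNReal.toReal_ofReal (by positivity), Real.norm_eq_abs]

end Setting

theorem IsGammaZeroPlus.toReal_convex {h : ℝ → ℝ≥0∞} (hh : IsGammaZeroPlus h) {s t a b : ℝ}
    (ha : 0 ≤ a) (hb : 0 ≤ b) (hab : a + b = 1) (hs : h s ≠ ⊤) (ht : h t ≠ ⊤) :
    h (a * s + b * t) ≠ ⊤ ∧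
      (h (a * s + b * t)).toReal ≤ a * (h s).toReal + b * (h t).toReal := by
  have h0 := hh.convex s t a b ha hb hab
  have h1 := ENNReal.mul_ne_top (ENNReal.ofReal_ne_top (r := a)) hs
  have h2 := ENNReal.mul_ne_top (ENNReal.ofReal_ne_top (r := b)) ht
  refine ⟨ne_top_of_le_ne_top (ENNReal.add_ne_top.mpr ⟨h1, h2⟩) h0, ?_⟩
  have := ENNReal.toReal_mono (ENNReal.add_ne_top.mpr ⟨h1, h2⟩) h0
  rwa [ENNReal.toReal_add h1 h2, ENNReal.toReal_mul, ENNReal.toReal_mul,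
    ENNReal.toReal_ofReal ha, ENNReal.toReal_ofReal hb] at this

/-- The variational inequality of the proximal point. -/
theorem IsProx.variational {h : ℝ → ℝ≥0∞} (hh : IsGammaZeroPlus h) (h0 : h 0 = 0) {γ t q : ℝ}
    (hγ : 0 < γ) (hq : IsProx (fun s => ENNReal.ofReal γ * h s) t q) :
    h q ≠ ⊤ ∧ ∀ s, h s ≠ ⊤ → γ * (h q).toReal + (t - q) * (s - q) ≤ γ * (h s).toReal := by
  have hfin : h q ≠ ⊤ := by
    intro htop
    have := hq 0
    simp only [htop, h0, mul_zero, zero_add] at this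
    rw [ENNReal.mul_top (by simpa using hγ), top_add] at this
    exact absurd this (by simp)
  have hreal : ∀ z, h z ≠ ⊤ →
      γ * (h q).toReal + (t - q) ^ 2 / 2 ≤ γ * (h z).toReal + (t - z) ^ 2 / 2 := by
    intro z hz
    have h1 := hq z
    simp only at h1
    have hz' := ENNReal.mul_ne_top (ENNReal.ofReal_ne_top (r := γ)) hz
    have hq' := ENNReal.mul_ne_top (ENNReal.ofReal_ne_top (r := γ)) hfin
    have h2 := ENNReal.toReal_mono (ENNReal.add_ne_top.mpr ⟨hz', ENNReal.ofReal_ne_top⟩) h1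
    rwa [ENNReal.toReal_add hq' ENNReal.ofReal_ne_top,
      ENNReal.toReal_add hz' ENNReal.ofReal_ne_top, ENNReal.toReal_mul, ENNReal.toReal_mul,
      ENNReal.toReal_ofReal hγ.le, ENNReal.toReal_ofReal (by positivity),
      ENNReal.toReal_ofReal (by positivity)] at h2
  refine ⟨hfin, fun s hs => ?_⟩
  have key : 0 ≤ γ * (h s).toReal - γ * (h q).toReal - (t - q) * (s - q) := by
    refine nonneg_of_forall_add_mul (Q := (s - q) ^ 2 / 2) fun θ hθ0 hθ1 => ?_
    obtain ⟨h1, h2⟩ := hh.toReal_convex (a := 1 - θ) (b := θ) (by linarith) hθ0.le (by ring)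
      hfin hs
    have h3 := hreal _ h1
    have h4 := mul_le_mul_of_nonneg_left h2 hγ.le
    refine le_of_mul_le_mul_left ?_ hθ0
    nlinarith
  linarith

theorem IsProj.variational {C : Set ℝ} (hC : C.OrdConnected) {w p : ℝ} (hp : IsProj C w p)
    {c : ℝ} (hc : c ∈ C) : (w - p) * (c - p) ≤ 0 := by
  by_contra hlt
  push Not at hlt
  rcases pos_and_pos_or_neg_and_neg_of_mul_pos hlt with ⟨h1, h2⟩ | ⟨h1, h2⟩
  · have hm : min c w ∈ C := hC.out hp.1 hc ⟨le_min (by linarith) (by linarith), min_le_left _ _⟩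
    have h3 := hp.2 _ hm
    rw [abs_of_pos h1, abs_of_nonneg (by linarith [min_le_right c w])] at h3
    have : p < min c w := lt_min (by linarith) (by linarith)
    linarith
  · have hm : max c w ∈ C := hC.out hc hp.1 ⟨le_max_left _ _, max_le (by linarith) (by linarith)⟩
    have h3 := hp.2 _ hm
    rw [abs_of_neg h1, abs_of_nonpos (by linarith [le_max_right c w])] at h3
    have : max c w < p := max_lt (by linarith) (by linarith)
    linarith

theorem IsProj.nonexpansive {C : Set ℝ} (hC : C.OrdConnected) {w w' p p' : ℝ}
    (hp : IsProj C w p) (hp' : IsProj C w' p') : |p - p'| ≤ |w - w'| := by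
  have h1 := hp.variational hC hp'.1
  have h2 := hp'.variational hC hp.1
  have h3 : (p - p') ^ 2 ≤ (w - w') * (p - p') := by nlinarith
  refine sq_le_sq.mp ?_
  nlinarith [sq_nonneg ((w - w') - (p - p'))]

theorem exists_isProj {C : Set ℝ} (hC : IsClosed C) (hne : C.Nonempty) (w : ℝ) :
    ∃ p, IsProj C w p := by
  obtain ⟨p, hp, h⟩ := hC.exists_infDist_eq_dist hne w
  refine ⟨p, hp, fun c hc => ?_⟩
  rw [← Real.dist_eq, ← Real.dist_eq, ← h]
  exact Metric.infDist_le_dist_of_mem hc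

/-- The point `x` has the sign of `t`, or vanishes. -/
def SameSign (x t : ℝ) : Prop := (0 < t ∧ 0 ≤ x) ∨ (t < 0 ∧ x ≤ 0) ∨ x = 0

theorem SameSign.of_sq_le {x t : ℝ} (h : x ^ 2 ≤ x * t) : SameSign x t := by
  rcases lt_trichotomy t 0 with ht | ht | ht
  · exact Or.inr (Or.inl ⟨ht, by nlinarith⟩)
  · refine Or.inr (Or.inr ?_)
    subst ht
    nlinarith
  · exact Or.inl ⟨ht, by nlinarith⟩

theorem SameSign.shrink {x y t : ℝ} (hx : SameSign x t) (h : 0 ≤ y * (x - y)) : SameSign y t := by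
  rcases hx with ⟨ht, hx⟩ | ⟨ht, hx⟩ | hx
  · exact Or.inl ⟨ht, by nlinarith⟩
  · exact Or.inr (Or.inl ⟨ht, by nlinarith⟩)
  · subst hx
    exact Or.inr (Or.inr (by nlinarith))

/-- The projection of `t` onto `[a, b]`. -/
def clamp (a b t : ℝ) : ℝ := max a (min b t)

theorem mul_supportFun_of_sameSign {a b γ χ x : ℝ} (hab : a ≤ b) (hγ : 0 < γ)
    (hx : SameSign x (softThreshold (γ * a) (γ * b) χ)) :
    γ * supportFun a b x = clamp (γ * a) (γ * b) χ * x := by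
  have hab' : γ * a ≤ γ * b := mul_le_mul_of_nonneg_left hab hγ.le
  rw [supportFun_eq hab]
  unfold softThreshold at hx
  unfold clamp
  rcases hx with ⟨ht, hx⟩ | ⟨ht, hx⟩ | hx
  · rw [max_eq_right (mul_le_mul_of_nonneg_right hab hx)]
    have h1 : min (γ * b) χ < χ := lt_of_le_of_lt (le_max_right (γ * a) _) (by linarith)
    have h2 : min (γ * b) χ = γ * b := by
      rcases min_choice (γ * b) χ with h | h
      · exact h
      · rw [h] at h1; exact absurd h1 (lt_irrefl _)
    rw [h2, max_eq_right hab']; ring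
  · rw [max_eq_left (mul_le_mul_of_nonpos_right hab hx)]
    have h1 : χ < max (γ * a) (min (γ * b) χ) := by linarith
    have h2 : max (γ * a) (min (γ * b) χ) = γ * a := by
      rcases max_choice (γ * a) (min (γ * b) χ) with h | h
      · exact h
      · rw [h] at h1; exact absurd (h1.trans_le (min_le_right _ _)) (lt_irrefl _)
    rw [h2]; ring
  · simp [hx]

theorem clamp_mul_le {a b γ χ : ℝ} (hab : a ≤ b) (hγ : 0 < γ) (s : ℝ) :
    clamp (γ * a) (γ * b) χ * s ≤ γ * supportFun a b s := by
  have hab' : γ * a ≤ γ * b := mul_le_mul_of_nonneg_left hab hγ.le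
  have h1 : γ * a ≤ clamp (γ * a) (γ * b) χ := le_max_left _ _
  have h2 : clamp (γ * a) (γ * b) χ ≤ γ * b := max_le hab' (min_le_left _ _)
  rw [supportFun_eq hab]
  rcases le_total 0 s with h | h
  · nlinarith [le_max_right (a * s) (b * s)]
  · nlinarith [le_max_left (a * s) (b * s)]

theorem abs_clamp_le {a b γ χ : ℝ} (hab : a ≤ b) (hγ : 0 < γ) :
    |clamp (γ * a) (γ * b) χ| ≤ |χ| + γ * (max a 0 + max (-b) 0) := by
  have hab' : γ * a ≤ γ * b := mul_le_mul_of_nonneg_left hab hγ.le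
  have h1 : γ * a ≤ γ * max a 0 := mul_le_mul_of_nonneg_left (le_max_left _ _) hγ.le
  have h2 : 0 ≤ γ * max a 0 := mul_nonneg hγ.le (le_max_right _ _)
  have h3 : γ * -b ≤ γ * max (-b) 0 := mul_le_mul_of_nonneg_left (le_max_left _ _) hγ.le
  have h4 : 0 ≤ γ * max (-b) 0 := mul_nonneg hγ.le (le_max_right _ _)
  have h5 := le_abs_self χ
  have h6 := neg_abs_le χ
  unfold clamp
  rw [abs_le]
  constructor
  · apply le_max_of_le_right
    apply le_min <;> nlinarith
  · refine max_le (by nlinarith) ((min_le_right _ _).trans (by nlinarith))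

theorem abs_softThreshold_le {a b γ χ : ℝ} (hab : a ≤ b) (hγ : 0 < γ) :
    |softThreshold (γ * a) (γ * b) χ| ≤ |χ| + γ * (max a 0 + max (-b) 0) := by
  have hab' : γ * a ≤ γ * b := mul_le_mul_of_nonneg_left hab hγ.le
  have h1 : γ * a ≤ γ * max a 0 := mul_le_mul_of_nonneg_left (le_max_left _ _) hγ.le
  have h2 : 0 ≤ γ * max a 0 := mul_nonneg hγ.le (le_max_right _ _)
  have h3 : γ * -b ≤ γ * max (-b) 0 := mul_le_mul_of_nonneg_left (le_max_left _ _) hγ.le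
  have h4 : 0 ≤ γ * max (-b) 0 := mul_nonneg hγ.le (le_max_right _ _)
  have h5 := le_abs_self χ
  have h6 := neg_abs_le χ
  unfold softThreshold
  rw [abs_le]
  rcases max_choice (γ * a) (min (γ * b) χ) with h | h
  · have := le_max_right (γ * a) (min (γ * b) χ)
    rw [h] at this ⊢
    rcases min_choice (γ * b) χ with h' | h' <;> rw [h'] at this <;> constructor <;> nlinarith
  · rw [h]
    rcases min_choice (γ * b) χ with h' | h'
    · rw [h']
      have := min_le_right (γ * b) χ
      rw [h'] at this
      constructor <;> nlinarith
    · rw [h']; constructor <;> nlinarith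

/-- Keeping the sign of `t` is a nonexpansive operation that fixes the points with this sign. -/
theorem sign_clip_spec {q t α : ℝ} (hq : SameSign q t) :
    SameSign (Real.sign t * max 0 (Real.sign t * (q + α))) t ∧
      |Real.sign t * max 0 (Real.sign t * (q + α)) - q| ≤ |α| := by
  rcases lt_trichotomy t 0 with ht | ht | ht
  · have hq0 : q ≤ 0 := by
      rcases hq with ⟨h, -⟩ | ⟨-, h⟩ | h <;> linarith
    rw [Real.sign_of_neg ht]
    refine ⟨Or.inr (Or.inl ⟨ht, by linarith [le_max_left 0 (-1 * (q + α))]⟩), ?_⟩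
    rw [abs_le]
    rcases max_choice 0 (-1 * (q + α)) with h | h
    · have := le_max_right 0 (-1 * (q + α))
      rw [h] at this ⊢
      constructor <;> linarith [le_abs_self α, neg_abs_le α]
    · rw [h]
      constructor <;> linarith [le_abs_self α, neg_abs_le α]
  · have hq0 : q = 0 := by
      rcases hq with ⟨h, -⟩ | ⟨h, -⟩ | h <;> linarith
    subst ht
    simp [Real.sign_zero, hq0, SameSign]
  · have hq0 : 0 ≤ q := by
      rcases hq with ⟨-, h⟩ | ⟨h, -⟩ | h <;> linarith
    rw [Real.sign_of_pos ht]
    refine ⟨Or.inl ⟨ht, by linarith [le_max_left 0 (1 * (q + α))]⟩, ?_⟩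
    rw [abs_le]
    rcases max_choice 0 (1 * (q + α)) with h | h
    · have := le_max_right 0 (1 * (q + α))
      rw [h] at this ⊢
      constructor <;> linarith [le_abs_self α, neg_abs_le α]
    · rw [h]
      constructor <;> linarith [le_abs_self α, neg_abs_le α]

theorem IsGammaZeroPlus.le_of_between {h : ℝ → ℝ≥0∞} (hh : IsGammaZeroPlus h) (h0 : h 0 = 0)
    {p q : ℝ} (hpq : 0 ≤ p * (q - p)) : h p ≤ h q := by
  rcases eq_or_ne p 0 with rfl | hp
  · rw [h0]; exact zero_le
  have hq : q ≠ 0 := by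
    rintro rfl
    have := mul_self_pos.mpr hp
    nlinarith
  have hp2 : 0 < p ^ 2 := by positivity
  have hpq' : 0 < p * q := by nlinarith
  have e : p = p / q * q + (1 - p / q) * 0 := by field_simp; ring
  have hθ : 0 ≤ p / q := by
    rw [show p / q = p * q / q ^ 2 by field_simp]; positivity
  have hθ1 : p / q ≤ 1 := by
    rw [show p / q = p ^ 2 / (p * q) by field_simp, div_le_one hpq']; nlinarith
  have h1 := hh.convex q 0 (p / q) (1 - p / q) hθ (by linarith) (by ring)
  rw [← e, h0, mul_zero, add_zero] at h1
  refine h1.trans ?_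
  calc ENNReal.ofReal (p / q) * h q ≤ 1 * h q := by
        gcongr
        exact ENNReal.ofReal_le_one.mpr hθ1
    _ = h q := one_mul _

theorem IsGammaZeroPlus.le_add_of_nonneg {h : ℝ → ℝ≥0∞} (hh : IsGammaZeroPlus h) (h0 : h 0 = 0)
    {p q R : ℝ} (hq : 0 ≤ q) (hR : q + 1 ≤ R) :
    h q ≤ h p + ENNReal.ofReal |q - p| * h R := by
  rcases le_or_gt q p with hqp | hqp
  · exact (hh.le_of_between h0 (by nlinarith)).trans le_self_add
  have hRp : 1 ≤ R - p := by linarith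
  set θ := (q - p) / (R - p) with hθ
  have hθ0 : 0 ≤ θ := div_nonneg (by linarith) (by linarith)
  have hθ1 : θ ≤ q - p := div_le_self (by linarith) hRp
  have hθ2 : θ ≤ 1 := by rw [hθ, div_le_one (by linarith)]; linarith
  have e : q = (1 - θ) * p + θ * R := by
    have : θ * (R - p) = q - p := div_mul_cancel₀ _ (by linarith)
    linarith
  have h1 := hh.convex p R (1 - θ) θ (by linarith) hθ0 (by ring)
  rw [← e] at h1
  refine h1.trans (add_le_add ?_ ?_)
  · calc ENNReal.ofReal (1 - θ) * h p ≤ 1 * h p := by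
          gcongr
          exact ENNReal.ofReal_le_one.mpr (by linarith)
      _ = h p := one_mul _
  · rw [abs_of_pos (by linarith)]
    gcongr

theorem IsGammaZeroPlus.comp_neg {h : ℝ → ℝ≥0∞} (hh : IsGammaZeroPlus h) :
    IsGammaZeroPlus fun t => h (-t) where
  proper := by
    obtain ⟨t, ht⟩ := hh.proper
    exact ⟨-t, by simpa using ht⟩
  lsc := hh.lsc.comp continuous_neg
  convex s t a b ha hb hab := by
    have := hh.convex (-s) (-t) a b ha hb hab
    rwa [show a * -s + b * -t = -(a * s + b * t) by ring] at this

theorem IsGammaZeroPlus.le_add_of_sameSign {h : ℝ → ℝ≥0∞} (hh : IsGammaZeroPlus h) (h0 : h 0 = 0)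
    {p q R t : ℝ} (hp : SameSign p t) (hq : SameSign q t) (hR : |q| + 1 ≤ R) :
    h q ≤ h p + ENNReal.ofReal |q - p| * max (h R) (h (-R)) := by
  have hcase : (0 ≤ p ∧ 0 ≤ q) ∨ (p ≤ 0 ∧ q ≤ 0) := by
    rcases hp with ⟨h1, h2⟩ | ⟨h1, h2⟩ | h2 <;> rcases hq with ⟨h3, h4⟩ | ⟨h3, h4⟩ | h4 <;>
      first
        | exact Or.inl ⟨by linarith, by linarith⟩
        | exact Or.inr ⟨by linarith, by linarith⟩
  rcases hcase with ⟨h1, h2⟩ | ⟨h1, h2⟩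
  · rw [abs_of_nonneg h2] at hR
    refine (hh.le_add_of_nonneg (p := p) h0 h2 hR).trans ?_
    gcongr
    exact le_max_left _ _
  · rw [abs_of_nonpos h2] at hR
    have := hh.comp_neg.le_add_of_nonneg (p := -p) (q := -q) (R := R) (by simpa using h0)
      (by linarith) hR
    simp only [neg_neg] at this
    rw [show -q - -p = -(q - p) by ring, abs_neg] at this
    refine this.trans ?_
    gcongr
    exact le_max_right _ _

/-- The projection of the proximal point of `γ h` at the soft-thresholded point is the proximal
point of `γ (ι_C + σ_{[a, b]} + h)`. -/
theorem IsProj.prox_soft {h : ℝ → ℝ≥0∞} (hh : IsGammaZeroPlus h) (h0 : h 0 = 0) {C : Set ℝ}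
    (hC : C.OrdConnected) (h0C : (0 : ℝ) ∈ C) {a b γ χ q p : ℝ} (hab : a ≤ b) (hγ : 0 < γ)
    (hq : IsProx (fun s => ENNReal.ofReal γ * h s) (softThreshold (γ * a) (γ * b) χ) q)
    (hp : IsProj C q p) :
    h p ≠ ⊤ ∧ SameSign q (softThreshold (γ * a) (γ * b) χ) ∧
      SameSign p (softThreshold (γ * a) (γ * b) χ) ∧
      ∀ s ∈ C, h s ≠ ⊤ → γ * ((h p).toReal + supportFun a b p) + (χ - p) * (s - p) ≤
        γ * ((h s).toReal + supportFun a b s) := by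
  set t := softThreshold (γ * a) (γ * b) χ with ht
  obtain ⟨hqfin, hqvar⟩ := hq.variational hh h0 hγ
  have hp0 := hp.variational hC h0C
  have hbet : 0 ≤ p * (q - p) := by linarith
  have hpfin : h p ≠ ⊤ := ne_top_of_le_ne_top hqfin (hh.le_of_between h0 hbet)
  have hqs : SameSign q t := by
    refine SameSign.of_sq_le ?_
    have h1 := hqvar 0 (by simp [h0])
    rw [h0] at h1
    have h2 : 0 ≤ γ * (h q).toReal := mul_nonneg hγ.le ENNReal.toReal_nonneg
    simp only [ENNReal.toReal_zero, mul_zero] at h1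
    nlinarith
  have hps : SameSign p t := hqs.shrink hbet
  refine ⟨hpfin, hqs, hps, fun s hs hsfin => ?_⟩
  have hd : χ = t + clamp (γ * a) (γ * b) χ := by
    rw [ht]; unfold softThreshold clamp; ring
  have hσq := mul_supportFun_of_sameSign hab hγ hqs
  have hσp := mul_supportFun_of_sameSign hab hγ hps
  have hσs := clamp_mul_le (χ := χ) hab hγ s
  set d := clamp (γ * a) (γ * b) χ with hddef
  have hs1 := hqvar s hsfin
  have hsp := hp.variational hC hs
  rcases eq_or_ne q p with rfl | hne
  · rw [hd]; nlinarith
  -- `p` lies between `s` and `q`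
  have hne2 : 0 < (q - p) ^ 2 := by
    have := sub_ne_zero.mpr hne
    positivity
  have hden : 0 < (q - p) * (q - s) := by nlinarith
  set θ := (q - p) ^ 2 / ((q - p) * (q - s)) with hθ
  have hqs0 : q - s ≠ 0 := by
    intro h; rw [h, mul_zero] at hden; exact lt_irrefl _ hden
  have hθ0 : 0 ≤ θ := by positivity
  have hθ1 : θ ≤ 1 := by
    rw [hθ, div_le_one hden]; nlinarith
  have hqp0 : q - p ≠ 0 := sub_ne_zero.mpr hne
  have hθe : θ * (q - s) = q - p := by rw [hθ]; field_simp
  have e : p = θ * s + (1 - θ) * q := by linarith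
  obtain ⟨-, hcv⟩ := hh.toReal_convex hθ0 (by linarith) (by ring : θ + (1 - θ) = 1) hsfin hqfin
  rw [← e] at hcv
  have h1 := mul_le_mul_of_nonneg_left hcv hγ.le
  have h2 := mul_le_mul_of_nonneg_left hs1 (by linarith : 0 ≤ 1 - θ)
  have h3 : (1 - θ) * (s - q) = s - p := by linarith
  have h4 : (1 - θ) * ((t - q) * (s - q)) = (t - q) * (s - p) := by rw [← h3]; ring
  have h5 : γ * (h p).toReal + (t - q) * (s - p) ≤ γ * (h s).toReal := by nlinarith
  rw [hd]; nlinarith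

namespace Setting

variable {K X : Type*} {S : Setting K X}

/-- The size of the interval `D k` as seen from the origin. -/
def dualBound (S : Setting K X) (k : K) : ℝ := max (S.dlo k) 0 + max (-(S.dhi k)) 0

theorem dualBound_nonneg (k : K) : 0 ≤ S.dualBound k :=
  add_nonneg (le_max_right _ _) (le_max_right _ _)

variable {A : K → ℝ} {gp : K → ℝ → ℝ≥0∞} (hS : S.Standing) (hN : S.IsNormalization A gp)
include hS hN

theorem Standing.component_variational {k : K} {γ χ q p : ℝ} (hγ : 0 < γ)
    (hq : IsProx (fun s => ENNReal.ofReal γ * S.h k s)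
      (softThreshold (γ * S.dlo k) (γ * S.dhi k) χ) q) (hp : IsProj (S.C k) q p) :
    gp k p ≠ ⊤ ∧ ∀ s, gp k s ≠ ⊤ →
      γ * (gp k p).toReal + (χ - p) * (s - p) ≤ γ * (gp k s).toReal := by
  obtain ⟨h1, -, -, h2⟩ := hp.prox_soft (hS.h_gamma k) (hS.h_zero k) (hS.C_interval k)
    (hS.zero_mem_C k) (hS.dlo_le_dhi k) hγ hq
  refine ⟨(hN.ne_top_iff k p).mpr ⟨hp.1, h1⟩, fun s hs => ?_⟩
  obtain ⟨h3, h4⟩ := (hN.ne_top_iff k s).mp hs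
  have := h2 s h3 h4
  rw [hN.toReal k p hp.1 h1, hN.toReal k s h3 h4]
  nlinarith

theorem Standing.exists_exact_step {γ : ℝ} (hγ : 0 < γ) (w : EllTwo K) (q : K → ℝ)
    (hq : ∀ k, IsProx (fun s => ENNReal.ofReal γ * S.h k s)
      (softThreshold (γ * S.dlo k) (γ * S.dhi k) (w k)) (q k)) :
    ∃ p : EllTwo K, (∀ k, IsProj (S.C k) (q k) (p k)) ∧ Gsum gp p ≠ ⊤ ∧
      ∀ s : EllTwo K, Gsum gp s ≠ ⊤ →
        (Gsum gp p).toReal + 1 / γ * ⟪w - p, s - p⟫ ≤ (Gsum gp s).toReal := by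
  choose p hp using fun k => exists_isProj (hS.C_closed k) ⟨0, hS.zero_mem_C k⟩ (q k)
  have hvar := fun k => hS.component_variational hN hγ (hq k) (hp k)
  have h0 : ∀ k, (gp k 0).toReal = A k := fun k => by
    rw [hN.zero k, ENNReal.toReal_ofReal (hN.nonneg k)]
  have hv0 : ∀ k, γ * (gp k (p k)).toReal + (w k - p k) * (0 - p k) ≤ γ * A k := fun k => by
    have := (hvar k).2 0 (by rw [hN.zero k]; exact ENNReal.ofReal_ne_top)
    rwa [h0] at this
  have hw := EllTwo.summable_sq w
  have hmem : Memℓp p 2 := by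
    apply memℓp_two_of_summable_sq
    refine Summable.of_nonneg_of_le (fun k => sq_nonneg _) (fun k => ?_)
      (hw.add (hN.summable.mul_left (2 * γ)))
    have h1 : 0 ≤ γ * (gp k (p k)).toReal := mul_nonneg hγ.le ENNReal.toReal_nonneg
    nlinarith [hv0 k, sq_nonneg (w k - p k)]
  have hfinsum : ∀ s : EllTwo K, Gsum gp s ≠ ⊤ →
      (∀ k, gp k (s k) ≠ ⊤) ∧ HasSum (fun k => (gp k (s k)).toReal) (Gsum gp s).toReal := by
    intro s hs
    have hk := ENNReal.ne_top_of_tsum_ne_top hs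
    refine ⟨hk, ?_⟩
    rw [Gsum, ENNReal.tsum_toReal_eq hk]
    exact ENNReal.hasSum_toReal hs
  have hpfin : Gsum gp (⟨p, hmem⟩ : EllTwo K) ≠ ⊤ := by
    have hle : ∀ k, gp k (p k) ≤ ENNReal.ofReal (A k + 1 / (4 * γ) * w k ^ 2) := by
      intro k
      rw [← ENNReal.ofReal_toReal (hvar k).1]
      refine ENNReal.ofReal_le_ofReal ?_
      have h2 : γ * (A k + 1 / (4 * γ) * w k ^ 2) = γ * A k + w k ^ 2 / 4 := by field_simp
      refine le_of_mul_le_mul_left ?_ hγ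
      rw [h2]
      nlinarith [hv0 k, sq_nonneg (w k / 2 - p k)]
    refine ne_top_of_le_ne_top ?_ (ENNReal.tsum_le_tsum hle)
    exact (hN.summable.add (hw.mul_left (1 / (4 * γ)))).tsum_ofReal_ne_top
  refine ⟨⟨p, hmem⟩, hp, hpfin, fun s hs => ?_⟩
  obtain ⟨hsk, hssum⟩ := hfinsum s hs
  obtain ⟨-, hpsum⟩ := hfinsum _ hpfin
  have hin := (lp.hasSum_inner (𝕜 := ℝ) (w - ⟨p, hmem⟩) (s - (⟨p, hmem⟩ : EllTwo K))).mul_left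
    (1 / γ)
  refine hasSum_le (fun k => ?_) (hpsum.add hin) hssum
  have h1 := (hvar k).2 (s k) (hsk k)
  have h2 : ⟪(w - (⟨p, hmem⟩ : EllTwo K)) k, (s - (⟨p, hmem⟩ : EllTwo K)) k⟫
      = (w k - p k) * (s k - p k) := by
    simp only [RCLike.inner_apply, conj_trivial]
    exact mul_comm _ _
  rw [h2]
  refine le_of_mul_le_mul_left ?_ hγ
  rw [mul_add, ← mul_assoc, mul_one_div_cancel hγ.ne', one_mul]
  exact h1

theorem Standing.component_error {k : K} {γ χ q p α ν R E : ℝ} (hγ : 0 < γ)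
    (hq : IsProx (fun s => ENNReal.ofReal γ * S.h k s)
      (softThreshold (γ * S.dlo k) (γ * S.dhi k) χ) q) (hp : IsProj (S.C k) q p)
    (hν : IsProj (S.C k) (Real.sign (softThreshold (γ * S.dlo k) (γ * S.dhi k) χ) *
      max 0 (Real.sign (softThreshold (γ * S.dlo k) (γ * S.dhi k) χ) * (q + α))) ν)
    (hR : |χ| + γ * S.dualBound k + |α| + 1 ≤ R) (hE : 0 ≤ E)
    (hα : ENNReal.ofReal (γ * |α|) * max (S.h k R) (S.h k (-R)) ≤ ENNReal.ofReal E) :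
    gp k ν ≤ gp k p + ENNReal.ofReal ((|α| * (|χ| + γ * S.dualBound k) + E) / γ) := by
  obtain ⟨hpfin, hqs, hps, -⟩ := hp.prox_soft (hS.h_gamma k) (hS.h_zero k) (hS.C_interval k)
    (hS.zero_mem_C k) (hS.dlo_le_dhi k) hγ hq
  have hqvar := (hq.variational (hS.h_gamma k) (hS.h_zero k) hγ).2 0 (by simp [hS.h_zero k])
  have hab := hS.dlo_le_dhi k
  have htabs := abs_softThreshold_le (χ := χ) hab hγ
  have hdabs := abs_clamp_le (χ := χ) hab hγ
  have hσ := fun x hx => mul_supportFun_of_sameSign (χ := χ) (x := x) hab hγ hx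
  set t := softThreshold (γ * S.dlo k) (γ * S.dhi k) χ with ht
  set d := clamp (γ * S.dlo k) (γ * S.dhi k) χ with hd
  obtain ⟨hzs, hzq⟩ := sign_clip_spec (α := α) hqs
  set z := Real.sign t * max 0 (Real.sign t * (q + α)) with hz
  have hν0 := hν.variational (hS.C_interval k) (hS.zero_mem_C k)
  have hνs : SameSign ν t := hzs.shrink (by linarith)
  have hνp : |ν - p| ≤ |α| := (hν.nonexpansive (hS.C_interval k) hp).trans hzq
  have hνz : |ν| ≤ |z| := by
    refine sq_le_sq.mp ?_
    nlinarith [sq_nonneg (z - ν)]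
  have hqt : |q| ≤ |t| := by
    refine sq_le_sq.mp ?_
    rw [hS.h_zero k] at hqvar
    have h2 : 0 ≤ γ * (S.h k q).toReal := mul_nonneg hγ.le ENNReal.toReal_nonneg
    simp only [ENNReal.toReal_zero, mul_zero] at hqvar
    nlinarith [sq_nonneg (t - q)]
  have hzq' : |z| ≤ |q| + |α| := by
    have := abs_add_le q (z - q)
    rw [add_sub_cancel] at this
    linarith
  have hνR : |ν| + 1 ≤ R := by
    have : S.dualBound k = max (S.dlo k) 0 + max (-(S.dhi k)) 0 := rfl
    rw [← this] at htabs
    linarith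
  have hh := (hS.h_gamma k).le_add_of_sameSign (hS.h_zero k) hps hνs hνR
  have hh2 : S.h k ν ≤ S.h k p + ENNReal.ofReal (E / γ) := by
    refine hh.trans ?_
    gcongr
    calc ENNReal.ofReal |ν - p| * max (S.h k R) (S.h k (-R))
        ≤ ENNReal.ofReal (1 / γ) * (ENNReal.ofReal (γ * |α|) * max (S.h k R) (S.h k (-R))) := by
          rw [← mul_assoc, ← ENNReal.ofReal_mul (by positivity), ← mul_assoc,
            one_div_mul_cancel hγ.ne', one_mul]
          gcongr
      _ ≤ ENNReal.ofReal (1 / γ) * ENNReal.ofReal E := by gcongr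
      _ = ENNReal.ofReal (E / γ) := by
          rw [← ENNReal.ofReal_mul (by positivity)]; congr 1; ring
  have hνfin : S.h k ν ≠ ⊤ :=
    ne_top_of_le_ne_top (ENNReal.add_ne_top.mpr ⟨hpfin, ENNReal.ofReal_ne_top⟩) hh2
  have hh3 := ENNReal.toReal_mono (ENNReal.add_ne_top.mpr ⟨hpfin, ENNReal.ofReal_ne_top⟩) hh2
  rw [ENNReal.toReal_add hpfin ENNReal.ofReal_ne_top, ENNReal.toReal_ofReal (by positivity)] at hh3
  have hgν := (hN.ne_top_iff k ν).mpr ⟨hν.1, hνfin⟩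
  have hgp := (hN.ne_top_iff k p).mpr ⟨hp.1, hpfin⟩
  have hdb : 0 ≤ S.dualBound k := dualBound_nonneg k
  have herr : 0 ≤ (|α| * (|χ| + γ * S.dualBound k) + E) / γ := by positivity
  rw [← ENNReal.ofReal_toReal hgν, ← ENNReal.ofReal_toReal hgp,
    ← ENNReal.ofReal_add ENNReal.toReal_nonneg herr]
  refine ENNReal.ofReal_le_ofReal ?_
  rw [hN.toReal k ν hν.1 hνfin, hN.toReal k p hp.1 hpfin]
  have h1 : γ * supportFun (S.dlo k) (S.dhi k) ν - γ * supportFun (S.dlo k) (S.dhi k) p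
      ≤ |α| * (|χ| + γ * S.dualBound k) := by
    rw [hσ ν hνs, hσ p hps, ← mul_sub]
    calc d * (ν - p) ≤ |d * (ν - p)| := le_abs_self _
      _ = |d| * |ν - p| := abs_mul _ _
      _ ≤ (|χ| + γ * S.dualBound k) * |α| := mul_le_mul hdabs hνp (abs_nonneg _) (by positivity)
      _ = _ := mul_comm _ _
  have h2 : supportFun (S.dlo k) (S.dhi k) ν - supportFun (S.dlo k) (S.dhi k) p
      ≤ |α| * (|χ| + γ * S.dualBound k) / γ := by
    rw [le_div_iff₀ hγ]; linarith
  rw [add_div]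
  linarith

omit hN in
theorem Standing.abs_nu_sub_le {k : K} {γ χ q p α ν : ℝ} (hγ : 0 < γ)
    (hq : IsProx (fun s => ENNReal.ofReal γ * S.h k s)
      (softThreshold (γ * S.dlo k) (γ * S.dhi k) χ) q) (hp : IsProj (S.C k) q p)
    (hν : IsProj (S.C k) (Real.sign (softThreshold (γ * S.dlo k) (γ * S.dhi k) χ) *
      max 0 (Real.sign (softThreshold (γ * S.dlo k) (γ * S.dhi k) χ) * (q + α))) ν) :
    |ν - p| ≤ |α| := by
  obtain ⟨-, hqs, -, -⟩ := hp.prox_soft (hS.h_gamma k) (hS.h_zero k) (hS.C_interval k)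
    (hS.zero_mem_C k) (hS.dlo_le_dhi k) hγ hq
  exact (hν.nonexpansive (hS.C_interval k) hp).trans (sign_clip_spec hqs).2

end Setting

theorem summable_of_le_sub_succ {f G e : ℕ → ℝ} (hf : ∀ m, 0 ≤ f m) (hG : ∀ m, 0 ≤ G m)
    (he : ∀ m, 0 ≤ e m) (hes : Summable e) (h : ∀ m, f m ≤ G m - G (m + 1) + e m) :
    Summable f := by
  refine summable_of_sum_range_le (c := G 0 + ∑' m, e m) hf fun n => ?_
  have h1 : ∑ i ∈ Finset.range n, f i ≤ G 0 - G n + ∑ i ∈ Finset.range n, e i := by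
    induction n with
    | zero => simp
    | succ n ih => rw [Finset.sum_range_succ, Finset.sum_range_succ]; linarith [h n]
  linarith [hes.sum_le_tsum (Finset.range n) (fun i _ => he i), hG n]

theorem bounded_of_le_add {a s : ℕ → ℝ} (hs : ∀ m, 0 ≤ s m) (hss : Summable s)
    (h : ∀ m, a (m + 1) ≤ a m + s m) (n : ℕ) : a n ≤ a 0 + ∑' m, s m := by
  have h1 : a n ≤ a 0 + ∑ i ∈ Finset.range n, s i := by
    induction n with
    | zero => simp
    | succ n ih => rw [Finset.sum_range_succ]; linarith [h n]
  linarith [hss.sum_le_tsum (Finset.range n) (fun i _ => hs i)]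

theorem le_add_of_sq_le {a e β : ℝ} (ha : 0 ≤ a) (hβ : 0 ≤ β)
    (h : e ^ 2 ≤ a ^ 2 + 2 * β * e) : e ≤ a + 2 * β := by
  by_contra hlt
  push Not at hlt
  have : 0 < e := by linarith
  nlinarith

theorem summable_of_fejer {a d x e τ : ℕ → ℝ} {c τ0 : ℝ} (hc : 0 < c) (hτ0 : 0 < τ0)
    (hτ : ∀ m, τ0 ≤ τ m ∧ τ m ≤ 1) (ha : ∀ m, 0 ≤ a m) (hx : ∀ m, 0 ≤ x m) (he : ∀ m, 0 ≤ e m)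
    (hes : Summable e) (h1 : ∀ m, d m ≤ a m - c * x m + e m)
    (h2 : ∀ m, a (m + 1) ≤ (1 - τ m) * a m + τ m * d m) :
    Summable x ∧ Summable fun m => a m - d m + e m := by
  have hpos : ∀ m, c * x m ≤ a m - d m + e m := fun m => by linarith [h1 m]
  have hcx : ∀ m, 0 ≤ c * x m := fun m => mul_nonneg hc.le (hx m)
  have hs : Summable fun m => τ0 * (a m - d m + e m) := by
    refine summable_of_le_sub_succ (fun m => mul_nonneg hτ0.le ((hcx m).trans (hpos m))) ha he hes
      fun m => ?_
    have h3 : τ0 * (a m - d m + e m) ≤ τ m * (a m - d m + e m) :=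
      mul_le_mul_of_nonneg_right (hτ m).1 ((hcx m).trans (hpos m))
    have h4 : τ m * e m ≤ 1 * e m := mul_le_mul_of_nonneg_right (hτ m).2 (he m)
    nlinarith [h2 m]
  have hs' : Summable fun m => a m - d m + e m := (summable_mul_left_iff hτ0.ne').mp hs
  exact ⟨(summable_mul_left_iff hc.ne').mp (Summable.of_nonneg_of_le hcx hpos hs'), hs'⟩

theorem summable_of_relaxed {G V τ : ℕ → ℝ} {τ0 : ℝ} (hτ0 : 0 < τ0)
    (hτ : ∀ m, τ0 ≤ τ m ∧ τ m ≤ 1) (hG : ∀ m, 0 ≤ G m) (hV : ∀ m, 0 ≤ V m) (hVs : Summable V)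
    (h : ∀ m, G (m + 1) ≤ (1 - τ m) * G m + τ m * V m) : Summable G := by
  have hs : Summable fun m => τ0 * G m := by
    refine summable_of_le_sub_succ (fun m => mul_nonneg hτ0.le (hG m)) hG hV hVs fun m => ?_
    have h3 : τ0 * G m ≤ τ m * G m := mul_le_mul_of_nonneg_right (hτ m).1 (hG m)
    have h4 : τ m * V m ≤ 1 * V m := mul_le_mul_of_nonneg_right (hτ m).2 (hV m)
    nlinarith [h m]
  exact (summable_mul_left_iff hτ0.ne').mp hs

/-- A summable sequence that is decreasing up to small errors is `o(1 / m)`. -/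
theorem tendsto_nat_mul_of_summable {G θ : ℕ → ℝ} (hG : ∀ m, 0 ≤ G m) (hGs : Summable G)
    (hθ : ∀ m, 0 ≤ θ m) (hθs : Summable θ) (hmθ : Summable fun m : ℕ => (m : ℝ) * θ m)
    (h : ∀ m, G (m + 1) ≤ G m + θ m) : Tendsto (fun m : ℕ => (m : ℝ) * G m) atTop (𝓝 0) := by
  set s : ℕ → ℝ := fun m => G m + ((m : ℝ) * θ m + θ m) with hs
  have hs0 : ∀ m, 0 ≤ s m := fun m => by
    have := hG m
    have := hθ m
    positivity
  have hss : Summable s := hGs.add (hmθ.add hθs)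
  have hstep : ∀ m : ℕ, ((m + 1 : ℕ) : ℝ) * G (m + 1) ≤ (m : ℝ) * G m + s m := fun m => by
    have := mul_le_mul_of_nonneg_left (h m) (by positivity : (0 : ℝ) ≤ ((m + 1 : ℕ) : ℝ))
    simp only [hs]
    push_cast at this ⊢
    linarith
  set Q : ℕ → ℝ := fun m => (m : ℝ) * G m - ∑ i ∈ Finset.range m, s i with hQ
  have hanti : Antitone Q := antitone_nat_of_succ_le fun m => by
    simp only [hQ, Finset.sum_range_succ]
    linarith [hstep m]
  have hbdd : BddBelow (Set.range Q) := by
    refine ⟨-∑' i, s i, ?_⟩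
    rintro _ ⟨m, rfl⟩
    have h1 : 0 ≤ (m : ℝ) * G m := mul_nonneg (Nat.cast_nonneg m) (hG m)
    have h2 := hss.sum_le_tsum (Finset.range m) (fun i _ => hs0 i)
    simp only [hQ]
    linarith
  have hlim := (tendsto_atTop_ciInf hanti hbdd).add hss.hasSum.tendsto_sum_nat
  set l := (⨅ i, Q i) + ∑' i, s i with hl
  have hlim' : Tendsto (fun m : ℕ => (m : ℝ) * G m) atTop (𝓝 l) :=
    hlim.congr fun m => by simp only [hQ]; ring
  have hl0 : 0 ≤ l := ge_of_tendsto hlim'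
    (Eventually.of_forall fun m => mul_nonneg (Nat.cast_nonneg m) (hG m))
  rcases hl0.eq_or_lt with h0 | hpos
  · rwa [← h0] at hlim'
  exfalso
  have hev : ∀ᶠ m : ℕ in atTop, l / 2 < (m : ℝ) * G m :=
    hlim'.eventually (lt_mem_nhds (by linarith))
  obtain ⟨N, hN⟩ := eventually_atTop.mp hev
  have hsum : Summable fun m : ℕ => l / 2 * (1 / ((m + N : ℕ) : ℝ)) := by
    refine Summable.of_nonneg_of_le (fun m => by positivity) (fun m => ?_)
      ((summable_nat_add_iff N).mpr hGs)
    rcases Nat.eq_zero_or_pos (m + N) with hz | hp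
    · rw [hz]; simpa using hG 0
    · rw [mul_one_div, div_le_iff₀ (by exact_mod_cast hp)]
      linarith [hN (m + N) (Nat.le_add_left _ _)]
  have h2 := (summable_mul_left_iff (by linarith : l / 2 ≠ 0)).mp hsum
  exact Real.not_summable_one_div_natCast
    ((summable_nat_add_iff (f := fun m : ℕ => 1 / (m : ℝ)) N).mp h2)

namespace Setting

variable {K X : Type*} {S : Setting K X}
variable {A : K → ℝ} {gp : K → ℝ → ℝ≥0∞} (hS : S.Standing) (hN : S.IsNormalization A gp)
include hS

theorem Standing.forward_backward_descent {γ : ℝ} (hγ : 0 < γ) {u b p s : EllTwo K}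
    (hvar : (Gsum gp p).toReal +
      1 / γ * ⟪u - (γ / S.lam) • (hS.grad u + b) - p, s - p⟫ ≤ (Gsum gp s).toReal) :
    hS.obj A gp p - hS.obj A gp s ≤
      S.lam / γ * ⟪u - p, p - s⟫ + S.kappa ^ 2 * ‖u - p‖ ^ 2 + ‖b‖ * ‖p - s‖ := by
  have hl := hS.lam_pos
  have h1 := sqLoss_le S.y hS.n_pos hS.norm_feat_le u p
  have h2 := le_sqLoss hS.feat S.y u s
  have h3 := mul_le_mul_of_nonneg_left hvar hl.le
  have e1 : S.lam * (1 / γ * ⟪u - (γ / S.lam) • (hS.grad u + b) - p, s - p⟫)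
      = -(S.lam / γ * ⟪u - p, p - s⟫) - ⟪hS.grad u, s - p⟫ + ⟪b, p - s⟫ := by
    rw [show u - (γ / S.lam) • (hS.grad u + b) - p
        = (u - p) - (γ / S.lam) • (hS.grad u + b) by module, inner_sub_left,
      real_inner_smul_left, inner_add_left, ← neg_sub p s, inner_neg_right, inner_neg_right,
      inner_neg_right]
    field_simp
    ring
  have h4 : -⟪b, p - s⟫ ≤ ‖b‖ * ‖p - s‖ := by
    have := abs_real_inner_le_norm b (p - s)
    linarith [neg_abs_le ⟪b, p - s⟫]
  have h5 : ⟪hS.grad u, p - u⟫ - ⟪hS.grad u, s - u⟫ = -⟪hS.grad u, s - p⟫ := by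
    rw [← inner_sub_right, ← inner_neg_right]; congr 1; abel
  rw [mul_add, e1] at h3
  rw [norm_sub_rev] at h1
  unfold Standing.obj Standing.loss
  unfold Standing.grad at h3 h5
  linarith

omit hS in
theorem inner_sub_sub_eq {E : Type*} [NormedAddCommGroup E] [InnerProductSpace ℝ E] (u p s : E) :
    ⟪u - p, p - s⟫ = (‖u - s‖ ^ 2 - ‖u - p‖ ^ 2 - ‖p - s‖ ^ 2) / 2 := by
  have := norm_add_sq_real (u - p) (p - s)
  rw [sub_add_sub_cancel] at this
  linarith

theorem Standing.forward_backward_le_min {γ : ℝ} (hγ : 0 < γ) {u b p s : EllTwo K}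
    (hvar : (Gsum gp p).toReal +
      1 / γ * ⟪u - (γ / S.lam) • (hS.grad u + b) - p, s - p⟫ ≤ (Gsum gp s).toReal) :
    hS.obj A gp p - hS.obj A gp s ≤ S.lam / (2 * γ) * (‖u - s‖ ^ 2 - ‖p - s‖ ^ 2)
      + S.kappa ^ 2 * ‖u - p‖ ^ 2 + ‖b‖ * ‖p - s‖ := by
  have h := hS.forward_backward_descent (A := A) hγ hvar
  rw [inner_sub_sub_eq] at h
  have : 0 ≤ S.lam / (2 * γ) * ‖u - p‖ ^ 2 := by
    have := hS.lam_pos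
    positivity
  have e : S.lam / γ * ((‖u - s‖ ^ 2 - ‖u - p‖ ^ 2 - ‖p - s‖ ^ 2) / 2) =
    S.lam / (2 * γ) * (‖u - s‖ ^ 2 - ‖p - s‖ ^ 2) - S.lam / (2 * γ) * ‖u - p‖ ^ 2 := by
    field_simp; ring
  linarith

theorem Standing.forward_backward_le_self {γ : ℝ} (hγ : 0 < γ) (hγ2 : γ < S.lam / S.kappa ^ 2)
    {u b p : EllTwo K} (hvar : (Gsum gp p).toReal +
      1 / γ * ⟪u - (γ / S.lam) • (hS.grad u + b) - p, u - p⟫ ≤ (Gsum gp u).toReal) :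
    hS.obj A gp p - hS.obj A gp u ≤ ‖b‖ * ‖p - u‖ := by
  have h := hS.forward_backward_descent (A := A) hγ hvar
  have hk := hS.kappa_pos
  rw [← neg_sub u p, inner_neg_right, real_inner_self_eq_norm_sq, norm_neg] at h
  rw [lt_div_iff₀ (by positivity), mul_comm, ← lt_div_iff₀ hγ] at hγ2
  have := mul_le_mul_of_nonneg_right hγ2.le (sq_nonneg ‖u - p‖)
  rw [norm_sub_rev p u]
  linarith

include hN in
theorem Standing.forward_backward_fejer {γ : ℝ} (hγ : 0 < γ) {uh u b p : EllTwo K}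
    (huh : Gsum gp uh ≠ ⊤) (hmin : ∀ v, Gsum gp v ≠ ⊤ → hS.obj A gp uh ≤ hS.obj A gp v)
    (hp : Gsum gp p ≠ ⊤) (hvar : (Gsum gp p).toReal +
      1 / γ * ⟪u - (γ / S.lam) • (hS.grad u + b) - p, uh - p⟫ ≤ (Gsum gp uh).toReal) :
    ‖p - uh‖ ^ 2 ≤ ‖u - uh‖ ^ 2 - (1 - γ * S.kappa ^ 2 / S.lam) * ‖u - p‖ ^ 2
      + 2 * (γ / S.lam * ‖b‖) * ‖p - uh‖ := by
  have hl := hS.lam_pos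
  have h1 := hS.first_order hN huh hmin hp
  have h2 := inner_sqLossGrad_sub_le S.y hS.n_pos hS.norm_feat_le u uh p
  have h3 : -⟪b, p - uh⟫ ≤ ‖b‖ * ‖p - uh‖ := by
    have := abs_real_inner_le_norm b (p - uh)
    linarith [neg_abs_le ⟪b, p - uh⟫]
  have h4 := inner_sub_sub_eq u p uh
  have e1 : ⟪u - (γ / S.lam) • (hS.grad u + b) - p, uh - p⟫
      = -⟪u - p, p - uh⟫ + γ / S.lam * (⟪hS.grad u, p - uh⟫ + ⟪b, p - uh⟫) := by
    rw [show u - (γ / S.lam) • (hS.grad u + b) - p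
        = (u - p) - (γ / S.lam) • (hS.grad u + b) by module, inner_sub_left,
      real_inner_smul_left, inner_add_left, ← neg_sub p uh, inner_neg_right, inner_neg_right,
      inner_neg_right]
    ring
  have e2 : ⟪uh - p, sqLossGrad hS.feat S.y u - sqLossGrad hS.feat S.y uh⟫
      = -⟪hS.grad u, p - uh⟫ + ⟪hS.grad uh, p - uh⟫ := by
    rw [real_inner_comm, inner_sub_left, ← neg_sub p uh, inner_neg_right, inner_neg_right]
    unfold Standing.grad; ring
  rw [e1] at hvar
  rw [e2] at h2
  have h5 : -⟪u - p, p - uh⟫ + γ / S.lam * (⟪hS.grad u, p - uh⟫ + ⟪b, p - uh⟫)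
      ≤ γ * ((Gsum gp uh).toReal - (Gsum gp p).toReal) := by
    have := mul_le_mul_of_nonneg_left (sub_nonneg.mpr hvar) hγ.le
    have e : γ * (1 / γ * (-⟪u - p, p - uh⟫ +
        γ / S.lam * (⟪hS.grad u, p - uh⟫ + ⟪b, p - uh⟫)))
      = -⟪u - p, p - uh⟫ + γ / S.lam * (⟪hS.grad u, p - uh⟫ + ⟪b, p - uh⟫) := by
      field_simp
    linarith
  have hg : 0 < γ / S.lam := div_pos hγ hl
  have h6 := mul_le_mul_of_nonneg_left h1 hg.le
  have e3 : γ / S.lam * (S.lam * ((Gsum gp p).toReal - (Gsum gp uh).toReal))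
      = γ * ((Gsum gp p).toReal - (Gsum gp uh).toReal) := by field_simp
  rw [mul_add, e3] at h6
  have h7 := mul_le_mul_of_nonneg_left h2 hg.le
  have h8 := mul_le_mul_of_nonneg_left h3 hg.le
  have e4 : γ * S.kappa ^ 2 / S.lam * ‖u - p‖ ^ 2
      = 2 * (γ / S.lam * (S.kappa ^ 2 / 2 * ‖u - p‖ ^ 2)) := by ring
  linarith

end Setting

namespace AlgParams

variable {K : Type*} (P : AlgParams K)

/-- The decay factor `max {m, 1}^(-2p)` of the error tolerance. -/
def decay (m : ℕ) : ℝ := ((max m 1 : ℕ) : ℝ) ^ (-2 * P.p)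

theorem decay_pos (m : ℕ) : 0 < P.decay m := by
  have : (0 : ℝ) < ((max m 1 : ℕ) : ℝ) := by
    exact_mod_cast lt_of_lt_of_le Nat.zero_lt_one (le_max_right m 1)
  exact Real.rpow_pos_of_pos this _

variable {P} {X : Type*} {S : Setting K X}

theorem Admissible.decay_le_one (hP : P.Admissible S) (m : ℕ) : P.decay m ≤ 1 :=
  Real.rpow_le_one_of_one_le_of_nonpos (by exact_mod_cast le_max_right m 1)
    (by linarith [hP.one_lt_p])

theorem Admissible.summable_mul_decay (hP : P.Admissible S) :
    Summable fun m : ℕ => (m : ℝ) * P.decay m := by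
  have h := Real.summable_nat_rpow.mpr (show 1 + -2 * P.p < -1 by linarith [hP.one_lt_p])
  refine h.congr fun m => ?_
  rcases Nat.eq_zero_or_pos m with rfl | hm
  · simp only [Nat.cast_zero, zero_mul]
    exact Real.zero_rpow (by linarith [hP.one_lt_p])
  · have : (0 : ℝ) < m := by exact_mod_cast hm
    rw [decay, max_eq_left (show 1 ≤ m from hm), Real.rpow_add this, Real.rpow_one]

theorem Admissible.summable_decay (hP : P.Admissible S) : Summable P.decay := by
  have h := Real.summable_nat_rpow.mpr (show -2 * P.p < -1 by linarith [hP.one_lt_p])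
  rw [← summable_nat_add_iff 1] at h ⊢
  refine h.congr fun m => ?_
  rw [decay, max_eq_left (Nat.le_add_left 1 m)]

end AlgParams

/-- The iterates `u`, `v` of a run and the exact forward-backward points `p`, as elements of
`ℓ²`. -/
structure AlgFamilies.IsOrbit {K X : Type*} {S : Setting K X} (R : AlgFamilies K)
    (hS : S.Standing) (gp : K → ℝ → ℝ≥0∞) (P : AlgParams K) (u v p : ℕ → EllTwo K) : Prop where
  mu_eq : ∀ m k, u m k = R.mu m k
  nu_eq : ∀ m k, v m k = R.nu m k
  succ : ∀ m, u (m + 1) = (1 - P.tau m) • u m + P.tau m • v m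
  proj : ∀ m k, IsProj (S.C k) (R.prx m k) (p m k)
  ne_top : ∀ m, Gsum gp (p m) ≠ ⊤
  chi_eq : ∀ m k, R.chi m k = (u m - (P.gam m / S.lam) • (hS.grad (u m) + P.b m)) k
  variational : ∀ m, ∀ s : EllTwo K, Gsum gp s ≠ ⊤ → (Gsum gp (p m)).toReal +
    1 / P.gam m * ⟪u m - (P.gam m / S.lam) • (hS.grad (u m) + P.b m) - p m, s - p m⟫
      ≤ (Gsum gp s).toReal
  dist_le : ∀ m, ‖v m - p m‖ ≤ P.zeta * √(∑' k, P.xi k ^ 2) * P.decay m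

namespace AlgFamilies.IsRun

variable {K X : Type*} {S : Setting K X} {P : AlgParams K} {R : AlgFamilies K}
variable {A : K → ℝ} {gp : K → ℝ → ℝ≥0∞}

theorem alpha_mul_le (hR : R.IsRun S P) (m : ℕ) (k : K) :
    ENNReal.ofReal |R.alpha m k| * (4 * ENNReal.ofReal (P.gam m) *
        max (S.h k (|R.chi m k| + 2)) (S.h k (-|R.chi m k| - 2))
        + ENNReal.ofReal (2 * |R.chi m k| + 1)) ≤
      ENNReal.ofReal (P.zeta * P.decay m * P.xi k) :=
  ENNReal.mul_le_of_le_div (hR.alpha_le m k)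

theorem ofReal_tol_le (hP : P.Admissible S) (m : ℕ) (k : K) :
    ENNReal.ofReal (P.zeta * P.decay m * P.xi k) ≤
      ENNReal.ofReal (P.zeta * P.decay m * |P.xi k|) := by
  have := hP.zeta_pos
  have := P.decay_pos m
  exact ENNReal.ofReal_le_ofReal (mul_le_mul_of_nonneg_left (le_abs_self _) (by positivity))

theorem abs_alpha_le (hR : R.IsRun S P) (hP : P.Admissible S) (m : ℕ) (k : K) :
    |R.alpha m k| ≤ P.zeta * P.decay m * |P.xi k| := by
  have hz := hP.zeta_pos
  have hd := P.decay_pos m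
  have h1 := (hR.alpha_mul_le m k).trans (ofReal_tol_le hP m k)
  have h2 : ENNReal.ofReal |R.alpha m k| * 1 ≤
      ENNReal.ofReal |R.alpha m k| * (4 * ENNReal.ofReal (P.gam m) *
        max (S.h k (|R.chi m k| + 2)) (S.h k (-|R.chi m k| - 2))
        + ENNReal.ofReal (2 * |R.chi m k| + 1)) := by
    gcongr
    refine le_trans ?_ le_add_self
    rw [ENNReal.one_le_ofReal]
    linarith [abs_nonneg (R.chi m k)]
  rw [mul_one] at h2
  exact (ENNReal.ofReal_le_ofReal_iff (by positivity)).mp (h2.trans h1)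

theorem alpha_mul_h_le (hR : R.IsRun S P) (hP : P.Admissible S) (m : ℕ) (k : K) :
    ENNReal.ofReal (P.gam m * |R.alpha m k|) *
        max (S.h k (|R.chi m k| + 2)) (S.h k (-(|R.chi m k| + 2)))
      ≤ ENNReal.ofReal (P.zeta * P.decay m * |P.xi k|) := by
  obtain ⟨lo, hi, hlo, -, hg⟩ := hP.gam_bounds
  have hg0 : 0 ≤ P.gam m := hlo.le.trans (hg m).1
  refine le_trans ?_ ((hR.alpha_mul_le m k).trans (ofReal_tol_le hP m k))
  rw [neg_add', ENNReal.ofReal_mul hg0, mul_comm (ENNReal.ofReal (P.gam m)), mul_assoc]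
  gcongr
  refine le_trans ?_ le_self_add
  rw [mul_assoc]
  exact le_mul_of_one_le_left' (by norm_num)

theorem summable_xi_sq (hP : P.Admissible S) : Summable fun k => P.xi k ^ 2 := by
  have h1 : Memℓp P.xi 1 := by
    rw [memℓp_gen_iff (by norm_num)]
    simpa using hP.xi_summable.abs
  have h2 := h1.of_exponent_ge (p := 2) (by norm_num)
  rw [memℓp_gen_iff (by norm_num)] at h2
  simpa using h2

/-- One iteration: the exact forward-backward point and the computed point are in `ℓ²`. -/
theorem exists_step (hR : R.IsRun S P) (hP : P.Admissible S) (hS : S.Standing)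
    (hN : S.IsNormalization A gp) (m : ℕ) (u : EllTwo K) (hu : ∀ k, u k = R.mu m k) :
    ∃ p v : EllTwo K, (∀ k, v k = R.nu m k) ∧ (∀ k, IsProj (S.C k) (R.prx m k) (p k)) ∧
      Gsum gp p ≠ ⊤ ∧
      (∀ k, R.chi m k = (u - (P.gam m / S.lam) • (hS.grad u + P.b m)) k) ∧
      (∀ s : EllTwo K, Gsum gp s ≠ ⊤ → (Gsum gp p).toReal +
        1 / P.gam m * ⟪u - (P.gam m / S.lam) • (hS.grad u + P.b m) - p, s - p⟫
          ≤ (Gsum gp s).toReal) ∧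
      ‖v - p‖ ≤ P.zeta * √(∑' k, P.xi k ^ 2) * P.decay m := by
  obtain ⟨lo, hi, hlo, -, hg⟩ := hP.gam_bounds
  have hg0 : 0 < P.gam m := hlo.trans_le (hg m).1
  have hz := hP.zeta_pos
  have hd := P.decay_pos m
  have hchi : ∀ k, R.chi m k = (u - (P.gam m / S.lam) • (hS.grad u + P.b m)) k := by
    intro k
    have hmu : R.mu m = u := funext fun k => (hu k).symm
    have hgrad : hS.grad u k =
        2 / (S.n : ℝ) * ∑ i, (⟪hS.feat i, u⟫ - S.y i) * S.phi k (S.x i) := by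
      unfold Setting.Standing.grad sqLossGrad
      simp only [lp.coeFn_smul, lp.coeFn_sum, Pi.smul_apply, Finset.sum_apply, smul_eq_mul]
      rfl
    rw [hR.chi_eq m k, hmu]
    simp only [hS.predict_eq]
    simp only [lp.coeFn_sub, lp.coeFn_smul, lp.coeFn_add, Pi.sub_apply, Pi.smul_apply,
      Pi.add_apply, smul_eq_mul, hgrad]
  have hq : ∀ k, IsProx (fun s => ENNReal.ofReal (P.gam m) * S.h k s)
      (softThreshold (P.gam m * S.dlo k) (P.gam m * S.dhi k)
        ((u - (P.gam m / S.lam) • (hS.grad u + P.b m)) k)) (R.prx m k) := by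
    intro k
    rw [← hchi k, ← hR.thr_eq m k]
    exact hR.prx_spec m k
  obtain ⟨p, hp, hpfin, hvar⟩ := hS.exists_exact_step hN hg0 _ (R.prx m) hq
  have hdiff : ∀ k, |R.nu m k - p k| ≤ P.zeta * P.decay m * |P.xi k| := by
    intro k
    refine (hS.abs_nu_sub_le hg0 (hq k) (hp k) ?_).trans (hR.abs_alpha_le hP m k)
    have := hR.nu_spec m k
    rwa [hR.pii_eq m k, hR.thr_eq m k, hchi k] at this
  have hsq : ∀ k, (R.nu m k - p k) ^ 2 ≤ (P.zeta * P.decay m) ^ 2 * P.xi k ^ 2 := by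
    intro k
    rw [← mul_pow]
    refine sq_le_sq.mpr ((hdiff k).trans (le_of_eq ?_))
    rw [abs_mul, abs_of_pos (by positivity : 0 < P.zeta * P.decay m)]
  have hxi := (summable_xi_sq hP).mul_left ((P.zeta * P.decay m) ^ 2)
  have hsum := Summable.of_nonneg_of_le (fun k => sq_nonneg _) hsq hxi
  have hmem : Memℓp (fun k => R.nu m k - p k) 2 := memℓp_two_of_summable_sq hsum
  refine ⟨p, ⟨_, hmem⟩ + p, fun k => ?_, hp, hpfin, hchi, hvar, ?_⟩
  · simp only [lp.coeFn_add, Pi.add_apply]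
    ring
  · rw [add_sub_cancel_right]
    refine le_of_sq_le_sq ?_ (by positivity)
    rw [EllTwo.norm_sq, mul_right_comm, mul_pow, Real.sq_sqrt (tsum_nonneg fun k => sq_nonneg _),
      ← tsum_mul_left]
    exact hsum.tsum_le_tsum hsq hxi

theorem exists_orbit (hR : R.IsRun S P) (hP : P.Admissible S) (hS : S.Standing)
    (hN : S.IsNormalization A gp) :
    ∃ u v p : ℕ → EllTwo K, R.IsOrbit hS gp P u v p := by
  have hmem : ∀ m, Memℓp (R.mu m) 2 := by
    intro m
    induction m with
    | zero => exact hR.start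
    | succ m ih =>
      obtain ⟨p, v, hv, -⟩ := hR.exists_step hP hS hN m ⟨R.mu m, ih⟩ (fun _ => rfl)
      have h : Memℓp (⇑v) 2 := v.2
      rw [show (⇑v : K → ℝ) = R.nu m from funext hv] at h
      have := ih.add ((h.sub ih).const_smul (P.tau m))
      convert this using 1
      funext k
      rw [hR.mu_succ m k]
      rfl
  choose p v hv hp hpfin hchi hvar hvp using
    fun m => hR.exists_step hP hS hN m ⟨R.mu m, hmem m⟩ (fun _ => rfl)
  refine ⟨fun m => ⟨R.mu m, hmem m⟩, v, p, fun _ _ => rfl, hv, fun m => ?_, hp, hpfin, hchi,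
    hvar, hvp⟩
  ext k
  simp only [lp.coeFn_add, lp.coeFn_smul, Pi.add_apply, Pi.smul_apply, smul_eq_mul, hv m k]
  rw [hR.mu_succ m k]; ring

end AlgFamilies.IsRun

theorem Setting.Standing.dualBound_le {K X : Type*} {S : Setting K X} (hS : S.Standing) :
    ∃ c : ℝ, 0 ≤ c ∧ ∀ k, S.dualBound k ≤ c := by
  have hr := hS.one_lt_r
  refine ⟨1 + ∑' k, S.dualBound k ^ (S.r / (S.r - 1)), ?_, fun k => ?_⟩
  · have : 0 ≤ ∑' k, S.dualBound k ^ (S.r / (S.r - 1)) :=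
      tsum_nonneg fun k => Real.rpow_nonneg (dualBound_nonneg k) _
    linarith
  · have h1 := hS.summable_dual.le_tsum k fun j _ => Real.rpow_nonneg (dualBound_nonneg j) _
    have h0 : 0 ≤ S.dualBound k ^ (S.r / (S.r - 1)) := Real.rpow_nonneg (dualBound_nonneg k) _
    change S.dualBound k ^ (S.r / (S.r - 1)) ≤ ∑' k, S.dualBound k ^ (S.r / (S.r - 1)) at h1
    rcases le_total (S.dualBound k) 1 with h | h
    · linarith
    · have := Real.self_le_rpow_of_one_le h
        (show 1 ≤ S.r / (S.r - 1) by rw [le_div_iff₀ (by linarith)]; linarith)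
      linarith

theorem Setting.Standing.tendsto_dualBound {K X : Type*} {S : Setting K X} (hS : S.Standing) :
    Tendsto S.dualBound cofinite (𝓝 0) := by
  have hr := hS.one_lt_r
  have hpos : 0 < S.r / (S.r - 1) := div_pos (by linarith) (by linarith)
  have h := (hS.summable_dual.tendsto_cofinite_zero).rpow_const
    (p := 1 / (S.r / (S.r - 1))) (Or.inr (by positivity))
  rw [Real.zero_rpow (by positivity)] at h
  refine h.congr fun k => ?_
  change (S.dualBound k ^ (S.r / (S.r - 1))) ^ (1 / (S.r / (S.r - 1))) = S.dualBound k
  rw [← Real.rpow_mul (dualBound_nonneg k), mul_one_div_cancel hpos.ne', Real.rpow_one]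

namespace AlgFamilies

variable {K X : Type*} {S : Setting K X} {P : AlgParams K} {R : AlgFamilies K}
variable {A : K → ℝ} {gp : K → ℝ → ℝ≥0∞} {u v p : ℕ → EllTwo K} {uh : EllTwo K}

theorem IsOrbit.fejer {hS : S.Standing} (hO : R.IsOrbit hS gp P u v p) (hP : P.Admissible S)
    (hN : S.IsNormalization A gp) (huh : Gsum gp uh ≠ ⊤)
    (hmin : ∀ w, Gsum gp w ≠ ⊤ → hS.obj A gp uh ≤ hS.obj A gp w) :
    ∃ c C : ℝ, 0 < c ∧ 0 ≤ C ∧ ∀ m, ‖p m - uh‖ ^ 2 ≤ ‖u m - uh‖ ^ 2 - c * ‖u m - p m‖ ^ 2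
      + 2 * (C * ‖P.b m‖) * ‖p m - uh‖ := by
  obtain ⟨lo, hi, hlo, hhi, hg⟩ := hP.gam_bounds
  have hl := hS.lam_pos
  have hk := hS.kappa_pos
  have hhi0 : 0 < hi := hlo.trans_le ((hg 0).1.trans (hg 0).2)
  refine ⟨1 - hi * S.kappa ^ 2 / S.lam, hi / S.lam, ?_, by positivity, fun m => ?_⟩
  · rw [lt_div_iff₀ (by positivity)] at hhi
    rw [sub_pos, div_lt_one hl]
    exact hhi
  · have hg0 : 0 < P.gam m := hlo.trans_le (hg m).1
    refine (hS.forward_backward_fejer hN hg0 huh hmin (hO.ne_top m)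
      (hO.variational m uh huh)).trans ?_
    have h1 : P.gam m * S.kappa ^ 2 / S.lam * ‖u m - p m‖ ^ 2 ≤
        hi * S.kappa ^ 2 / S.lam * ‖u m - p m‖ ^ 2 := by
      gcongr
      exact (hg m).2
    have h2 : P.gam m / S.lam * ‖P.b m‖ * ‖p m - uh‖ ≤ hi / S.lam * ‖P.b m‖ * ‖p m - uh‖ := by
      gcongr
      exact (hg m).2
    linarith

theorem IsOrbit.bounded {hS : S.Standing} (hO : R.IsOrbit hS gp P u v p) (hP : P.Admissible S)
    (hN : S.IsNormalization A gp) (huh : Gsum gp uh ≠ ⊤)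
    (hmin : ∀ w, Gsum gp w ≠ ⊤ → hS.obj A gp uh ≤ hS.obj A gp w) :
    ∃ B : ℝ, 0 ≤ B ∧ ∀ m, ‖u m - uh‖ ≤ B ∧ ‖v m - uh‖ ≤ B ∧ ‖p m - uh‖ ≤ B := by
  obtain ⟨c, C, hc, hC, hF⟩ := hO.fejer hP hN huh hmin
  obtain ⟨τ0, hτ0, hτ⟩ := hP.tau_bounds
  have hz := hP.zeta_pos
  set D := P.zeta * √(∑' k, P.xi k ^ 2) with hD
  have hD0 : 0 ≤ D := by positivity
  set s : ℕ → ℝ := fun m => 2 * (C * ‖P.b m‖) + D * P.decay m with hs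
  have hd := P.decay_pos
  have hs0 : ∀ m, 0 ≤ s m := fun m => by
    have := (hd m).le
    positivity
  have hss : Summable s :=
    ((hP.b_summable.mul_left C).mul_left 2).add (hP.summable_decay.mul_left D)
  have he : ∀ m, ‖p m - uh‖ ≤ ‖u m - uh‖ + 2 * (C * ‖P.b m‖) := fun m => by
    refine le_add_of_sq_le (norm_nonneg _) (by positivity) ((hF m).trans ?_)
    have : 0 ≤ c * ‖u m - p m‖ ^ 2 := by positivity
    linarith
  have hv : ∀ m, ‖v m - uh‖ ≤ ‖u m - uh‖ + s m := fun m => by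
    have h1 := norm_add_le (v m - p m) (p m - uh)
    rw [sub_add_sub_cancel] at h1
    simp only [hs]
    linarith [he m, hO.dist_le m]
  have hstep : ∀ m, ‖u (m + 1) - uh‖ ≤ ‖u m - uh‖ + s m := fun m => by
    have hτ1 := (hτ m).2
    have hτ2 : 0 ≤ P.tau m := hτ0.le.trans (hτ m).1
    have e : u (m + 1) - uh = (1 - P.tau m) • (u m - uh) + P.tau m • (v m - uh) := by
      rw [hO.succ m]; module
    rw [e]
    refine (norm_add_le _ _).trans ?_
    rw [norm_smul, norm_smul, Real.norm_of_nonneg hτ2, Real.norm_of_nonneg (by linarith)]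
    nlinarith [mul_le_mul_of_nonneg_left (hv m) hτ2, mul_le_mul_of_nonneg_right hτ1 (hs0 m)]
  have hu := bounded_of_le_add (a := fun m => ‖u m - uh‖) hs0 hss hstep
  have hsle : ∀ m, s m ≤ ∑' j, s j := fun m => hss.le_tsum m fun j _ => hs0 j
  have hT : 0 ≤ ∑' j, s j := tsum_nonneg hs0
  refine ⟨‖u 0 - uh‖ + ∑' j, s j + ∑' j, s j, by positivity, fun m => ⟨?_, ?_, ?_⟩⟩
  · linarith [hu m]
  · linarith [hu m, hv m, hsle m]
  · have : 0 ≤ D * P.decay m := mul_nonneg hD0 (hd m).le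
    have h2 : 2 * (C * ‖P.b m‖) ≤ s m := by simp only [hs]; linarith
    linarith [hu m, he m, hsle m]

theorem IsOrbit.chi_bounded {hS : S.Standing} (hO : R.IsOrbit hS gp P u v p)
    (hP : P.Admissible S) {B : ℝ} (hB : ∀ m, ‖u m - uh‖ ≤ B) :
    ∃ Bc : ℝ, 0 ≤ Bc ∧ ∀ m k, |R.chi m k| ≤ Bc := by
  obtain ⟨lo, hi, hlo, hhi, hg⟩ := hP.gam_bounds
  have hl := hS.lam_pos
  have hhi0 : 0 < hi := hlo.trans_le ((hg 0).1.trans (hg 0).2)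
  obtain ⟨G, hG⟩ := norm_sqLossGrad_le S.y hS.n_pos hS.norm_feat_le (B + ‖uh‖)
  have hunorm : ∀ m, ‖u m‖ ≤ B + ‖uh‖ := fun m => by
    have := norm_add_le (u m - uh) uh
    rw [sub_add_cancel] at this
    linarith [hB m]
  have hb : ∀ m, ‖P.b m‖ ≤ ∑' j, ‖P.b j‖ := fun m =>
    hP.b_summable.le_tsum m fun j _ => norm_nonneg _
  have key : ∀ m k, |R.chi m k| ≤ B + ‖uh‖ + hi / S.lam * (G + ∑' j, ‖P.b j‖) := fun m k => by
    rw [hO.chi_eq m k, ← Real.norm_eq_abs]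
    refine (lp.norm_apply_le_norm (by norm_num) _ k).trans ((norm_sub_le _ _).trans ?_)
    refine add_le_add (hunorm m) ?_
    have hg0 : 0 ≤ P.gam m := hlo.le.trans (hg m).1
    rw [norm_smul, Real.norm_of_nonneg (by positivity)]
    have h1 : ‖hS.grad (u m) + P.b m‖ ≤ G + ∑' j, ‖P.b j‖ :=
      (norm_add_le _ _).trans (add_le_add (hG _ (hunorm m)) (hb m))
    have h2 : P.gam m / S.lam ≤ hi / S.lam := by
      gcongr
      exact (hg m).2
    exact mul_le_mul h2 h1 (norm_nonneg _) (by positivity)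
  exact ⟨max _ 0, le_max_right _ _, fun m k => (key m k).trans (le_max_left _ _)⟩

/-- The exact and the computed points have nearly the same penalty. -/
theorem IsOrbit.Gsum_error {hS : S.Standing} (hO : R.IsOrbit hS gp P u v p)
    (hR : R.IsRun S P) (hP : P.Admissible S) (hN : S.IsNormalization A gp) {Bc : ℝ}
    (hBc : ∀ m k, |R.chi m k| ≤ Bc) :
    ∃ M : ℝ, 0 ≤ M ∧ ∀ m, Gsum gp (v m) ≤ Gsum gp (p m) + ENNReal.ofReal (M * P.decay m) := by
  classical
  obtain ⟨lo, hi, hlo, hhi, hg⟩ := hP.gam_bounds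
  have hz := hP.zeta_pos
  have hhi0 : 0 < hi := hlo.trans_le ((hg 0).1.trans (hg 0).2)
  obtain ⟨cd, hcd0, hcd⟩ := hS.dualBound_le
  set good : K → Prop := fun k => hi * S.dualBound k + P.zeta * |P.xi k| ≤ 1 with hgood
  set r : K → ℝ := fun k => Bc + hi * S.dualBound k + P.zeta * |P.xi k| + 1 with hr
  set Λ : K → ℝ := fun k => (max (S.h k (r k)) (S.h k (-r k))).toReal with hΛ
  set e : K → ℝ := fun k => P.zeta * |P.xi k| +
    if good k then 0 else hi * (P.zeta * |P.xi k|) * Λ k with he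
  have hΛ0 : ∀ k, 0 ≤ Λ k := fun k => ENNReal.toReal_nonneg
  have hite0 : ∀ k, 0 ≤ if good k then 0 else hi * (P.zeta * |P.xi k|) * Λ k := fun k => by
    split_ifs
    · exact le_rfl
    · have := hΛ0 k
      positivity
  have he0 : ∀ k, 0 ≤ e k := fun k => add_nonneg (by positivity) (hite0 k)
  have hxi : Summable fun k => P.zeta * |P.xi k| := hP.xi_summable.abs.mul_left _
  have hgoodev : ∀ᶠ k in cofinite, good k := by
    have h1 := (hS.tendsto_dualBound.const_mul hi).add hxi.tendsto_cofinite_zero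
    rw [mul_zero, add_zero] at h1
    filter_upwards [h1.eventually (gt_mem_nhds zero_lt_one)] with k hk using hk.le
  have hes : Summable e := by
    refine hxi.add ?_
    refine summable_of_hasFiniteSupport ?_
    refine (hgoodev : {k | good k}ᶜ.Finite).subset fun k hk => ?_
    simp only [Function.mem_support] at hk
    intro hgk
    exact hk (if_pos hgk)
  set M : K → ℝ := fun k => (P.zeta * |P.xi k| * (Bc + hi * cd) + e k) / lo with hM
  have hcomp : ∀ m k, gp k (v m k) ≤ gp k (p m k) + ENNReal.ofReal (M k * P.decay m) := by
    intro m k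
    have hg0 : 0 < P.gam m := hlo.trans_le (hg m).1
    have hd := P.decay_pos m
    have hd1 := hP.decay_le_one m
    have hα := hR.abs_alpha_le hP m k
    have hαh := hR.alpha_mul_h_le hP m k
    have hdb := dualBound_nonneg (S := S) k
    have hgdb : P.gam m * S.dualBound k ≤ hi * S.dualBound k := by
      gcongr
      exact (hg m).2
    have hα1 : |R.alpha m k| ≤ P.zeta * |P.xi k| := by
      refine hα.trans ?_
      rw [mul_right_comm]
      exact mul_le_of_le_one_right (by positivity) hd1
    have hex : ∃ q : ℝ, |R.chi m k| + P.gam m * S.dualBound k + |R.alpha m k| + 1 ≤ q ∧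
        ENNReal.ofReal (P.gam m * |R.alpha m k|) * max (S.h k q) (S.h k (-q))
          ≤ ENNReal.ofReal (e k * P.decay m) := by
      have hsmall : P.gam m * S.dualBound k + |R.alpha m k| ≤ 1 →
          ∃ q : ℝ, |R.chi m k| + P.gam m * S.dualBound k + |R.alpha m k| + 1 ≤ q ∧
          ENNReal.ofReal (P.gam m * |R.alpha m k|) * max (S.h k q) (S.h k (-q))
            ≤ ENNReal.ofReal (e k * P.decay m) := by
        intro hle
        refine ⟨|R.chi m k| + 2, by linarith, hαh.trans (ENNReal.ofReal_le_ofReal ?_)⟩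
        rw [mul_right_comm]
        exact mul_le_mul_of_nonneg_right (le_add_of_nonneg_right (hite0 k)) hd.le
      by_cases hgk : good k
      · exact hsmall (by simp only [hgood] at hgk; linarith)
      rcases hR.alpha_dom m k with hfin | h0 | ⟨hD, hle⟩
      · refine ⟨r k, by simp only [hr]; linarith [hBc m k], ?_⟩
        have hmax : max (S.h k (r k)) (S.h k (-r k)) ≠ ⊤ := by
          rcases max_choice (S.h k (r k)) (S.h k (-r k)) with h | h <;> rw [h] <;> exact hfin _
        rw [← ENNReal.ofReal_toReal hmax, ← ENNReal.ofReal_mul (by positivity)]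
        refine ENNReal.ofReal_le_ofReal ?_
        change P.gam m * |R.alpha m k| * Λ k ≤ e k * P.decay m
        have h1 : P.gam m * |R.alpha m k| * Λ k ≤
            hi * (P.zeta * P.decay m * |P.xi k|) * Λ k := by
          have := hΛ0 k
          gcongr
          exact (hg m).2
        refine h1.trans ?_
        simp only [he, if_neg hgk]
        have : 0 ≤ P.zeta * |P.xi k| * P.decay m := by positivity
        linarith
      · refine ⟨_, le_rfl, ?_⟩
        rw [h0, abs_zero, mul_zero, ENNReal.ofReal_zero, zero_mul]
        exact zero_le
      · refine hsmall ?_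
        have hz0 : S.dualBound k = 0 := by
          unfold dualBound
          rw [max_eq_right hD.1, max_eq_right (by linarith [hD.2]), add_zero]
        rw [hz0, mul_zero, zero_add]
        exact hle
    obtain ⟨q, hq1, hq2⟩ := hex
    have hprx := hR.prx_spec m k
    have hnu := hR.nu_spec m k
    rw [hR.thr_eq m k] at hprx hnu
    rw [hR.pii_eq m k] at hnu
    rw [hO.nu_eq m k]
    refine (hS.component_error hN hg0 hprx (hO.proj m k) hnu hq1
      (mul_nonneg (he0 k) hd.le) hq2).trans ?_
    gcongr
    rw [hM]
    simp only
    rw [div_mul_eq_mul_div, add_mul (P.zeta * |P.xi k| * (Bc + hi * cd))]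
    have h1 : |R.alpha m k| * (|R.chi m k| + P.gam m * S.dualBound k) ≤
        P.zeta * |P.xi k| * (Bc + hi * cd) * P.decay m := by
      have h2 : |R.chi m k| + P.gam m * S.dualBound k ≤ Bc + hi * cd := by
        have := mul_le_mul_of_nonneg_left (hcd k) hhi0.le
        linarith [hBc m k]
      have h3 := mul_le_mul hα h2 (by positivity) (by positivity)
      linarith
    have h0 : 0 ≤ |R.alpha m k| * (|R.chi m k| + P.gam m * S.dualBound k) := by positivity
    exact div_le_div₀ (h0.trans h1 |>.trans (le_add_of_nonneg_right
      (mul_nonneg (he0 k) hd.le))) (add_le_add h1 le_rfl) hlo (hg m).1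
  have hMs : Summable M := ((hxi.mul_right _).add hes).div_const lo
  have hM0 : ∀ k, 0 ≤ M k := fun k => by
    have h1 : 0 ≤ Bc := (abs_nonneg _).trans (hBc 0 k)
    have := he0 k
    simp only [hM]
    positivity
  refine ⟨∑' k, M k, tsum_nonneg hM0, fun m => ?_⟩
  unfold Gsum
  rw [← tsum_mul_right, ENNReal.ofReal_tsum_of_nonneg
    (fun k => mul_nonneg (hM0 k) (P.decay_pos m).le) (hMs.mul_right _), ← ENNReal.tsum_add]
  exact ENNReal.tsum_le_tsum (hcomp m)

end AlgFamilies

/-- A relaxed recursion driven by a null sequence tends to zero. -/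
theorem tendsto_zero_of_relaxed {G V τ : ℕ → ℝ} {τ0 : ℝ} (hτ0 : 0 < τ0)
    (hτ : ∀ m, τ0 ≤ τ m ∧ τ m ≤ 1) (hG : ∀ m, 0 ≤ G m) (hV : Tendsto V atTop (𝓝 0))
    (h : ∀ m, G (m + 1) ≤ (1 - τ m) * G m + τ m * V m) : Tendsto G atTop (𝓝 0) := by
  have hτ1 : τ0 ≤ 1 := (hτ 0).1.trans (hτ 0).2
  refine tendsto_order.mpr ⟨fun a ha => Eventually.of_forall fun m => ha.trans_le (hG m),
    fun ε hε => ?_⟩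
  obtain ⟨N, hN⟩ := eventually_atTop.mp (hV.eventually (gt_mem_nhds (half_pos hε)))
  have hH : ∀ j, max (G (j + N) - ε / 2) 0 ≤ (1 - τ0) ^ j * max (G N - ε / 2) 0 := by
    intro j
    induction j with
    | zero => simp
    | succ j ih =>
      have h1 := h (j + N)
      have h2 := hN (j + N) (Nat.le_add_left _ _)
      have h3 := hτ (j + N)
      have h4 : G (j + N + 1) - ε / 2 ≤ (1 - τ (j + N)) * max (G (j + N) - ε / 2) 0 := by
        have h5 := mul_le_mul_of_nonneg_left (le_max_left (G (j + N) - ε / 2) 0)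
          (by linarith : 0 ≤ 1 - τ (j + N))
        have h6 := mul_le_mul_of_nonneg_left h2.le (by linarith : 0 ≤ τ (j + N))
        linarith
      have h7 : (1 - τ (j + N)) * max (G (j + N) - ε / 2) 0
          ≤ (1 - τ0) * max (G (j + N) - ε / 2) 0 :=
        mul_le_mul_of_nonneg_right (by linarith) (le_max_right _ _)
      have h8 := mul_le_mul_of_nonneg_left ih (by linarith : 0 ≤ 1 - τ0)
      rw [show j + 1 + N = j + N + 1 by ring, pow_succ]
      refine max_le (by linarith) (mul_nonneg (mul_nonneg (pow_nonneg (by linarith) _)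
        (by linarith)) (le_max_right _ _))
  have hpow := (tendsto_pow_atTop_nhds_zero_of_lt_one (by linarith : 0 ≤ 1 - τ0)
    (by linarith)).mul_const (max (G N - ε / 2) 0)
  rw [zero_mul] at hpow
  have hev : ∀ᶠ j in atTop, G (j + N) < ε := by
    filter_upwards [hpow.eventually (gt_mem_nhds (half_pos hε))] with j hj
    linarith [hH j, le_max_left (G (j + N) - ε / 2) 0]
  obtain ⟨L, hL⟩ := eventually_atTop.mp hev
  refine eventually_atTop.mpr ⟨L + N, fun m hm => ?_⟩
  have := hL (m - N) (by omega)
  rwa [Nat.sub_add_cancel (by omega)] at this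

theorem norm_relaxed_sq_le {E : Type*} [NormedAddCommGroup E] [NormedSpace ℝ E] {τ : ℝ}
    (h0 : 0 ≤ τ) (h1 : τ ≤ 1) (x y z : E) :
    ‖(1 - τ) • x + τ • y - z‖ ^ 2 ≤ (1 - τ) * ‖x - z‖ ^ 2 + τ * ‖y - z‖ ^ 2 := by
  have e : (1 - τ) • x + τ • y - z = (1 - τ) • (x - z) + τ • (y - z) := by module
  have h2 : ‖(1 - τ) • x + τ • y - z‖ ≤ (1 - τ) * ‖x - z‖ + τ * ‖y - z‖ := by
    rw [e]
    refine (norm_add_le _ _).trans (le_of_eq ?_)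
    rw [norm_smul, norm_smul, Real.norm_of_nonneg h0, Real.norm_of_nonneg (by linarith)]
  have h3 := pow_le_pow_left₀ (norm_nonneg _) h2 2
  nlinarith [mul_nonneg (mul_nonneg h0 (by linarith : 0 ≤ 1 - τ)) (sq_nonneg (‖x - z‖ - ‖y - z‖))]

namespace AlgFamilies

variable {K X : Type*} {S : Setting K X} {P : AlgParams K} {R : AlgFamilies K}
variable {A : K → ℝ} {gp : K → ℝ → ℝ≥0∞} {u v p : ℕ → EllTwo K} {uh : EllTwo K}

theorem IsOrbit.obj_error {hS : S.Standing} (hO : R.IsOrbit hS gp P u v p) (hR : R.IsRun S P)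
    (hP : P.Admissible S) (hN : S.IsNormalization A gp) {B : ℝ}
    (hB : ∀ m, ‖u m - uh‖ ≤ B ∧ ‖v m - uh‖ ≤ B ∧ ‖p m - uh‖ ≤ B) :
    ∃ C : ℝ, 0 ≤ C ∧ ∀ m, Gsum gp (v m) ≠ ⊤ ∧
      hS.obj A gp (v m) ≤ hS.obj A gp (p m) + C * P.decay m := by
  obtain ⟨Bc, -, hBc⟩ := hO.chi_bounded hP fun m => (hB m).1
  obtain ⟨M, hM0, hM⟩ := hO.Gsum_error hR hP hN hBc
  obtain ⟨L, hL0, hL⟩ := sqLoss_lipschitz_on_bounded S.y hS.n_pos hS.norm_feat_le (B + ‖uh‖)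
  have hl := hS.lam_pos
  have hz := hP.zeta_pos
  refine ⟨L * (P.zeta * √(∑' k, P.xi k ^ 2)) + S.lam * M, by positivity, fun m => ?_⟩
  have hd := P.decay_pos m
  have hfin := ENNReal.add_ne_top.mpr ⟨hO.ne_top m, ENNReal.ofReal_ne_top (r := M * P.decay m)⟩
  refine ⟨ne_top_of_le_ne_top hfin (hM m), ?_⟩
  have h1 := ENNReal.toReal_mono hfin (hM m)
  rw [ENNReal.toReal_add (hO.ne_top m) ENNReal.ofReal_ne_top,
    ENNReal.toReal_ofReal (by positivity)] at h1
  have hvn : ‖v m‖ ≤ B + ‖uh‖ := by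
    have := norm_add_le (v m - uh) uh
    rw [sub_add_cancel] at this
    linarith [(hB m).2.1]
  have h2 := hL (p m) (v m) hvn
  have h3 := mul_le_mul_of_nonneg_left (hO.dist_le m) hL0
  have h4 := mul_le_mul_of_nonneg_left h1 hl.le
  unfold Standing.obj Standing.loss
  linarith

theorem IsOrbit.summable_obj {hS : S.Standing} (hO : R.IsOrbit hS gp P u v p) (hR : R.IsRun S P)
    (hP : P.Admissible S) (hN : S.IsNormalization A gp) (huh : Gsum gp uh ≠ ⊤)
    (hmin : ∀ w, Gsum gp w ≠ ⊤ → hS.obj A gp uh ≤ hS.obj A gp w) :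
    (∀ m, Gsum gp (v m) ≠ ⊤) ∧ Summable fun m => hS.obj A gp (v m) - hS.obj A gp uh := by
  obtain ⟨B, hB0, hB⟩ := hO.bounded hP hN huh hmin
  obtain ⟨C, hC0, hC⟩ := hO.obj_error hR hP hN hB
  obtain ⟨c, Cf, hc, hCf, hF⟩ := hO.fejer hP hN huh hmin
  obtain ⟨τ0, hτ0, hτ⟩ := hP.tau_bounds
  obtain ⟨lo, hi, hlo, hhi, hg⟩ := hP.gam_bounds
  have hl := hS.lam_pos
  have hz := hP.zeta_pos
  set D := P.zeta * √(∑' k, P.xi k ^ 2) with hD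
  have hD0 : 0 ≤ D := by positivity
  have hdp := fun m => (P.decay_pos m).le
  set a : ℕ → ℝ := fun m => ‖u m - uh‖ ^ 2 with ha
  set d : ℕ → ℝ := fun m => ‖v m - uh‖ ^ 2 with hd
  set x : ℕ → ℝ := fun m => ‖u m - p m‖ ^ 2 with hx
  set e : ℕ → ℝ := fun m => 2 * Cf * B * ‖P.b m‖ + 2 * B * D * P.decay m with he
  have hes : Summable e := (hP.b_summable.mul_left _).add (hP.summable_decay.mul_left _)
  have he0 : ∀ m, 0 ≤ e m := fun m => by
    have := hdp m
    positivity
  have hdp' : ∀ m, d m ≤ ‖p m - uh‖ ^ 2 + 2 * B * D * P.decay m := fun m => by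
    have h1 := norm_add_le (v m - p m) (p m - uh)
    rw [sub_add_sub_cancel] at h1
    have h2 : ‖v m - uh‖ - ‖p m - uh‖ ≤ D * P.decay m := by linarith [hO.dist_le m]
    have h3 : ‖v m - uh‖ + ‖p m - uh‖ ≤ 2 * B := by linarith [(hB m).2.1, (hB m).2.2]
    have h4 := mul_le_mul_of_nonneg_right h2
      (by positivity : 0 ≤ ‖v m - uh‖ + ‖p m - uh‖)
    have h5 := mul_le_mul_of_nonneg_left h3 (mul_nonneg hD0 (hdp m))
    simp only [hd]
    linarith
  have h1 : ∀ m, d m ≤ a m - c * x m + e m := fun m => by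
    have h2 := hF m
    have h3 : Cf * ‖P.b m‖ * ‖p m - uh‖ ≤ Cf * ‖P.b m‖ * B :=
      mul_le_mul_of_nonneg_left (hB m).2.2 (by positivity)
    simp only [ha, hx, he]
    linarith [hdp' m]
  have h2 : ∀ m, a (m + 1) ≤ (1 - P.tau m) * a m + P.tau m * d m := fun m => by
    simp only [ha, hd]
    rw [hO.succ m]
    exact norm_relaxed_sq_le (hτ0.le.trans (hτ m).1) (hτ m).2 _ _ _
  obtain ⟨hxs, hys⟩ := summable_of_fejer hc hτ0 hτ (fun m => sq_nonneg _) (fun m => sq_nonneg _)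
    he0 hes h1 h2
  refine ⟨fun m => (hC m).1, ?_⟩
  have hbound : Summable fun m => S.lam / (2 * lo) * ((a m - d m + e m) + 2 * B * D * P.decay m)
      + S.kappa ^ 2 * x m + ‖P.b m‖ * B + C * P.decay m :=
    (((((hys.add (hP.summable_decay.mul_left _)).mul_left _).add (hxs.mul_left _)).add
      (hP.b_summable.mul_right _)).add (hP.summable_decay.mul_left _))
  refine Summable.of_nonneg_of_le (fun m => sub_nonneg.mpr (hmin _ (hC m).1)) (fun m => ?_) hbound
  have hg0 : 0 < P.gam m := hlo.trans_le (hg m).1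
  have h3 := hS.forward_backward_le_min (A := A) hg0 (hO.variational m uh huh)
  have h4 : ‖P.b m‖ * ‖p m - uh‖ ≤ ‖P.b m‖ * B :=
    mul_le_mul_of_nonneg_left (hB m).2.2 (norm_nonneg _)
  have hy0 : 0 ≤ (a m - d m + e m) + 2 * B * D * P.decay m := by
    have h5 : 0 ≤ c * x m := by positivity
    have h6 : 0 ≤ 2 * B * D * P.decay m := mul_nonneg (by positivity) (hdp m)
    linarith [h1 m]
  have h5 : S.lam / (2 * P.gam m) * (‖u m - uh‖ ^ 2 - ‖p m - uh‖ ^ 2) ≤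
      S.lam / (2 * lo) * ((a m - d m + e m) + 2 * B * D * P.decay m) := by
    have h6 : ‖u m - uh‖ ^ 2 - ‖p m - uh‖ ^ 2 ≤ (a m - d m + e m) + 2 * B * D * P.decay m := by
      simp only [ha]
      linarith [hdp' m, he0 m]
    refine (mul_le_mul_of_nonneg_left h6 (by positivity)).trans
      (mul_le_mul_of_nonneg_right ?_ hy0)
    have := (hg m).1
    gcongr
  linarith [(hC m).2]

theorem IsOrbit.obj_succ {hS : S.Standing} (hO : R.IsOrbit hS gp P u v p) (hP : P.Admissible S)
    (hN : S.IsNormalization A gp) {m : ℕ} (hu : Gsum gp (u m) ≠ ⊤) (hv : Gsum gp (v m) ≠ ⊤) :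
    Gsum gp (u (m + 1)) ≠ ⊤ ∧ hS.obj A gp (u (m + 1)) ≤
      (1 - P.tau m) * hS.obj A gp (u m) + P.tau m * hS.obj A gp (v m) := by
  obtain ⟨τ0, hτ0, hτ⟩ := hP.tau_bounds
  have h0 : 0 < P.tau m := hτ0.trans_le (hτ m).1
  rw [hO.succ m]
  rcases (hτ m).2.eq_or_lt with h | h
  · rw [h, sub_self, zero_smul, one_smul, zero_add, zero_mul, one_mul, zero_add]
    exact ⟨hv, le_rfl⟩
  · exact ⟨(hN.Gsum_convex_toReal hu hv (by linarith) h0 (by ring)).1,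
      hS.obj_convex hN hu hv (by linarith) h0 (by ring)⟩

theorem IsOrbit.obj_le_add {hS : S.Standing} (hO : R.IsOrbit hS gp P u v p) (hR : R.IsRun S P)
    (hP : P.Admissible S) (hN : S.IsNormalization A gp) (huh : Gsum gp uh ≠ ⊤)
    (hmin : ∀ w, Gsum gp w ≠ ⊤ → hS.obj A gp uh ≤ hS.obj A gp w) :
    ∃ c C : ℝ, 0 ≤ c ∧ 0 ≤ C ∧ ∀ m, Gsum gp (u m) ≠ ⊤ →
      hS.obj A gp (u (m + 1)) ≤ hS.obj A gp (u m) + (c * ‖P.b m‖ + C * P.decay m) := by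
  obtain ⟨B, hB0, hB⟩ := hO.bounded hP hN huh hmin
  obtain ⟨C, hC0, hC⟩ := hO.obj_error hR hP hN hB
  obtain ⟨τ0, hτ0, hτ⟩ := hP.tau_bounds
  obtain ⟨lo, hi, hlo, hhi, hg⟩ := hP.gam_bounds
  refine ⟨2 * B, C, by positivity, hC0, fun m hu => ?_⟩
  have hg0 : 0 < P.gam m := hlo.trans_le (hg m).1
  have h1 := hS.forward_backward_le_self (A := A) hg0 ((hg m).2.trans_lt hhi)
    (hO.variational m (u m) hu)
  have h2 : ‖p m - u m‖ ≤ 2 * B := by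
    have := norm_sub_le (p m - uh) (u m - uh)
    rw [sub_sub_sub_cancel_right] at this
    linarith [(hB m).1, (hB m).2.2]
  have h3 := mul_le_mul_of_nonneg_left h2 (norm_nonneg (P.b m))
  have h4 := (hO.obj_succ hP hN hu (hC m).1).2
  have h5 : 0 ≤ 2 * B * ‖P.b m‖ + C * P.decay m := by
    have := (P.decay_pos m).le
    positivity
  have h6 : hS.obj A gp (v m) ≤ hS.obj A gp (u m) + (2 * B * ‖P.b m‖ + C * P.decay m) := by
    linarith [(hC m).2]
  have h7 := mul_le_mul_of_nonneg_left h6 (hτ0.le.trans (hτ m).1)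
  have h8 := mul_le_mul_of_nonneg_right (hτ m).2 h5
  linarith

end AlgFamilies

/-- The `r`-th power of the `ℓ^r` norm. -/
def powSum {K : Type*} (r : ℝ) (x : K → ℝ) : ℝ≥0∞ := ∑' k, ‖x k‖ₑ ^ r

theorem enorm_rpow_eq {r : ℝ} (hr : 0 ≤ r) (x : ℝ) : ‖x‖ₑ ^ r = ENNReal.ofReal (|x| ^ r) := by
  rw [← ofReal_norm, ENNReal.ofReal_rpow_of_nonneg (norm_nonneg _) hr, Real.norm_eq_abs]

theorem powSum_ne_top {K : Type*} {r : ℝ} (hr : 1 < r) {x : K → ℝ}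
    (hx : Memℓp x (ENNReal.ofReal r)) : powSum r x ≠ ⊤ := by
  have hr' : (ENNReal.ofReal r).toReal = r := ENNReal.toReal_ofReal (by linarith)
  rw [memℓp_gen_iff (by rw [hr']; linarith), hr'] at hx
  unfold powSum
  simp only [enorm_rpow_eq (show 0 ≤ r by linarith)]
  exact hx.tsum_ofReal_ne_top

theorem powSum_relaxed_le {K : Type*} {r τ : ℝ} (hr : 1 < r) (h0 : 0 ≤ τ) (h1 : τ ≤ 1)
    (x y z : EllTwo K) : powSum r (⇑((1 - τ) • x + τ • y) - ⇑z) ≤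
      ENNReal.ofReal (1 - τ) * powSum r (⇑x - ⇑z) + ENNReal.ofReal τ * powSum r (⇑y - ⇑z) := by
  unfold powSum
  rw [← ENNReal.tsum_mul_left, ← ENNReal.tsum_mul_left, ← ENNReal.tsum_add]
  refine ENNReal.tsum_le_tsum fun k => ?_
  rw [enorm_rpow_eq (by linarith), enorm_rpow_eq (by linarith), enorm_rpow_eq (by linarith),
    ← ENNReal.ofReal_mul (by linarith), ← ENNReal.ofReal_mul h0,
    ← ENNReal.ofReal_add (mul_nonneg (by linarith) (by positivity)) (by positivity)]
  refine ENNReal.ofReal_le_ofReal ?_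
  have := convex_abs_rpow hr (by linarith : 0 ≤ 1 - τ) h0 (by ring) (x k - z k) (y k - z k)
  refine le_trans (le_of_eq ?_) this
  congr 2
  simp only [lp.coeFn_add, lp.coeFn_smul, Pi.sub_apply, Pi.add_apply, Pi.smul_apply, smul_eq_mul]
  ring

theorem powSum_eq_lrENorm_rpow {K : Type*} {r : ℝ} (hr : 1 < r) (x : K → ℝ) :
    powSum r x = lrENorm r x ^ r := by
  unfold lrENorm powSum
  rw [← ENNReal.rpow_mul, one_div_mul_cancel (by linarith), ENNReal.rpow_one]

theorem tendsto_powSum_zero {K : Type*} {r : ℝ} (hr : 1 < r) {x : ℕ → K → ℝ}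
    (h : Tendsto (fun m => lrENorm r (x m)) atTop (𝓝 0)) :
    Tendsto (fun m => powSum r (x m)) atTop (𝓝 0) := by
  have := ((ENNReal.continuous_rpow_const (y := r)).tendsto 0).comp h
  rw [ENNReal.zero_rpow_of_pos (by linarith)] at this
  exact this.congr fun m => (powSum_eq_lrENorm_rpow hr _).symm

theorem tendsto_lrENorm_zero {K : Type*} {r : ℝ} (hr : 1 < r) {x : ℕ → K → ℝ}
    (h : Tendsto (fun m => powSum r (x m)) atTop (𝓝 0)) :
    Tendsto (fun m => lrENorm r (x m)) atTop (𝓝 0) := by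
  have := ((ENNReal.continuous_rpow_const (y := 1 / r)).tendsto 0).comp h
  rwa [ENNReal.zero_rpow_of_pos (by positivity)] at this

theorem tendsto_const_mul_rpow_half {g : ℕ → ℝ≥0∞} (hg : Tendsto g atTop (𝓝 0)) (c : ℝ≥0) :
    Tendsto (fun m => (c : ℝ≥0∞) * g m ^ (1 / 2 : ℝ)) atTop (𝓝 0) := by
  have h1 := ((ENNReal.continuous_rpow_const (y := 1 / 2)).tendsto 0).comp hg
  rw [ENNReal.zero_rpow_of_pos (by norm_num)] at h1
  have h2 := ENNReal.Tendsto.const_mul (a := (c : ℝ≥0∞)) h1 (Or.inr ENNReal.coe_ne_top)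
  rwa [mul_zero] at h2

theorem tendsto_ofReal_zero {f : ℕ → ℝ} (h : Tendsto f atTop (𝓝 0)) :
    Tendsto (fun m => ENNReal.ofReal (f m)) atTop (𝓝 0) := by
  have := (ENNReal.continuous_ofReal.tendsto 0).comp h
  rwa [ENNReal.ofReal_zero] at this

namespace AlgFamilies

variable {K X : Type*} {S : Setting K X} {P : AlgParams K} {R : AlgFamilies K}
variable {A : K → ℝ} {gp : K → ℝ → ℝ≥0∞} {u v p : ℕ → EllTwo K} {uh : EllTwo K}

theorem IsOrbit.tendsto_lrENorm_u {hS : S.Standing} (hO : R.IsOrbit hS gp P u v p)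
    (hP : P.Admissible S) (huh : Memℓp (uh : K → ℝ) (ENNReal.ofReal S.r))
    (hvlim : Tendsto (fun m => lrENorm S.r (⇑(v m) - ⇑uh)) atTop (𝓝 0))
    (hvfin : ∀ m, lrENorm S.r (⇑(v m) - ⇑uh) ≠ ⊤) {M : ℕ}
    (hM : Memℓp (u M : K → ℝ) (ENNReal.ofReal S.r)) :
    Tendsto (fun m => lrENorm S.r (⇑(u m) - ⇑uh)) atTop (𝓝 0) := by
  have hr := hS.one_lt_r
  obtain ⟨τ0, hτ0, hτ⟩ := hP.tau_bounds
  set n : ℕ → ℝ≥0∞ := fun m => powSum S.r (⇑(u (m + M)) - ⇑uh) with hn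
  set nv : ℕ → ℝ≥0∞ := fun m => powSum S.r (⇑(v (m + M)) - ⇑uh) with hnv
  have hnvfin : ∀ m, nv m ≠ ⊤ := fun m => by
    simp only [hnv, powSum_eq_lrENorm_rpow hr]
    exact ENNReal.rpow_ne_top_of_nonneg (by linarith) (hvfin _)
  have hstep : ∀ m, n (m + 1) ≤
      ENNReal.ofReal (1 - P.tau (m + M)) * n m + ENNReal.ofReal (P.tau (m + M)) * nv m := by
    intro m
    simp only [hn, hnv]
    rw [show m + 1 + M = m + M + 1 by ring, hO.succ]
    exact powSum_relaxed_le hr (hτ0.le.trans (hτ _).1) (hτ _).2 _ _ _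
  have hrhs : ∀ m, n m ≠ ⊤ → ENNReal.ofReal (1 - P.tau (m + M)) * n m +
      ENNReal.ofReal (P.tau (m + M)) * nv m ≠ ⊤ := fun m hm =>
    ENNReal.add_ne_top.mpr ⟨ENNReal.mul_ne_top ENNReal.ofReal_ne_top hm,
      ENNReal.mul_ne_top ENNReal.ofReal_ne_top (hnvfin m)⟩
  have hnfin : ∀ m, n m ≠ ⊤ := by
    intro m
    induction m with
    | zero =>
      simp only [hn, zero_add]
      exact powSum_ne_top hr (hM.sub huh)
    | succ m ih => exact ne_top_of_le_ne_top (hrhs m ih) (hstep m)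
  have hnv0 : Tendsto (fun m => (nv m).toReal) atTop (𝓝 0) := by
    have h1 := (tendsto_add_atTop_iff_nat M).mpr (tendsto_powSum_zero hr hvlim)
    have h2 := (ENNReal.tendsto_toReal ENNReal.zero_ne_top).comp h1
    exact h2
  have hreal : Tendsto (fun m => (n m).toReal) atTop (𝓝 0) := by
    refine tendsto_zero_of_relaxed (τ := fun m => P.tau (m + M)) hτ0 (fun m => hτ _)
      (fun m => ENNReal.toReal_nonneg) hnv0 fun m => ?_
    have h1 := ENNReal.toReal_mono (hrhs m (hnfin m)) (hstep m)
    rwa [ENNReal.toReal_add (ENNReal.mul_ne_top ENNReal.ofReal_ne_top (hnfin m))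
      (ENNReal.mul_ne_top ENNReal.ofReal_ne_top (hnvfin m)), ENNReal.toReal_mul,
      ENNReal.toReal_mul, ENNReal.toReal_ofReal (by linarith [(hτ (m + M)).2]),
      ENNReal.toReal_ofReal (hτ0.le.trans (hτ _).1)] at h1
  have h3 := tendsto_ofReal_zero hreal
  refine tendsto_lrENorm_zero hr ((tendsto_add_atTop_iff_nat M).mp ?_)
  exact h3.congr fun m => ENNReal.ofReal_toReal (hnfin m)

/-- The behaviour of the objective along the iterates from the first index at which it is
finite. -/
theorem IsOrbit.objective_tail {hS : S.Standing} (hO : R.IsOrbit hS gp P u v p)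
    (hR : R.IsRun S P) (hP : P.Admissible S) (hN : S.IsNormalization A gp)
    (huh : Gsum gp uh ≠ ⊤) (hmin : ∀ w, Gsum gp w ≠ ⊤ → hS.obj A gp uh ≤ hS.obj A gp w) {M : ℕ}
    (hM : Gsum gp (u M) ≠ ⊤) :
    (∀ m, Gsum gp (u (m + M)) ≠ ⊤) ∧
      (Summable fun m => hS.obj A gp (u (m + M)) - hS.obj A gp uh) ∧
      ((Summable fun m : ℕ => (m : ℝ) * ‖P.b m‖) → Tendsto (fun m : ℕ => ((m + M : ℕ) : ℝ) *
        (hS.obj A gp (u (m + M)) - hS.obj A gp uh)) atTop (𝓝 0)) := by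
  obtain ⟨τ0, hτ0, hτ⟩ := hP.tau_bounds
  obtain ⟨hv, hvs⟩ := hO.summable_obj hR hP hN huh hmin
  have hfin : ∀ m, Gsum gp (u (m + M)) ≠ ⊤ := by
    intro m
    induction m with
    | zero => simpa using hM
    | succ m ih =>
      rw [show m + 1 + M = m + M + 1 by ring]
      exact (hO.obj_succ hP hN ih (hv _)).1
  have hpos : ∀ m, 0 ≤ hS.obj A gp (u (m + M)) - hS.obj A gp uh := fun m =>
    sub_nonneg.mpr (hmin _ (hfin m))
  have hsum : Summable fun m => hS.obj A gp (u (m + M)) - hS.obj A gp uh := by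
    refine summable_of_relaxed (τ := fun m => P.tau (m + M))
      (V := fun m => hS.obj A gp (v (m + M)) - hS.obj A gp uh) hτ0 (fun m => hτ _) hpos
      (fun m => sub_nonneg.mpr (hmin _ (hv _))) ((summable_nat_add_iff M).mpr hvs) fun m => ?_
    have h1 := (hO.obj_succ hP hN (hfin m) (hv (m + M))).2
    rw [show m + 1 + M = m + M + 1 by ring]
    linarith
  refine ⟨hfin, hsum, fun hb => ?_⟩
  obtain ⟨c, C, hc, hC, hle⟩ := hO.obj_le_add hR hP hN huh hmin
  have hθ0 : ∀ m, 0 ≤ c * ‖P.b m‖ + C * P.decay m := fun m => by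
    have := (P.decay_pos m).le
    positivity
  have hθs : Summable fun m => c * ‖P.b m‖ + C * P.decay m :=
    (hP.b_summable.mul_left c).add (hP.summable_decay.mul_left C)
  have hmθ : Summable fun m : ℕ => (m : ℝ) * (c * ‖P.b m‖ + C * P.decay m) := by
    refine ((hb.mul_left c).add (hP.summable_mul_decay.mul_left C)).congr fun m => by ring
  have hlim := tendsto_nat_mul_of_summable (θ := fun m => c * ‖P.b (m + M)‖ + C * P.decay (m + M))
    hpos hsum (fun m => hθ0 _) ((summable_nat_add_iff M).mpr hθs) (by
      refine Summable.of_nonneg_of_le (fun m => mul_nonneg (Nat.cast_nonneg m) (hθ0 _)) (fun m => ?_)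
        ((summable_nat_add_iff M).mpr hmθ)
      refine mul_le_mul_of_nonneg_right ?_ (hθ0 _)
      exact_mod_cast Nat.le_add_right m M) (fun m => by
      have := hle (m + M) (hfin m)
      rw [show m + 1 + M = m + M + 1 by ring]
      linarith)
  have h2 := hlim.add (hsum.tendsto_atTop_zero.const_mul (M : ℝ))
  rw [mul_zero, add_zero] at h2
  refine h2.congr fun m => ?_
  push_cast; ring

end AlgFamilies

theorem Setting.Standing.minimizer_spec {K X : Type*} {S : Setting K X} {A : K → ℝ}
    {gp : K → ℝ → ℝ≥0∞} (hS : S.Standing) (hN : S.IsNormalization A gp) {uh : EllTwo K}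
    (huh : Gsum gp uh ≠ ⊤) (hmin : ∀ w, Gsum gp w ≠ ⊤ → hS.obj A gp uh ≤ hS.obj A gp w)
    (w : EllTwo K) (hw : ∀ w', S.J w ≤ S.J w') : w = uh := by
  have h1 := hw uh
  have hwfin : Gsum gp w ≠ ⊤ := by
    rw [← hS.J_ne_top_iff hN]
    exact ne_top_of_le_ne_top ((hS.J_ne_top_iff hN).mpr huh) h1
  rw [hS.J_eq_obj hN hwfin, hS.J_eq_obj hN huh] at h1
  exact hS.eq_of_obj_le hN huh hmin hwfin (EReal.coe_le_coe_iff.mp h1)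

end

theorem theorem3 {K X : Type*} [Countable K] (S : Setting K X) (hS : S.Standing) :
    ∃ uhat : EllTwo K,
      -- `J` is proper and `uhat` is its unique minimizer, which lies in `ℓ^r`
      (∀ w, S.J w ≠ ⊥) ∧ S.J uhat ≠ ⊤ ∧
      (∀ w, S.J uhat ≤ S.J w) ∧
      (∀ w, (∀ w', S.J w ≤ S.J w') → w = uhat) ∧
      Memℓp (uhat : K → ℝ) (ENNReal.ofReal S.r) ∧
      ∀ (P : AlgParams K) (R : AlgFamilies K), P.Admissible S → R.IsRun S P →
        -- the iterates are well defined in `ℓ²`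
        ∃ u v : ℕ → EllTwo K,
          (∀ m k, u m k = R.mu m k) ∧ (∀ m k, v m k = R.nu m k) ∧
          -- objective values
          (∑' m, S.gap (v m) ^ 2 < ⊤) ∧
          ((∃ M, S.J (u M) ≠ ⊤) → Tendsto (fun m => S.J (u m)) atTop (𝓝 (⨅ w, S.J w))) ∧
          -- convergence in `ℓ^r`
          Tendsto (fun m => lrENorm S.r (⇑(v m) - ⇑uhat)) atTop (𝓝 0) ∧
          ((∃ M, Memℓp (u M : K → ℝ) (ENNReal.ofReal S.r) ∨ S.J (u M) ≠ ⊤) →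
            Tendsto (fun m => lrENorm S.r (⇑(u m) - ⇑uhat)) atTop (𝓝 0)) ∧
          (∃ c : ℝ≥0, ∀ m, lrENorm S.r (⇑(v m) - ⇑uhat) ≤ c * S.gap (v m) ^ (1 / 2 : ℝ)) ∧
          (∃ c : ℝ≥0, ∀ m, lrENorm S.r (⇑(u m) - ⇑uhat) ≤ c * S.gap (u m) ^ (1 / 2 : ℝ)) ∧
          -- summability of the gaps
          (Summable (fun m => 1 - P.tau m) →
            (∑' m, S.gap (v m) < ⊤) ∧
            ∀ M, S.J (u M) ≠ ⊤ → ∑' m, S.gap (u (M + m)) < ⊤) ∧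
          -- rates
          (2 < P.p → Summable (fun m => 1 - P.tau m) →
            Summable (fun m : ℕ => (m : ℝ) * ‖P.b m‖) → (∃ M, S.J (u M) ≠ ⊤) →
            Tendsto (fun m : ℕ => (m : ℝ≥0∞) * S.gap (u m)) atTop (𝓝 0) ∧
            Tendsto (fun m : ℕ => (m : ℝ≥0∞) ^ (1 / 2 : ℝ) *
              lrENorm S.r (⇑(u m) - ⇑uhat)) atTop (𝓝 0)) := by
  obtain ⟨A, gp, hN⟩ := hS.exists_normalization
  obtain ⟨uh, huh, hmin⟩ := hS.exists_minimizer hN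
  have hmem := hS.memℓp_of_Gsum_ne_top hN huh
  have hJtop : ∀ {w : EllTwo K}, S.J w ≠ ⊤ ↔ Setting.Gsum gp w ≠ ⊤ := hS.J_ne_top_iff hN
  refine ⟨uh, hS.J_ne_bot hN, hJtop.mpr huh, hS.J_isMin hN huh hmin,
    hS.minimizer_spec hN huh hmin, hmem, fun P R hP hR => ?_⟩
  obtain ⟨u, v, p, hO⟩ := hR.exists_orbit hP hS hN
  obtain ⟨hvfin, hvs⟩ := hO.summable_obj hR hP hN huh hmin
  have hgap : ∀ {w : EllTwo K}, Setting.Gsum gp w ≠ ⊤ →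
      S.gap w = ENNReal.ofReal (hS.obj A gp w - hS.obj A gp uh) := hS.gap_eq hN huh hmin
  have hgapv : ∀ m, S.gap (v m) = ENNReal.ofReal (hS.obj A gp (v m) - hS.obj A gp uh) :=
    fun m => hgap (hvfin m)
  have hV0 : ∀ m, 0 ≤ hS.obj A gp (v m) - hS.obj A gp uh :=
    fun m => sub_nonneg.mpr (hmin _ (hvfin m))
  have htail := fun M (hM : S.J (u M) ≠ ⊤) =>
    hO.objective_tail hR hP hN huh hmin (hJtop.mp hM)
  have hVle : ∀ m, hS.obj A gp (v m) - hS.obj A gp uh ≤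
      ∑' j, (hS.obj A gp (v j) - hS.obj A gp uh) := fun m => hvs.le_tsum m fun j _ => hV0 j
  obtain ⟨cv, -, hcv⟩ := hS.lrENorm_growth hN huh hmin
    (∑' j, (hS.obj A gp (v j) - hS.obj A gp uh))
  have hvO : ∀ m, lrENorm S.r (⇑(v m) - ⇑uh) ≤ cv * S.gap (v m) ^ (1 / 2 : ℝ) := fun m => by
    rw [hgapv m]
    exact hcv _ (hvfin m) (hVle m)
  have huO : ∃ c : ℝ≥0, ∀ m, lrENorm S.r (⇑(u m) - ⇑uh) ≤ c * S.gap (u m) ^ (1 / 2 : ℝ) := by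
    by_cases hex : ∃ M, S.J (u M) ≠ ⊤
    · classical
      obtain ⟨hfin, hsum, -⟩ := htail _ (Nat.find_spec hex)
      obtain ⟨c, hc0, hc⟩ := hS.lrENorm_growth hN huh hmin
        (∑' j, (hS.obj A gp (u (j + Nat.find hex)) - hS.obj A gp uh))
      refine ⟨c, fun m => ?_⟩
      rcases lt_or_ge m (Nat.find hex) with hlt | hge
      · have hJ : S.J (u m) = ⊤ := by
          by_contra h
          exact Nat.find_min hex hlt h
        have hG : Setting.Gsum gp (u m) = ⊤ := by
          by_contra h
          exact hJtop.mpr h hJ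
        rw [hS.gap_eq_top hN huh hmin hG, ENNReal.top_rpow_of_pos (by norm_num),
          ENNReal.mul_top (by exact_mod_cast hc0.ne')]
        exact le_top
      · obtain ⟨j, rfl⟩ := Nat.exists_eq_add_of_le' hge
        rw [hgap (hfin j)]
        exact hc _ (hfin j) (hsum.le_tsum j fun i _ => sub_nonneg.mpr (hmin _ (hfin i)))
    · refine ⟨1, fun m => ?_⟩
      have hG : Setting.Gsum gp (u m) = ⊤ := by
        by_contra h
        exact hex ⟨m, hJtop.mpr h⟩
      rw [hS.gap_eq_top hN huh hmin hG, ENNReal.top_rpow_of_pos (by norm_num),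
        ENNReal.mul_top (by simp)]
      exact le_top
  have hgapv0 : Tendsto (fun m => S.gap (v m)) atTop (𝓝 0) :=
    (tendsto_ofReal_zero hvs.tendsto_atTop_zero).congr fun m => (hgapv m).symm
  have hvlim : Tendsto (fun m => lrENorm S.r (⇑(v m) - ⇑uh)) atTop (𝓝 0) :=
    tendsto_of_tendsto_of_tendsto_of_le_of_le tendsto_const_nhds
      (tendsto_const_mul_rpow_half hgapv0 cv) (fun _ => zero_le) hvO
  have hvnorm : ∀ m, lrENorm S.r (⇑(v m) - ⇑uh) ≠ ⊤ := fun m => by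
    refine ne_top_of_le_ne_top ?_ (hvO m)
    rw [hgapv m]
    exact ENNReal.mul_ne_top ENNReal.coe_ne_top
      (ENNReal.rpow_ne_top_of_nonneg (by norm_num) ENNReal.ofReal_ne_top)
  refine ⟨u, v, hO.mu_eq, hO.nu_eq, ?_, ?_, hvlim, ?_, ⟨cv, hvO⟩, huO, ?_, ?_⟩
  · have hsq : Summable fun m => (hS.obj A gp (v m) - hS.obj A gp uh) ^ 2 :=
      Summable.of_nonneg_of_le (fun m => sq_nonneg _)
        (fun m => by rw [sq]; exact mul_le_mul_of_nonneg_right (hVle m) (hV0 m))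
        (hvs.mul_left _)
    rw [lt_top_iff_ne_top]
    simp only [hgapv, ← ENNReal.ofReal_pow (hV0 _)]
    exact hsq.tsum_ofReal_ne_top
  · rintro ⟨M, hM⟩
    obtain ⟨hfin, hsum, -⟩ := htail M hM
    rw [hS.iInf_J hN huh hmin, ← tendsto_add_atTop_iff_nat M]
    have h1 := hsum.tendsto_atTop_zero.add_const (hS.obj A gp uh)
    rw [zero_add] at h1
    refine ((continuous_coe_real_ereal.tendsto _).comp h1).congr fun m => ?_
    rw [Function.comp_apply, sub_add_cancel, hS.J_eq_obj hN (hfin m)]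
  · rintro ⟨M, hM⟩
    refine hO.tendsto_lrENorm_u hP hmem hvlim hvnorm (M := M) ?_
    rcases hM with h | h
    · exact h
    · exact hS.memℓp_of_Gsum_ne_top hN (hJtop.mp h)
  · intro _
    refine ⟨?_, fun M hM => ?_⟩
    · rw [lt_top_iff_ne_top]
      simp only [hgapv]
      exact hvs.tsum_ofReal_ne_top
    · obtain ⟨hfin, hsum, -⟩ := htail M hM
      rw [lt_top_iff_ne_top]
      have e : ∀ m, S.gap (u (M + m)) =
          ENNReal.ofReal (hS.obj A gp (u (m + M)) - hS.obj A gp uh) := fun m => by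
        rw [add_comm M m]
        exact hgap (hfin m)
      simp only [e]
      exact hsum.tsum_ofReal_ne_top
  · rintro - - hb ⟨M, hM⟩
    obtain ⟨hfin, -, hrate⟩ := htail M hM
    have hlim : Tendsto (fun m : ℕ => (m : ℝ≥0∞) * S.gap (u m)) atTop (𝓝 0) := by
      rw [← tendsto_add_atTop_iff_nat M]
      refine (tendsto_ofReal_zero (hrate hb)).congr fun m => ?_
      rw [hgap (hfin m), ENNReal.ofReal_mul (Nat.cast_nonneg _), ENNReal.ofReal_natCast]
    refine ⟨hlim, ?_⟩
    obtain ⟨c, hc⟩ := huO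
    refine tendsto_of_tendsto_of_tendsto_of_le_of_le tendsto_const_nhds
      (tendsto_const_mul_rpow_half hlim c) (fun _ => zero_le) fun m => ?_
    rw [ENNReal.mul_rpow_of_nonneg _ _ (by norm_num), mul_left_comm]
    gcongr
    exact hc m
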